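/- Let $\alpha>2$, and for $\varepsilon>0$ and $X\in\mathbb R^2$ let $g_\varepsilon(X)=\dfrac{1}{\varepsilon+|X|^{\alpha}}$. Given a random interferer field $\Phi\subset\mathbb R^2$, let $$I_\varepsilon(U,t)=\sum_{X\in\Phi}h_{X,U}(t)\,g_\varepsilon(X-U)\qquad(U\in\mathbb R^2,\ t\in\mathbb N),$$ where the power gains $h_{X,U}(t)$ are exponential with mean $1$ (Rayleigh fading), independent over interferers $X$, locations $U$ and slots $t$, and independent of $\Phi$. For $(U_1,t_1)\ne(U_2,t_2)$ put $$\zeta_\varepsilon(U_1,U_2,t_1,t_2)=\frac{\operatorname{cov}\big(I_\varepsilon(U_1,t_1),I_\varepsilon(U_2,t_2)\big)}{\sqrt{\operatorname{var} I_\varepsilon(U_1,t_1)}\,\sqrt{\operatorname{var} I_\varepsilon(U_2,t_2)}},\qquad \zeta(U_1,U_2,t_1,t_2)=\lim_{\varepsilon\downarrow0}\zeta_\varepsilon(U_1,U_2,t_1,t_2);$$ $\zeta$ is the interference correlation coefficient. Consider three interferer fields, all of whose parameters are positive. * PPP: a homogeneous Poisson point process of density $\lambda_P$; write $\zeta_{P,\varepsilon},\zeta_P$.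 * MCP (Matérn cluster process): each point of a Poisson process of density $\lambda_{M^o}$ is the parent of a Poisson number, with mean $c_M$, of points placed independently and uniformly in the disk of radius $R_M$ around it; the interferers are all these daughter points, of density $\lambda_M=\lambda_{M^o}c_M$; write $\zeta_{M,\varepsilon},\zeta_M$. * SOCP (second-order cluster process): each point of a Poisson process of density $\lambda_{S^o}$ is the parent of a Poisson number, with mean $c_{S'}$, of first-order points, displaced from it independently with planar density proportional to $1-e^{-|x|^2/(2\sigma^2)}$ on the disk $|x|\le R_{S'}$; each first-order point has a Poisson number, with mean $c_S$, of daughter points placed independently and uniformly in the disk of radius $R_S$ around it; the interferers are all these daughter points, of density $\lambda_S=\lambda_{S^o}c_{S'}c_S$; write $\zeta_{S,\varepsilon},\zeta_S$. Let $$F_\varepsilon(c,R)=\frac{c}{\pi^2R^4}\int_{\mathbb R^2}\int_{\mathbb R^2}g_\varepsilon(X)\,g_\varepsilon(Y)\,A_R(|X-Y|)\,dX\,dY,$$ where $A_R(r)=2R^2\arccos\frac{r}{2R}-r\sqrt{R^2-\frac{r^2}{4}}$ for $0\le r\le 2R$ and $A_R(r)=0$ otherwise. Then, for every $\varepsilon>0$,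 in all three models the sum $I_\varepsilon(U,t)$ converges almost surely and has finite second moment and positive variance; the limits $\zeta_P,\zeta_M,\zeta_S$ exist for all $(U_1,t_1)\neq(U_2,t_2)$; and the following holds. 1. If $\lambda_P=\lambda_M$, then $\zeta_M\ge\zeta_P$, with equality if $F_\varepsilon(c_M,R_M)=0$ for all sufficiently small $\varepsilon>0$. Moreover, for all sufficiently small $\varepsilon>0$ (and for every $\varepsilon>0$ if $U_1=U_2$), $\zeta_{M,\varepsilon}\ge\zeta_{P,\varepsilon}$, with equality if and only if $F_\varepsilon(c_M,R_M)=0$. 2. If $\lambda_P=\lambda_S$, then $\zeta_S\ge\zeta_P$, with equality if $F_\varepsilon(c_S,R_S)=0$ for all sufficiently small $\varepsilon>0$. Moreover, for all sufficiently small $\varepsilon>0$ (and for every $\varepsilon>0$ if $U_1=U_2$), $\zeta_{S,\varepsilon}\ge\zeta_{P,\varepsilon}$, with equality if and only if $F_\varepsilon(c_S,R_S)=0$. -/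

import Mathlib

open MeasureTheory ProbabilityTheory Filter Topology

/-- The plane, with the Euclidean norm and Lebesgue measure. -/
abbrev Plane : Type := EuclideanSpace ℝ (Fin 2)

namespace Interference

section PointProcesses

variable {Ω : Type*}

/-- The number of points (with multiplicity) of the enumerated configuration `Z` lying in `A`. -/
noncomputable def pointCount (Z : ℕ → Ω → Plane) (A : Set Plane) (ω : Ω) : ℕ∞ :=
  {n : ℕ | Z n ω ∈ A}.encard

/-- `Z 0, Z 1, …` is a measurable enumeration of the points of a homogeneous Poisson point process
of density `lam` on the plane: counts in sets of finite area are Poisson, and counts in pairwise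
disjoint sets are independent. -/
structure IsPoissonProcess [MeasurableSpace Ω] (μ : Measure Ω) (lam : ℝ)
    (Z : ℕ → Ω → Plane) : Prop where
  measurable : ∀ n, Measurable (Z n)
  count_law : ∀ A : Set Plane, MeasurableSet A → volume A ≠ ⊤ →
    HasLaw (pointCount Z A)
      ((poissonMeasure (lam * volume.real A).toNNReal).map (fun k : ℕ => (k : ℕ∞))) μ
  count_indep : ∀ (m : ℕ) (A : Fin m → Set Plane), (∀ i, MeasurableSet (A i)) →
    (∀ i, volume (A i) ≠ ⊤) → (∀ i j, i ≠ j → Disjoint (A i) (A j)) →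
    iIndepFun (fun i => pointCount Z (A i)) μ

/-- Radial profile of the uniform density on the disk of radius `R`. -/
noncomputable def uniformDiskDensity (R r : ℝ) : ℝ :=
  open Classical in if r ≤ R then 1 / (Real.pi * R ^ 2) else 0

/-- Radial profile of the reverse Gaussian density with standard deviation `σ` on the disk of
radius `R`. -/
noncomputable def reverseGaussianDensity (σ R r : ℝ) : ℝ :=
  open Classical in
  if r ≤ R then
    (1 - Real.exp (-r ^ 2 / (2 * σ ^ 2))) /
      (Real.pi * R ^ 2 + 2 * Real.pi * σ ^ 2 * (Real.exp (-R ^ 2 / (2 * σ ^ 2)) - 1))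
  else 0

/-- The rotation invariant measure on the plane with density `x ↦ f ‖x‖`. -/
noncomputable def radialLaw (f : ℝ → ℝ) : Measure Plane :=
  volume.withDensity (fun x => ENNReal.ofReal (f ‖x‖))

/-- A field of interferers indexed by `ι`: in the outcome `ω`, the interferers are those labels `i`
with `present i ω`; interferer `i` sits at `pos i ω` and has power gain `fade i U t ω` towards
the location `U` in slot `t`. This is only the raw data from which interference is computed. -/
structure InterfererField (Ω ι : Type*) where
  present : ι → Ω → Prop
  pos : ι → Ω → Plane
  fade : ι → Plane → ℕ → Ω → ℝ

/-- The sources of randomness in the PPP model. -/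
inductive PPPSource : Type where
  | points
  | fading (i : ℕ) (U : Plane) (t : ℕ)

/-- Interferers forming a Poisson point process of density `lam`, with independent unit-mean
Rayleigh fading (exponential power gains). -/
structure PPPModel [MeasurableSpace Ω] (μ : Measure Ω) (lam : ℝ) where
  Z : ℕ → Ω → Plane
  h : ℕ → Plane → ℕ → Ω → ℝ
  poisson : IsPoissonProcess μ lam Z
  measurable_h : ∀ i U t, Measurable (h i U t)
  law_h : ∀ i U t, HasLaw (h i U t) (expMeasure 1) μ
  indep : iIndep (fun s : PPPSource => match s with
    | .points => MeasurableSpace.comap (fun ω n => Z n ω) inferInstance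
    | .fading i U t => MeasurableSpace.comap (h i U t) inferInstance) μ

/-- The interferer field of the PPP model. -/
def PPPModel.field [MeasurableSpace Ω] {μ : Measure Ω} {lam : ℝ} (P : PPPModel μ lam) :
    InterfererField Ω ℕ where
  present _ _ := True
  pos := P.Z
  fade := P.h

/-- The sources of randomness in the MCP model. -/
inductive MCPSource : Type where
  | parents
  | number (n : ℕ)
  | offset (n k : ℕ)
  | fading (i : ℕ × ℕ) (U : Plane) (t : ℕ)

/-- Interferers forming a Matérn cluster process: the parents `Z n` form a Poisson process of
density `lamO`; the cluster of `Z n` consists of the points `Z n + Y n k`, `k < N n`, where `N n` is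
Poisson with mean `c` and `Y n k` is uniform on the disk of radius `R`; fading is Rayleigh with unit
mean; all these are independent. -/
structure MCPModel [MeasurableSpace Ω] (μ : Measure Ω) (lamO c R : ℝ) where
  Z : ℕ → Ω → Plane
  N : ℕ → Ω → ℕ
  Y : ℕ → ℕ → Ω → Plane
  h : ℕ × ℕ → Plane → ℕ → Ω → ℝ
  poisson : IsPoissonProcess μ lamO Z
  measurable_N : ∀ n, Measurable (N n)
  law_N : ∀ n, HasLaw (N n) (poissonMeasure c.toNNReal) μ
  measurable_Y : ∀ n k, Measurable (Y n k)
  law_Y : ∀ n k, HasLaw (Y n k) (radialLaw (uniformDiskDensity R)) μ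
  measurable_h : ∀ i U t, Measurable (h i U t)
  law_h : ∀ i U t, HasLaw (h i U t) (expMeasure 1) μ
  indep : iIndep (fun s : MCPSource => match s with
    | .parents => MeasurableSpace.comap (fun ω n => Z n ω) inferInstance
    | .number n => MeasurableSpace.comap (N n) inferInstance
    | .offset n k => MeasurableSpace.comap (Y n k) inferInstance
    | .fading i U t => MeasurableSpace.comap (h i U t) inferInstance) μ

/-- The interferer field of the MCP model: all daughter points. -/
def MCPModel.field [MeasurableSpace Ω] {μ : Measure Ω} {lamO c R : ℝ}
    (M : MCPModel μ lamO c R) : InterfererField Ω (ℕ × ℕ) where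
  present i ω := i.2 < M.N i.1 ω
  pos i ω := M.Z i.1 ω + M.Y i.1 i.2 ω
  fade := M.h

/-- The sources of randomness in the SOCP model. -/
inductive SOCPSource : Type where
  | parents
  | number₁ (n : ℕ)
  | offset₁ (n k : ℕ)
  | number₂ (n k : ℕ)
  | offset₂ (n k l : ℕ)
  | fading (i : ℕ × ℕ × ℕ) (U : Plane) (t : ℕ)

/-- Interferers forming a second-order cluster process: the parents `Z n` form a Poisson process of
density `lamO`; the first-order points of `Z n` are `Z n + V n k`, `k < N₁ n`, where `N₁ n` is Poisson
with mean `c₁` and `V n k` is reverse Gaussian on the disk of radius `R₁`; the daughters of the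
first-order point `(n, k)` are `Z n + V n k + W n k l`, `l < N₂ n k`, where `N₂ n k` is Poisson with
mean `c` and `W n k l` is uniform on the disk of radius `R`; fading is Rayleigh with unit mean; all
these are independent. -/
structure SOCPModel [MeasurableSpace Ω] (μ : Measure Ω) (lamO c₁ R₁ σ c R : ℝ) where
  Z : ℕ → Ω → Plane
  N₁ : ℕ → Ω → ℕ
  V : ℕ → ℕ → Ω → Plane
  N₂ : ℕ → ℕ → Ω → ℕ
  W : ℕ → ℕ → ℕ → Ω → Plane
  h : ℕ × ℕ × ℕ → Plane → ℕ → Ω → ℝ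
  poisson : IsPoissonProcess μ lamO Z
  measurable_N₁ : ∀ n, Measurable (N₁ n)
  law_N₁ : ∀ n, HasLaw (N₁ n) (poissonMeasure c₁.toNNReal) μ
  measurable_V : ∀ n k, Measurable (V n k)
  law_V : ∀ n k, HasLaw (V n k) (radialLaw (reverseGaussianDensity σ R₁)) μ
  measurable_N₂ : ∀ n k, Measurable (N₂ n k)
  law_N₂ : ∀ n k, HasLaw (N₂ n k) (poissonMeasure c.toNNReal) μ
  measurable_W : ∀ n k l, Measurable (W n k l)
  law_W : ∀ n k l, HasLaw (W n k l) (radialLaw (uniformDiskDensity R)) μ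
  measurable_h : ∀ i U t, Measurable (h i U t)
  law_h : ∀ i U t, HasLaw (h i U t) (expMeasure 1) μ
  indep : iIndep (fun s : SOCPSource => match s with
    | .parents => MeasurableSpace.comap (fun ω n => Z n ω) inferInstance
    | .number₁ n => MeasurableSpace.comap (N₁ n) inferInstance
    | .offset₁ n k => MeasurableSpace.comap (V n k) inferInstance
    | .number₂ n k => MeasurableSpace.comap (N₂ n k) inferInstance
    | .offset₂ n k l => MeasurableSpace.comap (W n k l) inferInstance
    | .fading i U t => MeasurableSpace.comap (h i U t) inferInstance) μ

/-- The interferer field of the SOCP model: all second-order daughter points. -/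
def SOCPModel.field [MeasurableSpace Ω] {μ : Measure Ω} {lamO c₁ R₁ σ c R : ℝ}
    (S : SOCPModel μ lamO c₁ R₁ σ c R) : InterfererField Ω (ℕ × ℕ × ℕ) where
  present i ω := i.2.1 < S.N₁ i.1 ω ∧ i.2.2 < S.N₂ i.1 i.2.1 ω
  pos i ω := S.Z i.1 ω + S.V i.1 i.2.1 ω + S.W i.1 i.2.1 i.2.2 ω
  fade := S.h

end PointProcesses

/-- Regularized path loss `g_ε(X) = 1 / (ε + |X|^α)`. -/
noncomputable def pathLoss (α ε : ℝ) (X : Plane) : ℝ := 1 / (ε + ‖X‖ ^ α)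

section Power

variable {Ω ι : Type*}

/-- The power received at `U` in slot `t` from label `i` (zero if there is no such interferer). -/
noncomputable def InterfererField.contribution (Φ : InterfererField Ω ι) (α ε : ℝ) (U : Plane)
    (t : ℕ) (i : ι) (ω : Ω) : ℝ :=
  Set.indicator {j | Φ.present j ω} (fun j => Φ.fade j U t ω * pathLoss α ε (Φ.pos j ω - U)) i

/-- The interference power `I_ε(U, t)`. -/
noncomputable def InterfererField.power (Φ : InterfererField Ω ι) (α ε : ℝ) (U : Plane) (t : ℕ)
    (ω : Ω) : ℝ :=
  ∑' i, Φ.contribution α ε U t i ω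

/-- The interference power is an almost surely convergent sum with finite second moment and
positive variance, for every `ε > 0`, every location and every slot. -/
def InterfererField.WellPosed [MeasurableSpace Ω] (Φ : InterfererField Ω ι) (μ : Measure Ω)
    (α : ℝ) : Prop :=
  ∀ (ε : ℝ), 0 < ε → ∀ (U : Plane) (t : ℕ),
    (∀ᵐ ω ∂μ, Summable (fun i => Φ.contribution α ε U t i ω)) ∧
    MemLp (Φ.power α ε U t) 2 μ ∧ 0 < Var[Φ.power α ε U t; μ]

/-- The normalized covariance of `I_ε(U₁, t₁)` and `I_ε(U₂, t₂)`. -/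
noncomputable def InterfererField.corr [MeasurableSpace Ω] (Φ : InterfererField Ω ι)
    (μ : Measure Ω) (α : ℝ) (U₁ U₂ : Plane) (t₁ t₂ : ℕ) (ε : ℝ) : ℝ :=
  cov[Φ.power α ε U₁ t₁, Φ.power α ε U₂ t₂; μ] /
    (Real.sqrt (Var[Φ.power α ε U₁ t₁; μ]) * Real.sqrt (Var[Φ.power α ε U₂ t₂; μ]))

/-- `ζ` is the interference correlation coefficient `ζ(U₁, U₂, t₁, t₂)`: the limit of the normalized
covariance as `ε → 0` from above. -/
def InterfererField.HasCorrCoef [MeasurableSpace Ω] (Φ : InterfererField Ω ι) (μ : Measure Ω)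
    (α : ℝ) (U₁ U₂ : Plane) (t₁ t₂ : ℕ) (ζ : ℝ) : Prop :=
  Tendsto (Φ.corr μ α U₁ U₂ t₁ t₂) (𝓝[>] 0) (𝓝 ζ)

end Power

/-- `A_R(r)`: the area of the intersection of two disks of radius `R` with centres at distance
`r`. -/
noncomputable def lensArea (R r : ℝ) : ℝ :=
  open Classical in
  if 0 ≤ r ∧ r ≤ 2 * R then
    2 * R ^ 2 * Real.arccos (r / (2 * R)) - r * Real.sqrt (R ^ 2 - r ^ 2 / 4)
  else 0

/-- The clustering functional `F(c, R)`, computed with the regularized path loss `g_ε`. -/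
noncomputable def clusterF (α ε c R : ℝ) : ℝ :=
  c / (Real.pi ^ 2 * R ^ 4) *
    ∫ X : Plane, ∫ Y : Plane, pathLoss α ε X * pathLoss α ε Y * lensArea R ‖X - Y‖

end Interference

/-! Everything rests on an exact second moment formula. For a field of density λ and ε > 0, the
covariance of the two interferences is λ(f · ⟨g₁, g₂⟩ + K(U₁, U₂)). Here gᵢ is the path loss towards
Uᵢ, ⟨·,·⟩ is the L² pairing `overlap`, and f is the mixed second moment of the gains: 2 for the same
location and slot, 1 otherwise. K is the excess over a Poisson process due to pairs of distinct
points in one cluster. It is 0 for the PPP and c⟨κg₁, κg₂⟩ for the MCP, with κ the averaging over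
the disk. The SOCP adds c₁c⟨κ'κg₁, κ'κg₂⟩, where κ' averages over the first-order displacement.

The formula comes from the Poisson process having intensity λ·vol and factorial second moment
measure (λ·vol)² (`IsPoissonProcess.pairMeasure_eq`), hence a Campbell formula for independently
marked processes (`IsPoissonProcess.lintegral_marked_sum_mul`). A cluster is itself a mark whose
moments follow from those of its points (`MarkMoments.cluster`); the SOCP uses this step twice.

The density cancels in the correlation, leaving (g₁₂ + k₁₂)/(2g + k), with g and k the pairing and
the excess at a single location. Let s = ε^(2/α)/ε. Scaling gives g = G₁s/ε exactly and mass of the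
path loss of order s, so k and k₁₂ are O(s²), because the disk average has a bounded density. If U₁
≠ U₂, then g₁₂ = O(s), since no point is close to both locations. As s²/(s/ε) = ε^(2/α) tends to 0,
clustering disappears in the limit: in all three models the coefficient is 1/2 if U₁ = U₂ and 0
otherwise (`HasCovarianceKernel.hasCorrCoef`).

For positive ε the comparison with the PPP is strict as soon as g₁₂k < 2gk₁₂. At one location this
reads gk < 2gk. At two locations the left side is O(s³), while k₁₂ ≥ bs makes the right side at
least of order s²/ε; their quotient is O(ε^(2/α)), whence the restriction to small ε
(`eventually_lt_different`). Of F only its positivity enters (`clusterF_pos`): correlations in the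
strict range are never equal and F never vanishes, so both sides of each equivalence are false. -/

namespace Interference

open scoped ENNReal NNReal

/-! ### Moments of the Poisson and exponential laws -/

section Moments

/-- The weights satisfy (n + 1) p(n + 1) = r p(n), so the factor n is absorbed by an index shift.
The first two moments and the factorial second moment all follow from this identity. -/
theorem lintegral_poissonMeasure_mul (r : ℝ≥0) (f : ℕ → ℝ≥0∞) :
    ∫⁻ n, (n : ℝ≥0∞) * f n ∂poissonMeasure r = r * ∫⁻ n, f (n + 1) ∂poissonMeasure r := by
  have key : ∀ n : ℕ, ((n + 1 : ℕ) : ℝ≥0∞) * poissonMeasure r {n + 1}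
      = r * poissonMeasure r {n} := by
    intro n
    rw [poissonMeasure_singleton, poissonMeasure_singleton, ← ENNReal.ofReal_natCast,
      ← ENNReal.ofReal_coe_nnreal, ← ENNReal.ofReal_mul (by positivity),
      ← ENNReal.ofReal_mul (by positivity)]
    congr 1
    rw [Nat.factorial_succ]
    push_cast
    field_simp
    ring
  rw [lintegral_countable', lintegral_countable', tsum_eq_zero_add' ENNReal.summable,
    ← ENNReal.tsum_mul_left]
  simp only [Nat.cast_zero, zero_mul, zero_add]
  refine tsum_congr fun n => ?_
  rw [mul_right_comm, key]
  ring

theorem lintegral_poissonMeasure_id (r : ℝ≥0) :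
    ∫⁻ n, (n : ℝ≥0∞) ∂poissonMeasure r = r := by
  simpa using lintegral_poissonMeasure_mul r (fun _ => 1)

theorem lintegral_poissonMeasure_factorial_two (r : ℝ≥0) :
    ∫⁻ n, (n : ℝ≥0∞) * ((n - 1 : ℕ) : ℝ≥0∞) ∂poissonMeasure r = (r : ℝ≥0∞) ^ 2 := by
  rw [lintegral_poissonMeasure_mul r (fun n => ((n - 1 : ℕ) : ℝ≥0∞))]
  simp only [Nat.add_sub_cancel, lintegral_poissonMeasure_id, sq]

theorem lintegral_poissonMeasure_sq (r : ℝ≥0) :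
    ∫⁻ n, (n : ℝ≥0∞) ^ 2 ∂poissonMeasure r = r + (r : ℝ≥0∞) ^ 2 := by
  simp only [sq (_ : ℝ≥0∞)]
  rw [lintegral_poissonMeasure_mul r (fun n => (n : ℝ≥0∞))]
  simp only [Nat.cast_add, Nat.cast_one]
  rw [lintegral_add_left (by fun_prop), lintegral_poissonMeasure_id]
  simp
  ring

theorem measurable_gammaPDF (a r : ℝ) : Measurable (gammaPDF a r) :=
  (measurable_gammaPDFReal a r).ennreal_ofReal

theorem ae_expMeasure_nonneg : ∀ᵐ x ∂expMeasure 1, 0 ≤ x := by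
  rw [expMeasure, gammaMeasure, ae_withDensity_iff (measurable_gammaPDF 1 1)]
  refine ae_of_all _ fun x hx => ?_
  by_contra h
  exact hx (gammaPDF_of_neg (not_le.1 h))

theorem lintegral_expMeasure_pow (n : ℕ) :
    ∫⁻ x, ENNReal.ofReal x ^ n ∂expMeasure 1 = (n.factorial : ℝ≥0∞) := by
  have h1 : ∫⁻ x, ENNReal.ofReal x ^ n ∂expMeasure 1
      = ∫⁻ x in Set.Ioi (0 : ℝ), ENNReal.ofReal (Real.exp (-x) * x ^ ((n + 1 : ℝ) - 1)) := by
    rw [expMeasure, gammaMeasure, lintegral_withDensity_eq_lintegral_mul _ (measurable_gammaPDF 1 1)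
      (by fun_prop), ← lintegral_indicator measurableSet_Ioi]
    refine lintegral_congr_ae ?_
    -- The exponential density lives on [0, ∞) and the Gamma integral on (0, ∞); the origin is a
    -- null set.
    filter_upwards [Measure.ae_ne volume (0 : ℝ)] with x hx
    rcases lt_or_gt_of_ne hx with hx | hx
    · simp [gammaPDF_of_neg hx, hx.le]
    · have : ENNReal.ofReal x ^ n = ENNReal.ofReal (x ^ n) := (ENNReal.ofReal_pow hx.le n).symm
      simp only [Pi.mul_apply, this, Set.indicator_of_mem (Set.mem_Ioi.2 hx)]
      rw [gammaPDF_of_nonneg hx.le, ← ENNReal.ofReal_mul (by positivity)]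
      congr 1
      simp
  have h2 : IntegrableOn (fun x : ℝ => Real.exp (-x) * x ^ ((n + 1 : ℝ) - 1)) (Set.Ioi 0) :=
    Real.GammaIntegral_convergent (by positivity)
  rw [h1, ← ofReal_integral_eq_lintegral_ofReal h2, ← Real.Gamma_eq_integral (by positivity),
    Real.Gamma_nat_eq_factorial, ENNReal.ofReal_natCast]
  refine (ae_restrict_iff' measurableSet_Ioi).2 (ae_of_all _ fun x hx => ?_)
  have : (0 : ℝ) < x := hx
  positivity

end Moments

/-! ### Intensity and factorial second moment measure of a Poisson process -/

section Poisson

variable {Ω : Type*} [MeasurableSpace Ω] {μ : Measure Ω}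
  {lam : ℝ} {Z : ℕ → Ω → Plane}

theorem coe_pointCount {Ω : Type*} (Z : ℕ → Ω → Plane) (A : Set Plane) (ω : Ω) :
    (pointCount Z A ω : ℝ≥0∞) = ∑' n, A.indicator 1 (Z n ω) := by
  rw [pointCount, ← ENNReal.tsum_set_one, tsum_subtype {n : ℕ | Z n ω ∈ A} (fun _ => (1 : ℝ≥0∞))]
  rfl

namespace IsPoissonProcess

theorem lintegral_comp_pointCount (hZ : IsPoissonProcess μ lam Z) {A : Set Plane}
    (hA : MeasurableSet A) (hA' : volume A ≠ ⊤) (f : ℕ∞ → ℝ≥0∞) :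
    ∫⁻ ω, f (pointCount Z A ω) ∂μ
      = ∫⁻ k, f (k : ℕ∞) ∂poissonMeasure (lam * volume.real A).toNNReal := by
  rw [(hZ.count_law A hA hA').lintegral_comp (Measurable.of_discrete).aemeasurable,
    lintegral_map Measurable.of_discrete Measurable.of_discrete]

theorem ofReal_area (hlam : 0 ≤ lam) {A : Set Plane} (hA' : volume A ≠ ⊤) :
    (((lam * volume.real A).toNNReal : ℝ≥0) : ℝ≥0∞) = ENNReal.ofReal lam * volume A := by
  change ENNReal.ofReal _ = _
  rw [ENNReal.ofReal_mul hlam, ofReal_measureReal hA']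

theorem lintegral_pointCount (hZ : IsPoissonProcess μ lam Z) (hlam : 0 ≤ lam) {A : Set Plane}
    (hA : MeasurableSet A) (hA' : volume A ≠ ⊤) :
    ∫⁻ ω, (pointCount Z A ω : ℝ≥0∞) ∂μ = ENNReal.ofReal lam * volume A := by
  rw [hZ.lintegral_comp_pointCount hA hA' (fun k => (k : ℝ≥0∞))]
  simp only [ENat.toENNReal_coe]
  rw [lintegral_poissonMeasure_id, ofReal_area hlam hA']

theorem lintegral_pointCount_sq (hZ : IsPoissonProcess μ lam Z) (hlam : 0 ≤ lam) {A : Set Plane}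
    (hA : MeasurableSet A) (hA' : volume A ≠ ⊤) :
    ∫⁻ ω, (pointCount Z A ω : ℝ≥0∞) * pointCount Z A ω ∂μ
      = ENNReal.ofReal lam * volume A + (ENNReal.ofReal lam * volume A) ^ 2 := by
  rw [hZ.lintegral_comp_pointCount hA hA' (fun k => (k : ℝ≥0∞) * k)]
  simp only [ENat.toENNReal_coe, ← sq]
  rw [lintegral_poissonMeasure_sq, ofReal_area hlam hA']

theorem measurable_coe_pointCount (hZ : IsPoissonProcess μ lam Z) {A : Set Plane}
    (hA : MeasurableSet A) : Measurable (fun ω => (pointCount Z A ω : ℝ≥0∞)) := by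
  simp only [coe_pointCount]
  exact .tsum fun n => (measurable_one.indicator hA).comp (hZ.measurable n)

theorem lintegral_pointCount_mul_of_disjoint (hZ : IsPoissonProcess μ lam Z) (hlam : 0 ≤ lam)
    {A B : Set Plane} (hA : MeasurableSet A) (hA' : volume A ≠ ⊤) (hB : MeasurableSet B)
    (hB' : volume B ≠ ⊤) (hAB : Disjoint A B) :
    ∫⁻ ω, (pointCount Z A ω : ℝ≥0∞) * pointCount Z B ω ∂μ
      = (ENNReal.ofReal lam * volume A) * (ENNReal.ofReal lam * volume B) := by
  have h := hZ.count_indep 2 ![A, B] (by intro i; fin_cases i <;> simpa)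
    (by intro i; fin_cases i <;> simpa)
    (by intro i j hij; fin_cases i <;> fin_cases j <;> simp_all [hAB.symm])
  have h' : IndepFun (pointCount Z A) (pointCount Z B) μ := h.indepFun (i := 0) (j := 1) (by simp)
  have h'' := h'.comp (φ := fun k : ℕ∞ => (k : ℝ≥0∞)) (ψ := fun k : ℕ∞ => (k : ℝ≥0∞))
    Measurable.of_discrete Measurable.of_discrete
  have := lintegral_mul_eq_lintegral_mul_lintegral_of_indepFun
    (hZ.measurable_coe_pointCount hA) (hZ.measurable_coe_pointCount hB) h''
  simp only [Pi.mul_apply] at this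
  rw [this, hZ.lintegral_pointCount hlam hA hA', hZ.lintegral_pointCount hlam hB hB']

/-- The law of the pairs of distinct points of a process. -/
noncomputable def pairMeasure (μ : Measure Ω) (Z : ℕ → Ω → Plane) : Measure (Plane × Plane) :=
  Measure.sum fun p : {p : ℕ × ℕ // p.1 ≠ p.2} => μ.map fun ω => (Z p.1.1 ω, Z p.1.2 ω)

end IsPoissonProcess

theorem tsum_prod_eq_diag_add (f : ℕ × ℕ → ℝ≥0∞) :
    ∑' p, f p = (∑' n, f (n, n)) + ∑' p : {p : ℕ × ℕ // p.1 ≠ p.2}, f p := by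
  have h1 : ∑' n, f (n, n) = ∑' p : {p : ℕ × ℕ | p.1 = p.2}, f p := by
    let e : ℕ ≃ {p : ℕ × ℕ | p.1 = p.2} :=
      ⟨fun n => ⟨(n, n), rfl⟩, fun p => p.1.1, fun n => rfl, fun ⟨⟨a, b⟩, h⟩ => by
        simp only [Set.mem_ofPred_eq] at h; subst h; rfl⟩
    exact (e.tsum_eq (fun p : {p : ℕ × ℕ | p.1 = p.2} => f p)).symm ▸ rfl
  rw [h1]
  exact (ENNReal.summable.tsum_add_tsum_compl (s := {p : ℕ × ℕ | p.1 = p.2})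
    ENNReal.summable).symm

/-- Separates self-pairs from pairs of distinct points. The former will be governed by the
intensity, the latter by the factorial second moment measure. -/
theorem lintegral_tsum_mul_tsum {a b : ℕ → Ω → ℝ≥0∞} (ha : ∀ n, Measurable (a n))
    (hb : ∀ n, Measurable (b n)) :
    ∫⁻ ω, (∑' n, a n ω) * (∑' n, b n ω) ∂μ
      = (∑' n, ∫⁻ ω, a n ω * b n ω ∂μ)
        + ∑' p : {p : ℕ × ℕ // p.1 ≠ p.2}, ∫⁻ ω, a p.1.1 ω * b p.1.2 ω ∂μ := by
  have h1 : ∀ ω, (∑' n, a n ω) * (∑' n, b n ω)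
      = (∑' n, a n ω * b n ω) + ∑' p : {p : ℕ × ℕ // p.1 ≠ p.2}, a p.1.1 ω * b p.1.2 ω := by
    intro ω
    rw [← tsum_prod_eq_diag_add (fun p => a p.1 ω * b p.2 ω),
      ENNReal.tsum_prod (f := fun n m => a n ω * b m ω)]
    simp only [ENNReal.tsum_mul_left, ENNReal.tsum_mul_right]
  simp only [h1]
  rw [lintegral_add_left (by fun_prop), lintegral_tsum (by fun_prop), lintegral_tsum (by fun_prop)]

namespace IsPoissonProcess

theorem lintegral_pairMeasure (hZ : ∀ n, Measurable (Z n)) {f g : Plane → ℝ≥0∞}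
    (hf : Measurable f) (hg : Measurable g) :
    ∫⁻ x, f x.1 * g x.2 ∂pairMeasure μ Z
      = ∑' p : {p : ℕ × ℕ // p.1 ≠ p.2}, ∫⁻ ω, f (Z p.1.1 ω) * g (Z p.1.2 ω) ∂μ := by
  rw [pairMeasure, lintegral_sum_measure]
  refine tsum_congr fun p => ?_
  rw [lintegral_map (by fun_prop) (by fun_prop)]

/-- Count laws are only given on sets of finite area. By σ-finiteness these sets still generate the
Borel sets, so they serve as the π-system for the uniqueness arguments below. -/
theorem generateFrom_finite_area :
    MeasurableSpace.generateFrom {s : Set Plane | MeasurableSet s ∧ volume s ≠ ⊤}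
      = (inferInstance : MeasurableSpace Plane) := by
  refine le_antisymm (MeasurableSpace.generateFrom_le fun s hs => hs.1) fun s hs => ?_
  rw [← Set.inter_univ s, ← iUnion_spanningSets (volume : Measure Plane), Set.inter_iUnion]
  refine MeasurableSet.iUnion fun i => MeasurableSpace.measurableSet_generateFrom
    ⟨hs.inter (measurableSet_spanningSets _ i), ?_⟩
  exact measure_ne_top_of_subset Set.inter_subset_right (measure_spanningSets_lt_top _ i).ne

theorem isPiSystem_finite_area :
    IsPiSystem {s : Set Plane | MeasurableSet s ∧ volume s ≠ ⊤} :=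
  fun _ hs _ ht _ => ⟨hs.1.inter ht.1, measure_ne_top_of_subset Set.inter_subset_left hs.2⟩

theorem sum_map_eq (hZ : IsPoissonProcess μ lam Z) (hlam : 0 ≤ lam) :
    Measure.sum (fun n => μ.map (Z n)) = ENNReal.ofReal lam • volume := by
  have key : ∀ A : Set Plane, MeasurableSet A → volume A ≠ ⊤ →
      Measure.sum (fun n => μ.map (Z n)) A = (ENNReal.ofReal lam • volume) A := by
    intro A hA hA'
    rw [← lintegral_indicator_one hA, lintegral_sum_measure, Measure.smul_apply, smul_eq_mul,
      ← hZ.lintegral_pointCount hlam hA hA']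
    simp only [coe_pointCount]
    have hm : ∀ n, Measurable fun ω => A.indicator (1 : Plane → ℝ≥0∞) (Z n ω) :=
      fun n => (measurable_one.indicator hA).comp (hZ.measurable n)
    rw [lintegral_tsum fun n => (hm n).aemeasurable]
    exact tsum_congr fun n => lintegral_map (measurable_one.indicator hA) (hZ.measurable n)
  refine Measure.ext_of_generateFrom_of_iUnion {s | MeasurableSet s ∧ volume s ≠ ⊤}
    (spanningSets volume) ?_ ?_ (iUnion_spanningSets _)
    (fun i => ⟨measurableSet_spanningSets _ i, (measure_spanningSets_lt_top _ i).ne⟩) ?_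
    (fun s hs => key s hs.1 hs.2)
  · exact generateFrom_finite_area.symm
  · exact isPiSystem_finite_area
  · intro i
    rw [key _ (measurableSet_spanningSets _ i) (measure_spanningSets_lt_top _ i).ne]
    exact ENNReal.mul_ne_top ENNReal.ofReal_ne_top (measure_spanningSets_lt_top _ i).ne

theorem pointCount_eq_add {Ω : Type*} (Z : ℕ → Ω → Plane) (A B : Set Plane) (ω : Ω) :
    (pointCount Z A ω : ℝ≥0∞) = pointCount Z (A ∩ B) ω + pointCount Z (A \ B) ω := by
  rw [coe_pointCount, coe_pointCount, coe_pointCount, ← ENNReal.tsum_add]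
  refine tsum_congr fun n => ?_
  by_cases hA : Z n ω ∈ A <;> by_cases hB : Z n ω ∈ B <;> simp [hA, hB]

/-- Cutting both sets along their intersection leaves four products. Three involve disjoint sets and
factor by independence; the fourth is the square of one Poisson variable, whose variance is the
extra term. -/
theorem lintegral_pointCount_mul (hZ : IsPoissonProcess μ lam Z) (hlam : 0 ≤ lam)
    {A B : Set Plane} (hA : MeasurableSet A) (hA' : volume A ≠ ⊤) (hB : MeasurableSet B)
    (hB' : volume B ≠ ⊤) :
    ∫⁻ ω, (pointCount Z A ω : ℝ≥0∞) * pointCount Z B ω ∂μ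
      = ENNReal.ofReal lam * volume (A ∩ B)
        + (ENNReal.ofReal lam * volume A) * (ENNReal.ofReal lam * volume B) := by
  have hI := hA.inter hB
  have hI' : volume (A ∩ B) ≠ ⊤ := measure_ne_top_of_subset Set.inter_subset_left hA'
  have hD := hA.diff hB
  have hD' : volume (A \ B) ≠ ⊤ := measure_ne_top_of_subset Set.sdiff_subset hA'
  have hE := hB.diff hA
  have hE' : volume (B \ A) ≠ ⊤ := measure_ne_top_of_subset Set.sdiff_subset hB'
  have hmI := hZ.measurable_coe_pointCount hI
  have hmD := hZ.measurable_coe_pointCount hD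
  have hmE := hZ.measurable_coe_pointCount hE
  have h1 : ∀ ω, (pointCount Z A ω : ℝ≥0∞) * pointCount Z B ω
      = (pointCount Z (A ∩ B) ω : ℝ≥0∞) * pointCount Z (A ∩ B) ω
        + (pointCount Z (A ∩ B) ω : ℝ≥0∞) * pointCount Z (B \ A) ω
        + (pointCount Z (A \ B) ω : ℝ≥0∞) * pointCount Z (A ∩ B) ω
        + (pointCount Z (A \ B) ω : ℝ≥0∞) * pointCount Z (B \ A) ω := by
    intro ω
    rw [pointCount_eq_add Z A B, pointCount_eq_add Z B A, Set.inter_comm B A]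
    ring
  simp only [h1]
  rw [lintegral_add_left (by fun_prop), lintegral_add_left (by fun_prop),
    lintegral_add_left (by fun_prop), hZ.lintegral_pointCount_sq hlam hI hI',
    hZ.lintegral_pointCount_mul_of_disjoint hlam hI hI' hE hE'
      (Set.disjoint_sdiff_inter.symm.mono_left (by rw [Set.inter_comm])),
    hZ.lintegral_pointCount_mul_of_disjoint hlam hD hD' hI hI' Set.disjoint_sdiff_inter,
    hZ.lintegral_pointCount_mul_of_disjoint hlam hD hD' hE hE'
      (Set.disjoint_sdiff_left.mono_right Set.sdiff_subset),
    ← measure_inter_add_sdiff A hB, ← measure_inter_add_sdiff B hA, Set.inter_comm B A]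
  ring

theorem pairMeasure_eq (hZ : IsPoissonProcess μ lam Z) (hlam : 0 ≤ lam) :
    pairMeasure μ Z = (ENNReal.ofReal lam • volume).prod (ENNReal.ofReal lam • volume) := by
  have hspan : (ENNReal.ofReal lam • (volume : Measure Plane)).FiniteSpanningSetsIn
      {s | MeasurableSet s ∧ volume s ≠ ⊤} :=
    { set := spanningSets volume
      set_mem := fun i =>
        ⟨measurableSet_spanningSets _ i, (measure_spanningSets_lt_top _ i).ne⟩
      finite := fun i => ENNReal.mul_lt_top ENNReal.ofReal_lt_top (measure_spanningSets_lt_top _ i)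
      spanning := iUnion_spanningSets _ }
  refine (Measure.prod_eq_generateFrom generateFrom_finite_area
    generateFrom_finite_area isPiSystem_finite_area isPiSystem_finite_area
    hspan hspan ?_).symm
  rintro A ⟨hA, hA'⟩ B ⟨hB, hB'⟩
  have hmA : Measurable (A.indicator (1 : Plane → ℝ≥0∞)) := measurable_one.indicator hA
  have hmB : Measurable (B.indicator (1 : Plane → ℝ≥0∞)) := measurable_one.indicator hB
  -- The mean of the product of two counts is computed twice: as diagonal plus `pairMeasure`, and
  -- from the Poisson law.
  have h1 := lintegral_tsum_mul_tsum (μ := μ) (fun n => hmA.comp (hZ.measurable n))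
    (fun n => hmB.comp (hZ.measurable n))
  simp only [Function.comp_apply] at h1
  rw [← lintegral_pairMeasure hZ.measurable hmA hmB] at h1
  simp only [← coe_pointCount] at h1
  rw [hZ.lintegral_pointCount_mul hlam hA hA' hB hB'] at h1
  have hmul : ∀ x : Plane × Plane, A.indicator (1 : Plane → ℝ≥0∞) x.1
      * B.indicator (1 : Plane → ℝ≥0∞) x.2 = (A ×ˢ B).indicator 1 x := by
    rintro ⟨x, y⟩
    by_cases hx : x ∈ A <;> by_cases hy : y ∈ B <;> simp [hx, hy]
  have hmul' : ∀ x : Plane, A.indicator (1 : Plane → ℝ≥0∞) x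
      * B.indicator (1 : Plane → ℝ≥0∞) x = (A ∩ B).indicator 1 x := by
    intro x
    by_cases hx : x ∈ A <;> by_cases hy : x ∈ B <;> simp [hx, hy]
  have h2 : ∑' n, ∫⁻ ω, (A ∩ B).indicator (1 : Plane → ℝ≥0∞) (Z n ω) ∂μ
      = ENNReal.ofReal lam * volume (A ∩ B) := by
    have h3 := congrArg (fun ν : Measure Plane => ν (A ∩ B)) (hZ.sum_map_eq hlam)
    simp only [Measure.smul_apply, smul_eq_mul] at h3
    rw [← h3, ← lintegral_indicator_one (hA.inter hB), lintegral_sum_measure]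
    exact tsum_congr fun n =>
      (lintegral_map (measurable_one.indicator (hA.inter hB)) (hZ.measurable n)).symm
  simp only [hmul, hmul'] at h1
  rw [h2, lintegral_indicator_one (hA.prod hB)] at h1
  -- Finiteness of the diagonal term permits cancelling it in `ℝ≥0∞`.
  have hfin : ENNReal.ofReal lam * volume (A ∩ B) ≠ ⊤ := ENNReal.mul_ne_top ENNReal.ofReal_ne_top
    (measure_ne_top_of_subset Set.inter_subset_left hA')
  exact ((ENNReal.add_right_inj hfin).1 h1).symm

end IsPoissonProcess
end Poisson

/-! ### Random marks and the moments of a cluster -/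

section Marks

variable {Ω : Type*} [MeasurableSpace Ω] {μ : Measure Ω} [IsProbabilityMeasure μ]

theorem lintegral_comp_of_indepFun {E F : Type*} [MeasurableSpace E] [MeasurableSpace F]
    {X : Ω → E} {Y : Ω → F} (hX : Measurable X) (hY : Measurable Y) (h : IndepFun X Y μ)
    {f : E → F → ℝ≥0∞} (hf : Measurable (Function.uncurry f)) :
    ∫⁻ ω, f (X ω) (Y ω) ∂μ = ∫⁻ x, ∫⁻ ω, f x (Y ω) ∂μ ∂(μ.map X) := by
  have h1 : ∫⁻ ω, f (X ω) (Y ω) ∂μ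
      = ∫⁻ p, Function.uncurry f p ∂(μ.map fun ω => (X ω, Y ω)) := by
    rw [lintegral_map hf (hX.prodMk hY)]
    rfl
  rw [h1, (indepFun_iff_map_prod_eq_prod_map_map hX.aemeasurable hY.aemeasurable).1 h,
    lintegral_prod _ hf.aemeasurable]
  refine lintegral_congr fun x => ?_
  exact lintegral_map (hf.comp measurable_prodMk_left) hY

variable {𝓜 : Type*} [MeasurableSpace 𝓜]

/-- First moments and mixed second moment of two random fields `z ↦ Φ z X`, `z ↦ Φ' z X` driven by
the random mark `X`. -/
structure MarkMoments (μ : Measure Ω) (X : Ω → 𝓜) (Φ Φ' : Plane → 𝓜 → ℝ≥0∞)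
    (ψ ψ' χ : Plane → ℝ≥0∞) : Prop where
  measurable : Measurable X
  measurable_left : Measurable (Function.uncurry Φ)
  measurable_right : Measurable (Function.uncurry Φ')
  left : ∀ z, ∫⁻ ω, Φ z (X ω) ∂μ = ψ z
  right : ∀ z, ∫⁻ ω, Φ' z (X ω) ∂μ = ψ' z
  mul : ∀ z, ∫⁻ ω, Φ z (X ω) * Φ' z (X ω) ∂μ = χ z

theorem MarkMoments.measurable_mean_left {X : Ω → 𝓜} {Φ Φ' : Plane → 𝓜 → ℝ≥0∞}
    {ψ ψ' χ : Plane → ℝ≥0∞} (h : MarkMoments μ X Φ Φ' ψ ψ' χ) : Measurable ψ := by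
  rw [← funext h.left]
  have := h.measurable
  exact (h.measurable_left.comp (by fun_prop : Measurable fun p : Plane × Ω => (p.1, X p.2))
    ).lintegral_prod_right'

theorem MarkMoments.measurable_mean_right {X : Ω → 𝓜} {Φ Φ' : Plane → 𝓜 → ℝ≥0∞}
    {ψ ψ' χ : Plane → ℝ≥0∞} (h : MarkMoments μ X Φ Φ' ψ ψ' χ) : Measurable ψ' := by
  rw [← funext h.right]
  have := h.measurable
  exact (h.measurable_right.comp (by fun_prop : Measurable fun p : Plane × Ω => (p.1, X p.2))
    ).lintegral_prod_right'

theorem MarkMoments.measurable_mean_mul {X : Ω → 𝓜} {Φ Φ' : Plane → 𝓜 → ℝ≥0∞}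
    {ψ ψ' χ : Plane → ℝ≥0∞} (h : MarkMoments μ X Φ Φ' ψ ψ' χ) : Measurable χ := by
  rw [← funext h.mul]
  have := h.measurable
  exact ((h.measurable_left.mul h.measurable_right).comp
    (by fun_prop : Measurable fun p : Plane × Ω => (p.1, X p.2))).lintegral_prod_right'

/-- The total contribution of the cluster centred at `z` with `q.1` points, the `k`-th of which has
offset `(q.2 k).1` and mark `(q.2 k).2`. -/
noncomputable def clusterSum (Φ : Plane → 𝓜 → ℝ≥0∞) (z : Plane) (q : ℕ × (ℕ → Plane × 𝓜)) :
    ℝ≥0∞ :=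
  ∑ k ∈ Finset.range q.1, Φ (z + (q.2 k).1) (q.2 k).2

theorem measurable_clusterSum {Φ : Plane → 𝓜 → ℝ≥0∞} (hΦ : Measurable (Function.uncurry Φ)) :
    Measurable (Function.uncurry (clusterSum Φ)) := by
  have h : Measurable fun p : ℕ × (Plane × (ℕ → Plane × 𝓜)) =>
      ∑ k ∈ Finset.range p.1, Φ (p.2.1 + (p.2.2 k).1) (p.2.2 k).2 := by
    refine measurable_from_prod_countable_right fun n => ?_
    have hk : ∀ k, Measurable fun q : Plane × (ℕ → Plane × 𝓜) =>
        Φ (q.1 + (q.2 k).1) (q.2 k).2 := fun k => hΦ.comp (by fun_prop :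
      Measurable fun q : Plane × (ℕ → Plane × 𝓜) => (q.1 + (q.2 k).1, (q.2 k).2))
    dsimp only
    fun_prop
  exact h.comp (by fun_prop : Measurable fun p : Plane × (ℕ × (ℕ → Plane × 𝓜)) =>
    (p.2.1, (p.1, p.2.2)))

/-- One row of a double sum over a cluster: a diagonal entry and n - 1 others. Membership of `k`
forces n ≥ 1, so the subtraction is not truncated. -/
theorem sum_range_ite_eq_add (n k : ℕ) (hk : k ∈ Finset.range n) (C D : ℝ≥0∞) :
    ∑ l ∈ Finset.range n, (if k = l then C else D) = C + ((n - 1 : ℕ) : ℝ≥0∞) * D := by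
  rw [← Finset.add_sum_erase _ _ hk, if_pos rfl, Finset.sum_congr rfl (g := fun _ => D)]
  · rw [Finset.sum_const, Finset.card_erase_of_mem hk, Finset.card_range, nsmul_eq_mul]
  · intro l hl
    rw [if_neg (Finset.ne_of_mem_erase hl).symm]

/-- Given the cluster size n, the product of the two sums has n diagonal terms and n(n - 1)
off-diagonal ones, which factor by independence. A Poisson size has mean c and factorial second
moment c². The conclusion has the same shape as the hypothesis on the points, so the step can be
iterated. -/
theorem MarkMoments.cluster {N : Ω → ℕ} {Y : ℕ → Ω → Plane} {X : ℕ → Ω → 𝓜} {c : ℝ≥0}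
    {κ : Measure Plane} {Φ Φ' : Plane → 𝓜 → ℝ≥0∞} {ψ ψ' χ : Plane → ℝ≥0∞}
    (hN : Measurable N) (hNlaw : HasLaw N (poissonMeasure c) μ)
    (hY : ∀ k, Measurable (Y k)) (hYlaw : ∀ k, HasLaw (Y k) κ μ)
    (hX : ∀ k, MarkMoments μ (X k) Φ Φ' ψ ψ' χ)
    (hNs : IndepFun N (fun ω k => (Y k ω, X k ω)) μ)
    (hYX : ∀ k, IndepFun (Y k) (X k) μ)
    (hpair : ∀ k l, k ≠ l → IndepFun (fun ω => (Y k ω, X k ω)) (fun ω => (Y l ω, X l ω)) μ) :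
    MarkMoments μ (fun ω => (N ω, fun k => (Y k ω, X k ω))) (clusterSum Φ) (clusterSum Φ')
      (fun z => c * ∫⁻ y, ψ (z + y) ∂κ) (fun z => c * ∫⁻ y, ψ' (z + y) ∂κ)
      (fun z => c * ∫⁻ y, χ (z + y) ∂κ
        + (c * ∫⁻ y, ψ (z + y) ∂κ) * (c * ∫⁻ y, ψ' (z + y) ∂κ)) := by
  have hXm := fun k => (hX k).measurable
  have hs : Measurable (fun ω (k : ℕ) => (Y k ω, X k ω)) := by fun_prop
  have hΦ := (hX 0).measurable_left
  have hΦ' := (hX 0).measurable_right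
  have hshift : ∀ z : Plane, Measurable fun p : Plane × 𝓜 => (z + p.1, p.2) := by
    intro z; fun_prop
  have hΦz : ∀ z, Measurable (Function.uncurry fun (y : Plane) x => Φ (z + y) x) :=
    fun z => hΦ.comp (hshift z)
  have hΦz' : ∀ z, Measurable (Function.uncurry fun (y : Plane) x => Φ' (z + y) x) :=
    fun z => hΦ'.comp (hshift z)
  have hL : ∀ z k, ∫⁻ ω, Φ (z + Y k ω) (X k ω) ∂μ = ∫⁻ y, ψ (z + y) ∂κ := by
    intro z k
    rw [lintegral_comp_of_indepFun (hY k) (hXm k) (hYX k) (hΦz z), (hYlaw k).map_eq]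
    simp only [(hX k).left]
  have hR : ∀ z k, ∫⁻ ω, Φ' (z + Y k ω) (X k ω) ∂μ = ∫⁻ y, ψ' (z + y) ∂κ := by
    intro z k
    rw [lintegral_comp_of_indepFun (hY k) (hXm k) (hYX k) (hΦz' z), (hYlaw k).map_eq]
    simp only [(hX k).right]
  have hLR : ∀ z k, ∫⁻ ω, Φ (z + Y k ω) (X k ω) * Φ' (z + Y k ω) (X k ω) ∂μ
      = ∫⁻ y, χ (z + y) ∂κ := by
    intro z k
    rw [lintegral_comp_of_indepFun (f := fun y x => Φ (z + y) x * Φ' (z + y) x) (hY k) (hXm k)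
      (hYX k) ((hΦz z).mul (hΦz' z)), (hYlaw k).map_eq]
    simp only [(hX k).mul]
  have hma : ∀ z k, Measurable fun ω => Φ (z + Y k ω) (X k ω) := fun z k =>
    (hΦz z).comp ((hY k).prodMk (hXm k))
  have hmb : ∀ z k, Measurable fun ω => Φ' (z + Y k ω) (X k ω) := fun z k =>
    (hΦz' z).comp ((hY k).prodMk (hXm k))
  have hkl : ∀ z k l, ∫⁻ ω, Φ (z + Y k ω) (X k ω) * Φ' (z + Y l ω) (X l ω) ∂μ
      = if k = l then ∫⁻ y, χ (z + y) ∂κ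
        else (∫⁻ y, ψ (z + y) ∂κ) * ∫⁻ y, ψ' (z + y) ∂κ := by
    intro z k l
    split_ifs with h
    · subst h
      exact hLR z k
    · rw [← hL z k, ← hR z l]
      exact lintegral_mul_eq_lintegral_mul_lintegral_of_indepFun (hma z k) (hmb z l)
        ((hpair k l h).comp (hΦz z) (hΦz' z))
  have hmC : ∀ {Θ : Plane → 𝓜 → ℝ≥0∞}, Measurable (Function.uncurry Θ) → ∀ z,
      Measurable (Function.uncurry fun n s => clusterSum Θ z (n, s)) := fun hΘ z =>
    (measurable_clusterSum hΘ).comp measurable_prodMk_left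
  refine ⟨hN.prodMk hs, measurable_clusterSum hΦ, measurable_clusterSum hΦ', fun z => ?_,
    fun z => ?_, fun z => ?_⟩
  · rw [lintegral_comp_of_indepFun (f := fun n s => clusterSum Φ z (n, s)) hN hs hNs (hmC hΦ z),
      hNlaw.map_eq]
    simp only [clusterSum]
    simp_rw [lintegral_finsetSum' _ (fun k _ => (hma z k).aemeasurable), hL,
      Finset.sum_const, Finset.card_range, nsmul_eq_mul]
    rw [lintegral_mul_const _ (by fun_prop), lintegral_poissonMeasure_id]
  · rw [lintegral_comp_of_indepFun (f := fun n s => clusterSum Φ' z (n, s)) hN hs hNs (hmC hΦ' z),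
      hNlaw.map_eq]
    simp only [clusterSum]
    simp_rw [lintegral_finsetSum' _ (fun k _ => (hmb z k).aemeasurable), hR,
      Finset.sum_const, Finset.card_range, nsmul_eq_mul]
    rw [lintegral_mul_const _ (by fun_prop), lintegral_poissonMeasure_id]
  · rw [lintegral_comp_of_indepFun (f := fun n s => clusterSum Φ z (n, s) * clusterSum Φ' z (n, s))
      hN hs hNs ((hmC hΦ z).mul (hmC hΦ' z)), hNlaw.map_eq]
    have hn : ∀ n : ℕ, ∫⁻ ω, clusterSum Φ z (n, fun k => (Y k ω, X k ω))
          * clusterSum Φ' z (n, fun k => (Y k ω, X k ω)) ∂μ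
        = n * (∫⁻ y, χ (z + y) ∂κ) + n * ((n - 1 : ℕ) : ℝ≥0∞) *
          ((∫⁻ y, ψ (z + y) ∂κ) * ∫⁻ y, ψ' (z + y) ∂κ) := by
      intro n
      simp only [clusterSum, Finset.sum_mul_sum]
      have hab : ∀ k l, Measurable fun ω => Φ (z + Y k ω) (X k ω) * Φ' (z + Y l ω) (X l ω) :=
        fun k l => (hma z k).mul (hmb z l)
      rw [lintegral_finsetSum' _ (fun k _ => by fun_prop)]
      simp_rw [fun k => lintegral_finsetSum' (μ := μ) (Finset.range n) (fun l (_ : l ∈ _) =>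
        (hab k l).aemeasurable), hkl]
      rw [Finset.sum_congr rfl fun k hk => sum_range_ite_eq_add n k hk _ _, Finset.sum_const,
        Finset.card_range, nsmul_eq_mul]
      ring
    simp only [hn]
    rw [lintegral_add_left (by fun_prop), lintegral_mul_const _ (by fun_prop),
      lintegral_mul_const _ (by fun_prop), lintegral_poissonMeasure_id,
      lintegral_poissonMeasure_factorial_two]
    ring

/-! ### Campbell formulas for marked Poisson processes -/

section Campbell

variable {lam : ℝ} {Z : ℕ → Ω → Plane} {X : ℕ → Ω → 𝓜} {Φ Φ' : Plane → 𝓜 → ℝ≥0∞}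
  {ψ ψ' χ : Plane → ℝ≥0∞}

theorem IsPoissonProcess.tsum_lintegral {Ω : Type*} [MeasurableSpace Ω] {μ : Measure Ω}
    {Z : ℕ → Ω → Plane} (hZ : IsPoissonProcess μ lam Z) (hlam : 0 ≤ lam)
    {f : Plane → ℝ≥0∞} (hf : Measurable f) :
    ∑' n, ∫⁻ ω, f (Z n ω) ∂μ = ENNReal.ofReal lam * ∫⁻ z, f z := by
  have h := congrArg (fun ν : Measure Plane => ∫⁻ z, f z ∂ν) (hZ.sum_map_eq hlam)
  simp only [lintegral_smul_measure, lintegral_sum_measure, smul_eq_mul] at h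
  rw [← h]
  exact tsum_congr fun n => (lintegral_map hf (hZ.measurable n)).symm

theorem IsPoissonProcess.lintegral_marked_sum (hZ : IsPoissonProcess μ lam Z) (hlam : 0 ≤ lam)
    (hX : ∀ n, MarkMoments μ (X n) Φ Φ' ψ ψ' χ)
    (hZX : IndepFun (fun ω n => Z n ω) (fun ω n => X n ω) μ) :
    ∫⁻ ω, ∑' n, Φ (Z n ω) (X n ω) ∂μ = ENNReal.ofReal lam * ∫⁻ z, ψ z := by
  have hm : ∀ n, Measurable fun ω => Φ (Z n ω) (X n ω) := fun n =>
    (hX n).measurable_left.comp ((hZ.measurable n).prodMk (hX n).measurable)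
  rw [lintegral_tsum fun n => (hm n).aemeasurable,
    ← hZ.tsum_lintegral hlam (hX 0).measurable_mean_left]
  refine tsum_congr fun n => ?_
  rw [lintegral_comp_of_indepFun (hZ.measurable n) (hX n).measurable
    (hZX.comp (measurable_pi_apply n) (measurable_pi_apply n)) (hX n).measurable_left]
  simp only [(hX n).left]
  exact lintegral_map (hX 0).measurable_mean_left (hZ.measurable n)

/-- Self-pairs see the mixed moment of a single mark, integrated against the intensity. For distinct
points the marks are independent, so only their means survive, and the product form of the pair
measure turns this into the product of the two first moments. -/
theorem IsPoissonProcess.lintegral_marked_sum_mul (hZ : IsPoissonProcess μ lam Z) (hlam : 0 ≤ lam)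
    (hX : ∀ n, MarkMoments μ (X n) Φ Φ' ψ ψ' χ)
    (hZX : IndepFun (fun ω n => Z n ω) (fun ω n => X n ω) μ)
    (hXX : ∀ n m, n ≠ m → IndepFun (X n) (X m) μ) :
    ∫⁻ ω, (∑' n, Φ (Z n ω) (X n ω)) * (∑' n, Φ' (Z n ω) (X n ω)) ∂μ
      = ENNReal.ofReal lam * (∫⁻ z, χ z)
        + (ENNReal.ofReal lam * ∫⁻ z, ψ z) * (ENNReal.ofReal lam * ∫⁻ z, ψ' z) := by
  have hψ := (hX 0).measurable_mean_left
  have hψ' := (hX 0).measurable_mean_right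
  have hχ := (hX 0).measurable_mean_mul
  have hXm := fun n => (hX n).measurable
  have hZm := hZ.measurable
  have hm : ∀ n, Measurable fun ω => Φ (Z n ω) (X n ω) := fun n =>
    (hX n).measurable_left.comp ((hZ.measurable n).prodMk (hX n).measurable)
  have hm' : ∀ n, Measurable fun ω => Φ' (Z n ω) (X n ω) := fun n =>
    (hX n).measurable_right.comp ((hZ.measurable n).prodMk (hX n).measurable)
  rw [lintegral_tsum_mul_tsum hm hm']
  congr 1
  · rw [← hZ.tsum_lintegral hlam hχ]
    refine tsum_congr fun n => ?_
    rw [lintegral_comp_of_indepFun (f := fun z x => Φ z x * Φ' z x) (hZ.measurable n)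
      (hX n).measurable (hZX.comp (measurable_pi_apply n) (measurable_pi_apply n))
      ((hX n).measurable_left.mul (hX n).measurable_right)]
    simp only [(hX n).mul]
    exact lintegral_map hχ (hZ.measurable n)
  · have h1 : (ENNReal.ofReal lam * ∫⁻ z, ψ z) * (ENNReal.ofReal lam * ∫⁻ z, ψ' z)
        = ∫⁻ x, ψ x.1 * ψ' x.2 ∂pairMeasure μ Z := by
      rw [hZ.pairMeasure_eq hlam, lintegral_prod_mul hψ.aemeasurable hψ'.aemeasurable,
        lintegral_smul_measure, lintegral_smul_measure]
      simp only [smul_eq_mul]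
    rw [h1, lintegral_pairMeasure hZ.measurable hψ hψ']
    refine tsum_congr fun ⟨⟨n, m⟩, hnm⟩ => ?_
    dsimp only at hnm ⊢
    have hpz : Measurable fun z : ℕ → Plane => (z n, z m) := by fun_prop
    have hpx : Measurable fun x : ℕ → 𝓜 => (x n, x m) := by fun_prop
    have hΦ1 : Measurable (fun q : (Plane × Plane) × (𝓜 × 𝓜) => Φ q.1.1 q.2.1) :=
      (hX 0).measurable_left.comp (by fun_prop :
        Measurable fun q : (Plane × Plane) × (𝓜 × 𝓜) => (q.1.1, q.2.1))
    have hΦ2 : Measurable (fun q : (Plane × Plane) × (𝓜 × 𝓜) => Φ' q.1.2 q.2.2) :=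
      (hX 0).measurable_right.comp (by fun_prop :
        Measurable fun q : (Plane × Plane) × (𝓜 × 𝓜) => (q.1.2, q.2.2))
    -- The two positions are frozen first; the marks then factor at fixed positions.
    have h2 := lintegral_comp_of_indepFun (μ := μ) (X := fun ω => (Z n ω, Z m ω))
      (Y := fun ω => (X n ω, X m ω)) (f := fun z x => Φ z.1 x.1 * Φ' z.2 x.2)
      (by fun_prop) (by fun_prop) (hZX.comp hpz hpx) (hΦ1.mul hΦ2)
    dsimp only at h2
    rw [h2, lintegral_map' _ (by fun_prop)]
    · refine lintegral_congr fun ω => ?_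
      rw [← (hX n).left, ← (hX m).right]
      exact lintegral_mul_eq_lintegral_mul_lintegral_of_indepFun
        ((hX n).measurable_left.comp (measurable_prodMk_left.comp (hXm n)))
        ((hX m).measurable_right.comp (measurable_prodMk_left.comp (hXm m)))
        ((hXX n m hnm).comp ((hX n).measurable_left.comp measurable_prodMk_left)
          ((hX m).measurable_right.comp measurable_prodMk_left))
    · refine Measurable.aemeasurable ?_
      exact ((hΦ1.mul hΦ2).comp (by fun_prop : Measurable fun p : (Plane × Plane) × Ω =>
        (p.1, (X n p.2, X m p.2)))).lintegral_prod_right'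

end Campbell
end Marks

/-! ### From extended nonnegative moments to summability and covariance -/

section NonnegativeSums

variable {Ω ι : Type*} [MeasurableSpace Ω] {μ : Measure Ω}

theorem ofReal_tsum_ae_eq {f : ι → Ω → ℝ} (hnn : ∀ᵐ ω ∂μ, ∀ i, 0 ≤ f i ω)
    (hs : ∀ᵐ ω ∂μ, Summable fun i => f i ω) :
    (fun ω => ENNReal.ofReal (∑' i, f i ω)) =ᵐ[μ] fun ω => ∑' i, ENNReal.ofReal (f i ω) := by
  filter_upwards [hnn, hs] with ω h1 h2 using ENNReal.ofReal_tsum_of_nonneg h1 h2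

theorem ae_summable_of_lintegral_ne_top [Countable ι] {f : ι → Ω → ℝ} (hf : ∀ i, Measurable (f i))
    (hnn : ∀ᵐ ω ∂μ, ∀ i, 0 ≤ f i ω) (h : ∫⁻ ω, ∑' i, ENNReal.ofReal (f i ω) ∂μ ≠ ⊤) :
    ∀ᵐ ω ∂μ, Summable fun i => f i ω := by
  filter_upwards [hnn, ae_lt_top' (by fun_prop) h] with ω h1 h2
  have := ENNReal.summable_toReal h2.ne
  simpa only [ENNReal.toReal_ofReal (h1 _)] using this

theorem memLp_two_tsum [Countable ι] {f : ι → Ω → ℝ} (hf : ∀ i, Measurable (f i))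
    (hnn : ∀ᵐ ω ∂μ, ∀ i, 0 ≤ f i ω) (hs : ∀ᵐ ω ∂μ, Summable fun i => f i ω)
    (h : ∫⁻ ω, (∑' i, ENNReal.ofReal (f i ω)) * ∑' i, ENNReal.ofReal (f i ω) ∂μ ≠ ⊤) :
    MemLp (fun ω => ∑' i, f i ω) 2 μ := by
  have hae : (fun ω => ∑' i, f i ω) =ᵐ[μ] fun ω => (∑' i, ENNReal.ofReal (f i ω)).toReal := by
    filter_upwards [hnn, ofReal_tsum_ae_eq hnn hs] with ω h1 h2
    rw [← h2, ENNReal.toReal_ofReal (tsum_nonneg h1)]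
  refine MemLp.ae_eq hae.symm ⟨Measurable.aestronglyMeasurable
    (ENNReal.measurable_toReal.comp (by fun_prop)), ?_⟩
  rw [eLpNorm_lt_top_iff_lintegral_rpow_enorm_lt_top (by simp) (by simp)]
  refine lt_of_le_of_lt (lintegral_mono fun ω => ?_) h.lt_top
  have : ‖(∑' i, ENNReal.ofReal (f i ω)).toReal‖ₑ ≤ ∑' i, ENNReal.ofReal (f i ω) := by
    rw [Real.enorm_of_nonneg ENNReal.toReal_nonneg]
    exact ENNReal.ofReal_toReal_le
  simp only [ENNReal.toReal_ofNat, ENNReal.rpow_ofNat, sq]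
  exact mul_le_mul' this this

/-- The second moment is supplied as `B` plus the product of the means. The means are thus
subtracted only after passing to real numbers, where they cancel. -/
theorem covariance_tsum [IsProbabilityMeasure μ] {f g : ι → Ω → ℝ} {B : ℝ≥0∞}
    (hfm : MemLp (fun ω => ∑' i, f i ω) 2 μ) (hgm : MemLp (fun ω => ∑' i, g i ω) 2 μ)
    (hfn : ∀ᵐ ω ∂μ, ∀ i, 0 ≤ f i ω) (hgn : ∀ᵐ ω ∂μ, ∀ i, 0 ≤ g i ω)
    (hfs : ∀ᵐ ω ∂μ, Summable fun i => f i ω) (hgs : ∀ᵐ ω ∂μ, Summable fun i => g i ω)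
    (hB : B ≠ ⊤)
    (hf : ∫⁻ ω, ∑' i, ENNReal.ofReal (f i ω) ∂μ ≠ ⊤)
    (hg : ∫⁻ ω, ∑' i, ENNReal.ofReal (g i ω) ∂μ ≠ ⊤)
    (h : ∫⁻ ω, (∑' i, ENNReal.ofReal (f i ω)) * ∑' i, ENNReal.ofReal (g i ω) ∂μ
      = B + (∫⁻ ω, ∑' i, ENNReal.ofReal (f i ω) ∂μ) * ∫⁻ ω, ∑' i, ENNReal.ofReal (g i ω) ∂μ) :
    cov[fun ω => ∑' i, f i ω, fun ω => ∑' i, g i ω; μ] = B.toReal := by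
  have hf0 : 0 ≤ᵐ[μ] fun ω => ∑' i, f i ω := hfn.mono fun ω h => tsum_nonneg h
  have hg0 : 0 ≤ᵐ[μ] fun ω => ∑' i, g i ω := hgn.mono fun ω h => tsum_nonneg h
  have hfg0 : 0 ≤ᵐ[μ] (fun ω => ∑' i, f i ω) * fun ω => ∑' i, g i ω := by
    filter_upwards [hf0, hg0] with ω h1 h2 using mul_nonneg h1 h2
  have ef := ofReal_tsum_ae_eq hfn hfs
  have eg := ofReal_tsum_ae_eq hgn hgs
  have efg : (fun ω => ENNReal.ofReal (((fun ω => ∑' i, f i ω) * fun ω => ∑' i, g i ω) ω))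
      =ᵐ[μ] fun ω => (∑' i, ENNReal.ofReal (f i ω)) * ∑' i, ENNReal.ofReal (g i ω) := by
    filter_upwards [hf0, ef, eg] with ω h1 h2 h3
    rw [Pi.mul_apply, ENNReal.ofReal_mul h1, ← h2, ← h3]
  rw [covariance_eq_sub hfm hgm,
    integral_eq_lintegral_of_nonneg_ae hfg0
      (hfm.aestronglyMeasurable.mul hgm.aestronglyMeasurable),
    integral_eq_lintegral_of_nonneg_ae hf0 hfm.aestronglyMeasurable,
    integral_eq_lintegral_of_nonneg_ae hg0 hgm.aestronglyMeasurable,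
    lintegral_congr_ae ef, lintegral_congr_ae eg, lintegral_congr_ae efg, h,
    ENNReal.toReal_add hB (ENNReal.mul_ne_top hf hg), ENNReal.toReal_mul]
  ring

end NonnegativeSums

/-! ### Rayleigh fading and the received power of one interferer -/

section Fading

/-- The regularized path loss towards `U`, as an extended nonnegative real. -/
noncomputable def gain (α ε : ℝ) (U z : Plane) : ℝ≥0∞ := ENNReal.ofReal (pathLoss α ε (z - U))

theorem measurable_pathLoss (α ε : ℝ) : Measurable (pathLoss α ε) := by
  unfold pathLoss
  fun_prop

theorem pathLoss_nonneg {α ε : ℝ} (hε : 0 < ε) (z : Plane) : 0 ≤ pathLoss α ε z := by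
  unfold pathLoss
  positivity

theorem measurable_gain (α ε : ℝ) (U : Plane) : Measurable (gain α ε U) :=
  ((measurable_pathLoss α ε).comp (measurable_id.sub_const U)).ennreal_ofReal

variable {Ω : Type*} [MeasurableSpace Ω] {μ : Measure Ω}

/-- The second mixed moment of the gains towards two location-slot pairs. -/
noncomputable def fadingFactor (U₁ U₂ : Plane) (t₁ t₂ : ℕ) : ℝ≥0∞ :=
  open Classical in if (U₁, t₁) = (U₂, t₂) then 2 else 1

/-- A family of unit-mean exponential gains, independent over locations and slots. -/
structure IsRayleigh (μ : Measure Ω) (h : Plane → ℕ → Ω → ℝ) : Prop where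
  measurable : ∀ U t, Measurable (h U t)
  law : ∀ U t, HasLaw (h U t) (expMeasure 1) μ
  indep : ∀ U₁ t₁ U₂ t₂, (U₁, t₁) ≠ (U₂, t₂) → IndepFun (h U₁ t₁) (h U₂ t₂) μ

theorem IsRayleigh.ae_nonneg {h : Plane → ℕ → Ω → ℝ} (hh : IsRayleigh μ h) (U : Plane) (t : ℕ) :
    ∀ᵐ ω ∂μ, 0 ≤ h U t ω :=
  ((hh.law U t).ae_iff (p := fun x => 0 ≤ x) (by fun_prop)).2 ae_expMeasure_nonneg

theorem IsRayleigh.lintegral_pow {h : Plane → ℕ → Ω → ℝ} (hh : IsRayleigh μ h) (U : Plane) (t : ℕ)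
    (n : ℕ) : ∫⁻ ω, ENNReal.ofReal (h U t ω) ^ n ∂μ = (n.factorial : ℝ≥0∞) := by
  rw [(hh.law U t).lintegral_comp (f := fun x => ENNReal.ofReal x ^ n) (by fun_prop),
    lintegral_expMeasure_pow]

/-- The second moment of a unit exponential is 2! = 2, whereas distinct links are independent with
mean 1. This factor 2 is the origin of the limit 1/2. -/
theorem IsRayleigh.lintegral_mul {h : Plane → ℕ → Ω → ℝ} (hh : IsRayleigh μ h) (U₁ U₂ : Plane)
    (t₁ t₂ : ℕ) : ∫⁻ ω, ENNReal.ofReal (h U₁ t₁ ω) * ENNReal.ofReal (h U₂ t₂ ω) ∂μ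
      = fadingFactor U₁ U₂ t₁ t₂ := by
  unfold fadingFactor
  split_ifs with heq
  · obtain ⟨rfl, rfl⟩ := Prod.ext_iff.1 heq
    simp only [← sq]
    rw [hh.lintegral_pow]
    simp
  · have := lintegral_mul_eq_lintegral_mul_lintegral_of_indepFun (hh.measurable U₁ t₁).ennreal_ofReal
      (hh.measurable U₂ t₂).ennreal_ofReal
      ((hh.indep U₁ t₁ U₂ t₂ heq).comp ENNReal.measurable_ofReal ENNReal.measurable_ofReal)
    have h1 := hh.lintegral_pow U₁ t₁ 1
    have h2 := hh.lintegral_pow U₂ t₂ 1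
    simp only [pow_one, Nat.factorial_one, Nat.cast_one] at h1 h2
    simp only [Pi.mul_apply] at this
    rw [this, h1, h2, one_mul]

/-- The received power as a function of the gain. -/
noncomputable def received (α ε : ℝ) (U z : Plane) (x : ℝ) : ℝ≥0∞ :=
  ENNReal.ofReal x * gain α ε U z

theorem measurable_received (α ε : ℝ) (U : Plane) :
    Measurable (Function.uncurry (received α ε U)) :=
  (ENNReal.measurable_ofReal.comp measurable_snd).mul ((measurable_gain α ε U).comp measurable_fst)

/-- The base case: a single interferer, marked by its two gains. It is used directly for the PPP and
fed into `MarkMoments.cluster` for the other models. -/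
theorem IsRayleigh.markMoments {h : Plane → ℕ → Ω → ℝ} (hh : IsRayleigh μ h) (α ε : ℝ)
    (U₁ U₂ : Plane) (t₁ t₂ : ℕ) :
    MarkMoments μ (fun ω => (h U₁ t₁ ω, h U₂ t₂ ω))
      (fun z x => received α ε U₁ z x.1) (fun z x => received α ε U₂ z x.2)
      (gain α ε U₁) (gain α ε U₂)
      (fun z => fadingFactor U₁ U₂ t₁ t₂ * (gain α ε U₁ z * gain α ε U₂ z)) := by
  have m1 := hh.measurable U₁ t₁
  have m2 := hh.measurable U₂ t₂
  have h1 := hh.lintegral_pow U₁ t₁ 1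
  have h2 := hh.lintegral_pow U₂ t₂ 1
  simp only [pow_one, Nat.factorial_one, Nat.cast_one] at h1 h2
  refine ⟨m1.prodMk m2,
    (measurable_received α ε U₁).comp (measurable_fst.prodMk (measurable_fst.comp measurable_snd)),
    (measurable_received α ε U₂).comp (measurable_fst.prodMk (measurable_snd.comp measurable_snd)),
    fun z => ?_, fun z => ?_, fun z => ?_⟩
  · simp only [received]
    rw [lintegral_mul_const _ (by fun_prop), h1, one_mul]
  · simp only [received]
    rw [lintegral_mul_const _ (by fun_prop), h2, one_mul]
  · simp only [received, mul_mul_mul_comm]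
    rw [lintegral_mul_const _ (by fun_prop), hh.lintegral_mul]

end Fading

/-! ### Independence by grouping the sources of randomness -/

section Independence

variable {Ω S β E F : Type*} {m : S → MeasurableSpace Ω} [MeasurableSpace E]
  [MeasurableSpace F] {X : Ω → E} {Y : Ω → F}

/-- The `σ`-algebra generated by the sources whose key is `a`. -/
@[reducible]
def sigmaOf (m : S → MeasurableSpace Ω) (key : S → β) (a : β) : MeasurableSpace Ω :=
  ⨆ s ∈ {s | key s = a}, m s

theorem measurable_sigmaOf {key : S → β} {a : β} (s : S) (hX : Measurable[m s] X)
    (hs : key s = a) : Measurable[sigmaOf m key a] X :=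
  hX.mono (le_iSup₂ (f := fun s (_ : s ∈ {s | key s = a}) => m s) s hs) le_rfl

theorem measurable_seq {mΩ : MeasurableSpace Ω} {f : Ω → ℕ → E}
    (h : ∀ n, Measurable fun ω => f ω n) : Measurable f :=
  measurable_pi_iff.2 h

/-- Disjoint blocks of independent sources are independent, and a key function cuts the sources into
blocks. Independence claims in the three models reduce to choosing a key: cluster index, index
within the cluster, link, or a test on these. -/
theorem indepFun_of_key [MeasurableSpace Ω] {μ : Measure Ω} (hle : ∀ s, m s ≤ ‹MeasurableSpace Ω›) (h : iIndep m μ) (key : S → β)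
    {a b : β} (hab : a ≠ b) (hX : Measurable[sigmaOf m key a] X)
    (hY : Measurable[sigmaOf m key b] Y) : IndepFun X Y μ := by
  rw [IndepFun_iff_Indep]
  refine indep_of_indep_of_le_left (indep_of_indep_of_le_right
    (indep_iSup_of_disjoint hle h (S := {s | key s = a}) (T := {s | key s = b}) ?_)
    hY.comap_le) hX.comap_le
  rw [Set.disjoint_left]
  rintro s (rfl : key s = a) h
  exact hab h

end Independence

/-! ### Averaging over a random displacement -/

section Smear

/-- The average of `f` over a random displacement of law `κ`. -/
noncomputable def smear (κ : Measure Plane) (f : Plane → ℝ≥0∞) (z : Plane) : ℝ≥0∞ :=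
  ∫⁻ y, f (z + y) ∂κ

/-- The uniform distribution on the disk of radius `R`. -/
noncomputable abbrev diskLaw (R : ℝ) : Measure Plane := radialLaw (uniformDiskDensity R)

/-- The integral of the product of two functions on the plane. -/
noncomputable def overlap (f g : Plane → ℝ≥0∞) : ℝ≥0∞ := ∫⁻ z, f z * g z

theorem measurable_smear (κ : Measure Plane) [SFinite κ] {f : Plane → ℝ≥0∞} (hf : Measurable f) :
    Measurable (smear κ f) :=
  (hf.comp (measurable_fst.add measurable_snd)).lintegral_prod_right'

/-- By Tonelli and translation invariance, a random displacement preserves total mass. Hence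
clustering changes neither the mean interference nor the self-pair term at a given density. -/
theorem lintegral_smear (κ : Measure Plane) [IsProbabilityMeasure κ] {f : Plane → ℝ≥0∞}
    (hf : Measurable f) : ∫⁻ z, smear κ f z = ∫⁻ z, f z := by
  have hm : Measurable (Function.uncurry fun z y : Plane => f (z + y)) :=
    hf.comp (measurable_fst.add measurable_snd)
  simp only [smear]
  rw [lintegral_lintegral_swap hm.aemeasurable]
  simp only [lintegral_add_right_eq_self f, lintegral_const, measure_univ, mul_one]

theorem smear_const_mul (κ : Measure Plane) (c : ℝ≥0∞) {f : Plane → ℝ≥0∞} (hf : Measurable f) :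
    smear κ (fun z => c * f z) = fun z => c * smear κ f z := by
  funext z
  exact lintegral_const_mul _ (hf.comp (measurable_const_add z))

theorem overlap_const_mul (a b : ℝ≥0∞) {f g : Plane → ℝ≥0∞} (hf : Measurable f)
    (hg : Measurable g) :
    overlap (fun z => a * f z) (fun z => b * g z) = a * b * overlap f g := by
  simp only [overlap, mul_mul_mul_comm]
  exact lintegral_const_mul _ (hf.mul hg)

end Smear

/-! ### Interferer fields and their covariance kernels -/

section Fields

variable {Ω ι : Type*}

theorem InterfererField.ofReal_contribution (Φ : InterfererField Ω ι) {α ε : ℝ} (hε : 0 < ε)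
    (U : Plane) (t : ℕ) (i : ι) (ω : Ω) [Decidable (Φ.present i ω)] :
    ENNReal.ofReal (Φ.contribution α ε U t i ω)
      = if Φ.present i ω then received α ε U (Φ.pos i ω) (Φ.fade i U t ω) else 0 := by
  unfold contribution
  split_ifs with h
  · rw [Set.indicator_of_mem (by exact h), ENNReal.ofReal_mul' (pathLoss_nonneg hε _)]
    rfl
  · rw [Set.indicator_of_notMem (by exact h), ENNReal.ofReal_zero]

theorem InterfererField.measurable_contribution [MeasurableSpace Ω] (Φ : InterfererField Ω ι)
    (α ε : ℝ) (U : Plane) (t : ℕ) (i : ι) (hp : MeasurableSet {ω | Φ.present i ω})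
    (hpos : Measurable (Φ.pos i)) (hfade : Measurable (Φ.fade i U t)) :
    Measurable (Φ.contribution α ε U t i) := by
  have h : Φ.contribution α ε U t i = {ω | Φ.present i ω}.indicator
      (fun ω => Φ.fade i U t ω * pathLoss α ε (Φ.pos i ω - U)) := by
    funext ω
    unfold contribution
    by_cases hω : Φ.present i ω
    · rw [Set.indicator_of_mem (by exact hω), Set.indicator_of_mem (by exact hω)]
    · rw [Set.indicator_of_notMem (by exact hω), Set.indicator_of_notMem (by exact hω)]
  rw [h]
  exact (hfade.mul ((measurable_pathLoss α ε).comp (hpos.sub_const U))).indicator hp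

theorem InterfererField.contribution_nonneg (Φ : InterfererField Ω ι) {α ε : ℝ} (hε : 0 < ε)
    (U : Plane) (t : ℕ) (i : ι) (ω : Ω) (h : 0 ≤ Φ.fade i U t ω) :
    0 ≤ Φ.contribution α ε U t i ω := by
  refine Set.indicator_apply_nonneg fun _ => ?_
  exact mul_nonneg h (pathLoss_nonneg hε _)

/-- The first two moments of the interference of a field of density `lam` whose excess covariance
density, compared with a Poisson process, is `K`. -/
structure HasCovarianceKernel [MeasurableSpace Ω] (Φ : InterfererField Ω ι) (μ : Measure Ω)
    (α lam : ℝ) (K : ℝ → Plane → Plane → ℝ≥0∞) : Prop where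
  measurable : ∀ ε U t i, Measurable (Φ.contribution α ε U t i)
  nonneg : ∀ ε, 0 < ε → ∀ U t, ∀ᵐ ω ∂μ, ∀ i, 0 ≤ Φ.contribution α ε U t i ω
  mean : ∀ ε, 0 < ε → ∀ U t, ∫⁻ ω, ∑' i, ENNReal.ofReal (Φ.contribution α ε U t i ω) ∂μ
    = ENNReal.ofReal lam * ∫⁻ z, gain α ε U z
  mul : ∀ ε, 0 < ε → ∀ U₁ U₂ t₁ t₂,
    ∫⁻ ω, (∑' i, ENNReal.ofReal (Φ.contribution α ε U₁ t₁ i ω))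
        * ∑' i, ENNReal.ofReal (Φ.contribution α ε U₂ t₂ i ω) ∂μ
      = ENNReal.ofReal lam
          * (fadingFactor U₁ U₂ t₁ t₂ * overlap (gain α ε U₁) (gain α ε U₂) + K ε U₁ U₂)
        + (ENNReal.ofReal lam * ∫⁻ z, gain α ε U₁ z) * (ENNReal.ofReal lam * ∫⁻ z, gain α ε U₂ z)

end Fields

/-! ### Covariance kernel of the Poisson process -/

section PPP

variable {Ω : Type*} [MeasurableSpace Ω] {μ : Measure Ω} {lam : ℝ}

/-- The `σ`-algebras of the sources of randomness. -/
@[reducible]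
def PPPModel.source (P : PPPModel μ lam) : PPPSource → MeasurableSpace Ω
  | .points => MeasurableSpace.comap (fun ω n => P.Z n ω) inferInstance
  | .fading i U t => MeasurableSpace.comap (P.h i U t) inferInstance

theorem PPPModel.source_le (P : PPPModel μ lam) (s : PPPSource) :
    P.source s ≤ ‹MeasurableSpace Ω› := by
  cases s with
  | points => exact (measurable_pi_lambda _ P.poisson.measurable).comap_le
  | fading i U t => exact (P.measurable_h i U t).comap_le

theorem PPPModel.iIndep_source (P : PPPModel μ lam) : iIndep P.source μ := P.indep

/-- The index of the point to which a source of randomness belongs. -/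
def PPPSource.point : PPPSource → Option ℕ
  | .points => none
  | .fading i _ _ => some i

/-- Whether a source of randomness concerns the points. -/
def PPPSource.isPoints : PPPSource → Bool
  | .points => true
  | .fading _ _ _ => false

/-- The location and the slot of a fading source. -/
def PPPSource.link : PPPSource → Option (Plane × ℕ)
  | .points => none
  | .fading _ U t => some (U, t)

theorem PPPModel.isRayleigh (P : PPPModel μ lam) (i : ℕ) : IsRayleigh μ (P.h i) where
  measurable := P.measurable_h i
  law := P.law_h i
  indep U₁ t₁ U₂ t₂ hne := by
    refine indepFun_of_key P.source_le P.iIndep_source PPPSource.link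
      (a := some (U₁, t₁)) (b := some (U₂, t₂)) (by simpa using hne) ?_ ?_
    · exact measurable_sigmaOf (.fading i U₁ t₁) (comap_measurable _) rfl
    · exact measurable_sigmaOf (.fading i U₂ t₂) (comap_measurable _) rfl

theorem PPPModel.hasCovarianceKernel [IsProbabilityMeasure μ] (P : PPPModel μ lam) (hlam : 0 ≤ lam)
    (α : ℝ) : HasCovarianceKernel P.field μ α lam (fun _ _ _ => 0) := by
  have hsum : ∀ {ε : ℝ}, 0 < ε → ∀ U t ω,
      ∑' i, ENNReal.ofReal (P.field.contribution α ε U t i ω)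
        = ∑' n, received α ε U (P.Z n ω) (P.h n U t ω) := by
    intro ε hε U t ω
    classical
    refine tsum_congr fun n => ?_
    rw [P.field.ofReal_contribution hε]
    exact if_pos trivial
  have hmark : ∀ U₁ U₂ t₁ t₂ n,
      Measurable[sigmaOf P.source PPPSource.point (some n)]
        (fun ω => (P.h n U₁ t₁ ω, P.h n U₂ t₂ ω)) := fun U₁ U₂ t₁ t₂ n =>
    Measurable.prodMk (measurable_sigmaOf (.fading n U₁ t₁) (comap_measurable _) rfl)
      (measurable_sigmaOf (.fading n U₂ t₂) (comap_measurable _) rfl)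
  have hpair : ∀ U₁ U₂ t₁ t₂ n m, n ≠ m → IndepFun (fun ω => (P.h n U₁ t₁ ω, P.h n U₂ t₂ ω))
      (fun ω => (P.h m U₁ t₁ ω, P.h m U₂ t₂ ω)) μ := fun U₁ U₂ t₁ t₂ n m hnm =>
    indepFun_of_key P.source_le P.iIndep_source PPPSource.point (by simpa using hnm)
      (hmark U₁ U₂ t₁ t₂ n) (hmark U₁ U₂ t₁ t₂ m)
  have hZX : ∀ U₁ U₂ t₁ t₂, IndepFun (fun ω n => P.Z n ω)
      (fun ω n => (P.h n U₁ t₁ ω, P.h n U₂ t₂ ω)) μ := fun U₁ U₂ t₁ t₂ => by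
    refine indepFun_of_key P.source_le P.iIndep_source PPPSource.isPoints
      (a := true) (b := false) (by simp) ?_ ?_
    · exact measurable_sigmaOf .points (comap_measurable _) rfl
    · exact measurable_seq fun n =>
        Measurable.prodMk (measurable_sigmaOf (.fading n U₁ t₁) (comap_measurable _) rfl)
          (measurable_sigmaOf (.fading n U₂ t₂) (comap_measurable _) rfl)
  refine ⟨fun ε U t i => ?_, fun ε hε U t => ?_, fun ε hε U t => ?_, fun ε hε U₁ U₂ t₁ t₂ => ?_⟩
  · exact P.field.measurable_contribution α ε U t i MeasurableSet.univ
      (P.poisson.measurable i) (P.measurable_h i U t)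
  · filter_upwards [ae_all_iff.2 fun i => (P.isRayleigh i).ae_nonneg U t] with ω hω i
    exact P.field.contribution_nonneg hε U t i ω (hω i)
  · simp only [hsum hε]
    have h := P.poisson.lintegral_marked_sum hlam
      (fun n => (P.isRayleigh n).markMoments α ε U U t t) (hZX U U t t)
    exact h
  · simp only [hsum hε]
    have h := P.poisson.lintegral_marked_sum_mul hlam
      (fun n => (P.isRayleigh n).markMoments α ε U₁ U₂ t₁ t₂) (hZX U₁ U₂ t₁ t₂)
      (hpair U₁ U₂ t₁ t₂)
    have hgg : Measurable fun z => gain α ε U₁ z * gain α ε U₂ z :=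
      (measurable_gain _ _ _).mul (measurable_gain _ _ _)
    rw [lintegral_const_mul _ hgg] at h
    rw [h, add_zero]
    rfl

end PPP

/-! ### Covariance kernel of the Matérn cluster process -/

section MCP

variable {Ω : Type*} [MeasurableSpace Ω] {μ : Measure Ω} {lamO c R : ℝ}

/-- The `σ`-algebras of the sources of randomness. -/
@[reducible]
def MCPModel.source (M : MCPModel μ lamO c R) : MCPSource → MeasurableSpace Ω
  | .parents => MeasurableSpace.comap (fun ω n => M.Z n ω) inferInstance
  | .number n => MeasurableSpace.comap (M.N n) inferInstance
  | .offset n k => MeasurableSpace.comap (M.Y n k) inferInstance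
  | .fading i U t => MeasurableSpace.comap (M.h i U t) inferInstance

theorem MCPModel.source_le (M : MCPModel μ lamO c R) (s : MCPSource) :
    M.source s ≤ ‹MeasurableSpace Ω› := by
  cases s with
  | parents => exact (measurable_pi_lambda _ M.poisson.measurable).comap_le
  | number n => exact (M.measurable_N n).comap_le
  | offset n k => exact (M.measurable_Y n k).comap_le
  | fading i U t => exact (M.measurable_h i U t).comap_le

theorem MCPModel.iIndep_source (M : MCPModel μ lamO c R) : iIndep M.source μ := M.indep

/-- The index of the cluster to which a source of randomness belongs. -/
def MCPSource.cluster : MCPSource → Option ℕ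
  | .parents => none
  | .number n => some n
  | .offset n _ => some n
  | .fading i _ _ => some i.1

/-- The index within its cluster of the point to which a source of randomness belongs. -/
def MCPSource.member : MCPSource → Option ℕ
  | .parents => none
  | .number _ => none
  | .offset _ k => some k
  | .fading i _ _ => some i.2

/-- The location and the slot of a fading source. -/
def MCPSource.link : MCPSource → Option (Plane × ℕ)
  | .fading _ U t => some (U, t)
  | _ => none

theorem MCPModel.isRayleigh (M : MCPModel μ lamO c R) (i : ℕ × ℕ) : IsRayleigh μ (M.h i) where
  measurable := M.measurable_h i
  law := M.law_h i
  indep U₁ t₁ U₂ t₂ hne := by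
    refine indepFun_of_key M.source_le M.iIndep_source MCPSource.link
      (a := some (U₁, t₁)) (b := some (U₂, t₂)) (by simpa using hne) ?_ ?_
    · exact measurable_sigmaOf (.fading i U₁ t₁) (comap_measurable _) rfl
    · exact measurable_sigmaOf (.fading i U₂ t₂) (comap_measurable _) rfl

/-- The mark attached to the `n`-th parent. -/
def MCPModel.mark (M : MCPModel μ lamO c R) (U₁ U₂ : Plane) (t₁ t₂ n : ℕ) (ω : Ω) :
    ℕ × (ℕ → Plane × (ℝ × ℝ)) :=
  (M.N n ω, fun k => (M.Y n k ω, (M.h (n, k) U₁ t₁ ω, M.h (n, k) U₂ t₂ ω)))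

theorem MCPModel.measurable_mark (M : MCPModel μ lamO c R) {β : Type*} (key : MCPSource → β)
    (a : β) (U₁ U₂ : Plane) (t₁ t₂ n : ℕ) (hN : key (.number n) = a)
    (hY : ∀ k, key (.offset n k) = a) (hh : ∀ k U t, key (.fading (n, k) U t) = a) :
    Measurable[sigmaOf M.source key a] (M.mark U₁ U₂ t₁ t₂ n) :=
  Measurable.prodMk (measurable_sigmaOf (.number n) (comap_measurable _) hN)
    (measurable_seq fun k => Measurable.prodMk
      (measurable_sigmaOf (.offset n k) (comap_measurable _) (hY k))
      (Measurable.prodMk (measurable_sigmaOf (.fading (n, k) U₁ t₁) (comap_measurable _) (hh k _ _))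
        (measurable_sigmaOf (.fading (n, k) U₂ t₂) (comap_measurable _) (hh k _ _))))

theorem MCPModel.indepFun_parents_mark (M : MCPModel μ lamO c R) (U₁ U₂ : Plane) (t₁ t₂ : ℕ) :
    IndepFun (fun ω n => M.Z n ω) (fun ω n => M.mark U₁ U₂ t₁ t₂ n ω) μ := by
  refine indepFun_of_key M.source_le M.iIndep_source (fun s => s.cluster.isSome)
    (a := false) (b := true) (by simp) ?_ ?_
  · exact measurable_sigmaOf .parents (comap_measurable _) rfl
  · exact measurable_seq fun n =>
      M.measurable_mark _ _ U₁ U₂ t₁ t₂ n rfl (fun _ => rfl) (fun _ _ _ => rfl)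

theorem MCPModel.indepFun_mark (M : MCPModel μ lamO c R) (U₁ U₂ : Plane) (t₁ t₂ : ℕ) {n m : ℕ}
    (hnm : n ≠ m) : IndepFun (M.mark U₁ U₂ t₁ t₂ n) (M.mark U₁ U₂ t₁ t₂ m) μ :=
  indepFun_of_key M.source_le M.iIndep_source MCPSource.cluster
    (a := some n) (b := some m) (by simpa using hnm)
    (M.measurable_mark _ _ U₁ U₂ t₁ t₂ n rfl (fun _ => rfl) (fun _ _ _ => rfl))
    (M.measurable_mark _ _ U₁ U₂ t₁ t₂ m rfl (fun _ => rfl) (fun _ _ _ => rfl))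

theorem MCPModel.markMoments [IsProbabilityMeasure μ] (M : MCPModel μ lamO c R) (α ε : ℝ)
    (U₁ U₂ : Plane) (t₁ t₂ n : ℕ) :
    MarkMoments μ (M.mark U₁ U₂ t₁ t₂ n) (clusterSum fun z x => received α ε U₁ z x.1)
      (clusterSum fun z x => received α ε U₂ z x.2)
      (fun z => c.toNNReal * smear (diskLaw R) (gain α ε U₁) z)
      (fun z => c.toNNReal * smear (diskLaw R) (gain α ε U₂) z)
      (fun z => c.toNNReal * smear (diskLaw R)
          (fun z => fadingFactor U₁ U₂ t₁ t₂ * (gain α ε U₁ z * gain α ε U₂ z)) z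
        + (c.toNNReal * smear (diskLaw R) (gain α ε U₁) z)
          * (c.toNNReal * smear (diskLaw R) (gain α ε U₂) z)) := by
  refine MarkMoments.cluster (M.measurable_N n) (M.law_N n) (M.measurable_Y n) (M.law_Y n)
    (fun k => (M.isRayleigh (n, k)).markMoments α ε U₁ U₂ t₁ t₂) ?_ (fun k => ?_)
    (fun k l hkl => ?_)
  · refine indepFun_of_key M.source_le M.iIndep_source (fun s => s.member.isSome)
      (a := false) (b := true) (by simp) ?_ ?_
    · exact measurable_sigmaOf (.number n) (comap_measurable _) rfl
    · exact measurable_seq fun k => Measurable.prodMk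
        (measurable_sigmaOf (.offset n k) (comap_measurable _) rfl)
        (Measurable.prodMk (measurable_sigmaOf (.fading (n, k) U₁ t₁) (comap_measurable _) rfl)
          (measurable_sigmaOf (.fading (n, k) U₂ t₂) (comap_measurable _) rfl))
  · refine indepFun_of_key M.source_le M.iIndep_source (fun s => s.link.isSome)
      (a := false) (b := true) (by simp) ?_ ?_
    · exact measurable_sigmaOf (.offset n k) (comap_measurable _) rfl
    · exact Measurable.prodMk (measurable_sigmaOf (.fading (n, k) U₁ t₁) (comap_measurable _) rfl)
          (measurable_sigmaOf (.fading (n, k) U₂ t₂) (comap_measurable _) rfl)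
  · have h : ∀ k, Measurable[sigmaOf M.source MCPSource.member (some k)]
        (fun ω => (M.Y n k ω, (M.h (n, k) U₁ t₁ ω, M.h (n, k) U₂ t₂ ω))) := fun k =>
      Measurable.prodMk (measurable_sigmaOf (.offset n k) (comap_measurable _) rfl)
        (Measurable.prodMk (measurable_sigmaOf (.fading (n, k) U₁ t₁) (comap_measurable _) rfl)
          (measurable_sigmaOf (.fading (n, k) U₂ t₂) (comap_measurable _) rfl))
    exact indepFun_of_key M.source_le M.iIndep_source MCPSource.member
      (by simpa using hkl) (h k) (h l)

theorem tsum_ite_lt (N : ℕ) (f : ℕ → ℝ≥0∞) :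
    ∑' k, (if k < N then f k else 0) = ∑ k ∈ Finset.range N, f k := by
  rw [tsum_eq_sum (s := Finset.range N) fun k hk => if_neg (by simpa using hk)]
  exact Finset.sum_congr rfl fun k hk => if_pos (Finset.mem_range.1 hk)

/-- Pairs of interferers are of three kinds. A point with itself gives the fading term, two points
of different clusters give the product of means, and two siblings, displaced independently from a
common parent, give the kernel. -/
theorem MCPModel.hasCovarianceKernel [IsProbabilityMeasure μ] (M : MCPModel μ lamO c R)
    (hlam : 0 ≤ lamO) (α : ℝ) :
    HasCovarianceKernel M.field μ α (lamO * c) (fun ε U₁ U₂ => ENNReal.ofReal c *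
      overlap (smear (diskLaw R) (gain α ε U₁))
        (smear (diskLaw R) (gain α ε U₂))) := by
  have hprob : IsProbabilityMeasure (diskLaw R) :=
    (M.law_Y 0 0).isProbabilityMeasure_iff.1 inferInstance
  have hsum : ∀ {ε : ℝ}, 0 < ε → ∀ U t ω,
      ∑' i, ENNReal.ofReal (M.field.contribution α ε U t i ω)
        = ∑' n, ∑ k ∈ Finset.range (M.N n ω),
          received α ε U (M.Z n ω + M.Y n k ω) (M.h (n, k) U t ω) := by
    intro ε hε U t ω
    classical
    rw [ENNReal.tsum_prod']
    refine tsum_congr fun n => ?_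
    rw [← tsum_ite_lt]
    refine tsum_congr fun k => ?_
    rw [M.field.ofReal_contribution hε]
    exact if_congr Iff.rfl rfl rfl
  have hofReal : ((c.toNNReal : ℝ≥0) : ℝ≥0∞) = ENNReal.ofReal c := rfl
  have hg : ∀ ε U, Measurable (gain α ε U) := fun ε U => measurable_gain α ε U
  refine ⟨fun ε U t i => ?_, fun ε hε U t => ?_, fun ε hε U t => ?_, fun ε hε U₁ U₂ t₁ t₂ => ?_⟩
  · exact M.field.measurable_contribution α ε U t i
      (measurableSet_lt measurable_const (M.measurable_N i.1))
      ((M.poisson.measurable i.1).add (M.measurable_Y i.1 i.2)) (M.measurable_h i U t)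
  · filter_upwards [ae_all_iff.2 fun i => (M.isRayleigh i).ae_nonneg U t] with ω hω i
    exact M.field.contribution_nonneg hε U t i ω (hω i)
  · simp only [hsum hε]
    refine (M.poisson.lintegral_marked_sum hlam (fun n => M.markMoments α ε U U t t n)
      (M.indepFun_parents_mark U U t t)).trans ?_
    rw [lintegral_const_mul _ (measurable_smear (diskLaw R) (hg ε U)), lintegral_smear (diskLaw R) (hg ε U),
      hofReal, ENNReal.ofReal_mul hlam, mul_assoc]
  · simp only [hsum hε]
    refine (M.poisson.lintegral_marked_sum_mul hlam (fun n => M.markMoments α ε U₁ U₂ t₁ t₂ n)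
      (M.indepFun_parents_mark U₁ U₂ t₁ t₂) (fun n m h => M.indepFun_mark U₁ U₂ t₁ t₂ h)).trans ?_
    have hgg : Measurable fun z => gain α ε U₁ z * gain α ε U₂ z := (hg ε U₁).mul (hg ε U₂)
    have hs₁ := measurable_smear (diskLaw R) (hg ε U₁)
    have hs₂ := measurable_smear (diskLaw R) (hg ε U₂)
    have hcs : Measurable fun z => (c.toNNReal * smear (diskLaw R) (gain α ε U₁) z)
        * (c.toNNReal * smear (diskLaw R) (gain α ε U₂) z) :=
      (hs₁.const_mul _).mul (hs₂.const_mul _)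
    have hov := overlap_const_mul (c.toNNReal : ℝ≥0∞) c.toNNReal hs₁ hs₂
    rw [overlap] at hov
    rw [lintegral_add_right _ hcs, hov,
      lintegral_const_mul _ hs₁, lintegral_const_mul _ hs₂,
      lintegral_smear (diskLaw R) (hg ε U₁), lintegral_smear (diskLaw R) (hg ε U₂),
      lintegral_const_mul _ (measurable_smear (diskLaw R) (hgg.const_mul _)), lintegral_smear _
        (hgg.const_mul _), lintegral_const_mul _ hgg, hofReal, ENNReal.ofReal_mul hlam]
    simp only [overlap]
    ring

end MCP

/-! ### Covariance kernel of the second-order cluster process -/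

section SOCP

variable {Ω : Type*} [MeasurableSpace Ω] {μ : Measure Ω} {lamO c₁ R₁ σ c R : ℝ}

/-- The `σ`-algebras of the sources of randomness. -/
@[reducible]
def SOCPModel.source (S : SOCPModel μ lamO c₁ R₁ σ c R) : SOCPSource → MeasurableSpace Ω
  | .parents => MeasurableSpace.comap (fun ω n => S.Z n ω) inferInstance
  | .number₁ n => MeasurableSpace.comap (S.N₁ n) inferInstance
  | .offset₁ n k => MeasurableSpace.comap (S.V n k) inferInstance
  | .number₂ n k => MeasurableSpace.comap (S.N₂ n k) inferInstance
  | .offset₂ n k l => MeasurableSpace.comap (S.W n k l) inferInstance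
  | .fading i U t => MeasurableSpace.comap (S.h i U t) inferInstance

theorem SOCPModel.source_le (S : SOCPModel μ lamO c₁ R₁ σ c R) (s : SOCPSource) :
    S.source s ≤ ‹MeasurableSpace Ω› := by
  cases s with
  | parents => exact (measurable_pi_lambda _ S.poisson.measurable).comap_le
  | number₁ n => exact (S.measurable_N₁ n).comap_le
  | offset₁ n k => exact (S.measurable_V n k).comap_le
  | number₂ n k => exact (S.measurable_N₂ n k).comap_le
  | offset₂ n k l => exact (S.measurable_W n k l).comap_le
  | fading i U t => exact (S.measurable_h i U t).comap_le

theorem SOCPModel.iIndep_source (S : SOCPModel μ lamO c₁ R₁ σ c R) : iIndep S.source μ := S.indep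

/-- The index of the cluster to which a source of randomness belongs. -/
def SOCPSource.cluster : SOCPSource → Option ℕ
  | .parents => none
  | .number₁ n => some n
  | .offset₁ n _ => some n
  | .number₂ n _ => some n
  | .offset₂ n _ _ => some n
  | .fading i _ _ => some i.1

/-- The index within its cluster of the first-order point to which a source of randomness
belongs. -/
def SOCPSource.member : SOCPSource → Option ℕ
  | .parents => none
  | .number₁ _ => none
  | .offset₁ _ k => some k
  | .number₂ _ k => some k
  | .offset₂ _ k _ => some k
  | .fading i _ _ => some i.2.1

/-- Whether a source of randomness concerns the daughters of the first-order points. -/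
def SOCPSource.isSecond : SOCPSource → Bool
  | .parents => false
  | .number₁ _ => false
  | .offset₁ _ _ => false
  | .number₂ _ _ => true
  | .offset₂ _ _ _ => true
  | .fading _ _ _ => true

/-- The index among its siblings of the daughter to which a source of randomness belongs. -/
def SOCPSource.daughter : SOCPSource → Option ℕ
  | .offset₂ _ _ l => some l
  | .fading i _ _ => some i.2.2
  | _ => none

/-- The location and the slot of a fading source. -/
def SOCPSource.link : SOCPSource → Option (Plane × ℕ)
  | .fading _ U t => some (U, t)
  | _ => none

theorem SOCPModel.isRayleigh (S : SOCPModel μ lamO c₁ R₁ σ c R) (i : ℕ × ℕ × ℕ) :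
    IsRayleigh μ (S.h i) where
  measurable := S.measurable_h i
  law := S.law_h i
  indep U₁ t₁ U₂ t₂ hne := by
    refine indepFun_of_key S.source_le S.iIndep_source SOCPSource.link
      (a := some (U₁, t₁)) (b := some (U₂, t₂)) (by simpa using hne) ?_ ?_
    · exact measurable_sigmaOf (.fading i U₁ t₁) (comap_measurable _) rfl
    · exact measurable_sigmaOf (.fading i U₂ t₂) (comap_measurable _) rfl

variable (S : SOCPModel μ lamO c₁ R₁ σ c R) (U₁ U₂ : Plane) (t₁ t₂ : ℕ)

/-- The offset and the gains of a daughter of a first-order point. -/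
def SOCPModel.daughterMark (n k l : ℕ) (ω : Ω) : Plane × (ℝ × ℝ) :=
  (S.W n k l ω, (S.h (n, k, l) U₁ t₁ ω, S.h (n, k, l) U₂ t₂ ω))

/-- The mark attached to a first-order point. -/
def SOCPModel.firstMark (n k : ℕ) (ω : Ω) : ℕ × (ℕ → Plane × (ℝ × ℝ)) :=
  (S.N₂ n k ω, fun l => S.daughterMark U₁ U₂ t₁ t₂ n k l ω)

/-- The mark attached to a parent. -/
def SOCPModel.mark (n : ℕ) (ω : Ω) : ℕ × (ℕ → Plane × (ℕ × (ℕ → Plane × (ℝ × ℝ)))) :=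
  (S.N₁ n ω, fun k => (S.V n k ω, S.firstMark U₁ U₂ t₁ t₂ n k ω))

variable {β : Type*} (key : SOCPSource → β) (a : β)

theorem SOCPModel.measurable_daughterMark (n k l : ℕ) (hW : key (.offset₂ n k l) = a)
    (hh : ∀ U t, key (.fading (n, k, l) U t) = a) :
    Measurable[sigmaOf S.source key a] (S.daughterMark U₁ U₂ t₁ t₂ n k l) :=
  Measurable.prodMk (measurable_sigmaOf (.offset₂ n k l) (comap_measurable _) hW)
    (Measurable.prodMk
      (measurable_sigmaOf (.fading (n, k, l) U₁ t₁) (comap_measurable _) (hh _ _))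
      (measurable_sigmaOf (.fading (n, k, l) U₂ t₂) (comap_measurable _) (hh _ _)))

theorem SOCPModel.measurable_firstMark (n k : ℕ) (hN : key (.number₂ n k) = a)
    (hW : ∀ l, key (.offset₂ n k l) = a) (hh : ∀ l U t, key (.fading (n, k, l) U t) = a) :
    Measurable[sigmaOf S.source key a] (S.firstMark U₁ U₂ t₁ t₂ n k) :=
  Measurable.prodMk (measurable_sigmaOf (.number₂ n k) (comap_measurable _) hN)
    (measurable_seq fun l => S.measurable_daughterMark U₁ U₂ t₁ t₂ key a n k l (hW l) (hh l))

theorem SOCPModel.measurable_mark (n : ℕ) (hN₁ : key (.number₁ n) = a)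
    (hV : ∀ k, key (.offset₁ n k) = a) (hN : ∀ k, key (.number₂ n k) = a)
    (hW : ∀ k l, key (.offset₂ n k l) = a) (hh : ∀ k l U t, key (.fading (n, k, l) U t) = a) :
    Measurable[sigmaOf S.source key a] (S.mark U₁ U₂ t₁ t₂ n) :=
  Measurable.prodMk (measurable_sigmaOf (.number₁ n) (comap_measurable _) hN₁)
    (measurable_seq fun k => Measurable.prodMk
      (measurable_sigmaOf (.offset₁ n k) (comap_measurable _) (hV k))
      (S.measurable_firstMark U₁ U₂ t₁ t₂ key a n k (hN k) (hW k) (hh k)))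

theorem SOCPModel.indepFun_parents_mark :
    IndepFun (fun ω n => S.Z n ω) (fun ω n => S.mark U₁ U₂ t₁ t₂ n ω) μ := by
  refine indepFun_of_key S.source_le S.iIndep_source (fun s => s.cluster.isSome)
    (a := false) (b := true) (by simp) ?_ ?_
  · exact measurable_sigmaOf .parents (comap_measurable _) rfl
  · exact measurable_seq fun n => S.measurable_mark U₁ U₂ t₁ t₂ _ _ n rfl (fun _ => rfl)
      (fun _ => rfl) (fun _ _ => rfl) (fun _ _ _ _ => rfl)

theorem SOCPModel.indepFun_mark {n m : ℕ} (hnm : n ≠ m) :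
    IndepFun (S.mark U₁ U₂ t₁ t₂ n) (S.mark U₁ U₂ t₁ t₂ m) μ :=
  indepFun_of_key S.source_le S.iIndep_source SOCPSource.cluster
    (a := some n) (b := some m) (by simpa using hnm)
    (S.measurable_mark U₁ U₂ t₁ t₂ _ _ n rfl (fun _ => rfl)
      (fun _ => rfl) (fun _ _ => rfl) (fun _ _ _ _ => rfl))
    (S.measurable_mark U₁ U₂ t₁ t₂ _ _ m rfl (fun _ => rfl)
      (fun _ => rfl) (fun _ _ => rfl) (fun _ _ _ _ => rfl))

/-- The mean received power from the daughters of a first-order point. -/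
noncomputable def firstMean (α ε c R : ℝ) (U z : Plane) : ℝ≥0∞ :=
  c.toNNReal * smear (diskLaw R) (gain α ε U) z

/-- The mixed second moment of the received powers from the daughters of a first-order point. -/
noncomputable def firstMul (α ε c R : ℝ) (U₁ U₂ : Plane) (t₁ t₂ : ℕ) (z : Plane) : ℝ≥0∞ :=
  c.toNNReal * smear (diskLaw R)
      (fun z => fadingFactor U₁ U₂ t₁ t₂ * (gain α ε U₁ z * gain α ε U₂ z)) z
    + firstMean α ε c R U₁ z * firstMean α ε c R U₂ z

theorem SOCPModel.markMoments_firstMark [IsProbabilityMeasure μ] (α ε : ℝ) (n k : ℕ) :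
    MarkMoments μ (S.firstMark U₁ U₂ t₁ t₂ n k) (clusterSum fun z x => received α ε U₁ z x.1)
      (clusterSum fun z x => received α ε U₂ z x.2) (firstMean α ε c R U₁) (firstMean α ε c R U₂)
      (firstMul α ε c R U₁ U₂ t₁ t₂) := by
  refine MarkMoments.cluster (S.measurable_N₂ n k) (S.law_N₂ n k) (S.measurable_W n k)
    (S.law_W n k) (fun l => (S.isRayleigh (n, k, l)).markMoments α ε U₁ U₂ t₁ t₂) ?_ (fun l => ?_)
    (fun l l' hl => ?_)
  · refine indepFun_of_key S.source_le S.iIndep_source (fun s => s.daughter.isSome)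
      (a := false) (b := true) (by simp) ?_ ?_
    · exact measurable_sigmaOf (.number₂ n k) (comap_measurable _) rfl
    · exact measurable_seq fun l => S.measurable_daughterMark U₁ U₂ t₁ t₂ _ _ n k l rfl
        (fun _ _ => rfl)
  · refine indepFun_of_key S.source_le S.iIndep_source (fun s => s.link.isSome)
      (a := false) (b := true) (by simp) ?_ ?_
    · exact measurable_sigmaOf (.offset₂ n k l) (comap_measurable _) rfl
    · exact Measurable.prodMk
        (measurable_sigmaOf (.fading (n, k, l) U₁ t₁) (comap_measurable _) rfl)
        (measurable_sigmaOf (.fading (n, k, l) U₂ t₂) (comap_measurable _) rfl)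
  · exact indepFun_of_key S.source_le S.iIndep_source SOCPSource.daughter
      (a := some l) (b := some l') (by simpa using hl)
      (S.measurable_daughterMark U₁ U₂ t₁ t₂ _ _ n k l rfl (fun _ _ => rfl))
      (S.measurable_daughterMark U₁ U₂ t₁ t₂ _ _ n k l' rfl (fun _ _ => rfl))

/-- Second use of `MarkMoments.cluster`: each first-order point now carries its entire family of
daughters as its mark. -/
theorem SOCPModel.markMoments [IsProbabilityMeasure μ] (α ε : ℝ) (n : ℕ) :
    MarkMoments μ (S.mark U₁ U₂ t₁ t₂ n)
      (clusterSum (clusterSum fun z x => received α ε U₁ z x.1))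
      (clusterSum (clusterSum fun z x => received α ε U₂ z x.2))
      (fun z => c₁.toNNReal * smear (radialLaw (reverseGaussianDensity σ R₁))
        (firstMean α ε c R U₁) z)
      (fun z => c₁.toNNReal * smear (radialLaw (reverseGaussianDensity σ R₁))
        (firstMean α ε c R U₂) z)
      (fun z => c₁.toNNReal * smear (radialLaw (reverseGaussianDensity σ R₁))
          (firstMul α ε c R U₁ U₂ t₁ t₂) z
        + (c₁.toNNReal * smear (radialLaw (reverseGaussianDensity σ R₁))
            (firstMean α ε c R U₁) z)
          * (c₁.toNNReal * smear (radialLaw (reverseGaussianDensity σ R₁))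
            (firstMean α ε c R U₂) z)) := by
  refine MarkMoments.cluster (S.measurable_N₁ n) (S.law_N₁ n) (S.measurable_V n) (S.law_V n)
    (fun k => S.markMoments_firstMark U₁ U₂ t₁ t₂ α ε n k) ?_ (fun k => ?_) (fun k l hkl => ?_)
  · refine indepFun_of_key S.source_le S.iIndep_source (fun s => s.member.isSome)
      (a := false) (b := true) (by simp) ?_ ?_
    · exact measurable_sigmaOf (.number₁ n) (comap_measurable _) rfl
    · exact measurable_seq fun k => Measurable.prodMk
        (measurable_sigmaOf (.offset₁ n k) (comap_measurable _) rfl)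
        (S.measurable_firstMark U₁ U₂ t₁ t₂ _ _ n k rfl (fun _ => rfl) (fun _ _ _ => rfl))
  · refine indepFun_of_key S.source_le S.iIndep_source SOCPSource.isSecond
      (a := false) (b := true) (by simp) ?_ ?_
    · exact measurable_sigmaOf (.offset₁ n k) (comap_measurable _) rfl
    · exact S.measurable_firstMark U₁ U₂ t₁ t₂ _ _ n k rfl (fun _ => rfl) (fun _ _ _ => rfl)
  · have h : ∀ k, Measurable[sigmaOf S.source SOCPSource.member (some k)]
        (fun ω => (S.V n k ω, S.firstMark U₁ U₂ t₁ t₂ n k ω)) := fun k =>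
      Measurable.prodMk (measurable_sigmaOf (.offset₁ n k) (comap_measurable _) rfl)
        (S.measurable_firstMark U₁ U₂ t₁ t₂ _ _ n k rfl (fun _ => rfl) (fun _ _ _ => rfl))
    exact indepFun_of_key S.source_le S.iIndep_source SOCPSource.member
      (by simpa using hkl) (h k) (h l)

/-- Two daughters of one first-order point share its position and differ only by disk displacements:
the first summand. Two daughters of different first-order points share only the parent, so both
levels of displacement are averaged: the second summand. -/
theorem SOCPModel.hasCovarianceKernel [IsProbabilityMeasure μ] (hlam : 0 ≤ lamO) (hc₁ : 0 ≤ c₁)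
    (α : ℝ) :
    HasCovarianceKernel S.field μ α (lamO * c₁ * c) (fun ε U₁ U₂ => ENNReal.ofReal c *
        overlap (smear (diskLaw R) (gain α ε U₁)) (smear (diskLaw R) (gain α ε U₂))
      + ENNReal.ofReal c₁ * ENNReal.ofReal c *
        overlap (smear (radialLaw (reverseGaussianDensity σ R₁))
            (smear (diskLaw R) (gain α ε U₁)))
          (smear (radialLaw (reverseGaussianDensity σ R₁)) (smear (diskLaw R) (gain α ε U₂)))) := by
  have hprob : IsProbabilityMeasure (diskLaw R) :=
    (S.law_W 0 0 0).isProbabilityMeasure_iff.1 inferInstance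
  have hprob' : IsProbabilityMeasure (radialLaw (reverseGaussianDensity σ R₁)) :=
    (S.law_V 0 0).isProbabilityMeasure_iff.1 inferInstance
  have hsum : ∀ {ε : ℝ}, 0 < ε → ∀ U t ω,
      ∑' i, ENNReal.ofReal (S.field.contribution α ε U t i ω)
        = ∑' n, ∑ k ∈ Finset.range (S.N₁ n ω), ∑ l ∈ Finset.range (S.N₂ n k ω),
          received α ε U (S.Z n ω + S.V n k ω + S.W n k l ω) (S.h (n, k, l) U t ω) := by
    intro ε hε U t ω
    classical
    rw [ENNReal.tsum_prod']
    refine tsum_congr fun n => ?_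
    rw [ENNReal.tsum_prod', ← tsum_ite_lt]
    refine tsum_congr fun k => ?_
    split_ifs with hk
    · rw [← tsum_ite_lt]
      refine tsum_congr fun l => ?_
      rw [S.field.ofReal_contribution hε]
      exact if_congr (and_iff_right hk) rfl rfl
    · refine ENNReal.tsum_eq_zero.2 fun l => ?_
      rw [S.field.ofReal_contribution hε]
      exact if_neg fun h => hk h.1
  have hofReal : ∀ x : ℝ, ((x.toNNReal : ℝ≥0) : ℝ≥0∞) = ENNReal.ofReal x := fun _ => rfl
  have hg : ∀ ε U, Measurable (gain α ε U) := fun ε U => measurable_gain α ε U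
  have hs : ∀ ε U, Measurable (smear (diskLaw R) (gain α ε U)) := fun ε U =>
    measurable_smear _ (hg ε U)
  have hf : ∀ ε U, Measurable (firstMean α ε c R U) := fun ε U => (hs ε U).const_mul _
  have hv : ∀ ε U, Measurable (smear (radialLaw (reverseGaussianDensity σ R₁))
    (firstMean α ε c R U)) := fun ε U => measurable_smear _ (hf ε U)
  have hmean : ∀ ε U, ∫⁻ z, c₁.toNNReal * smear (radialLaw (reverseGaussianDensity σ R₁))
      (firstMean α ε c R U) z = ENNReal.ofReal c₁ * (ENNReal.ofReal c * ∫⁻ z, gain α ε U z) := by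
    intro ε U
    rw [lintegral_const_mul _ (hv ε U), lintegral_smear _ (hf ε U)]
    simp only [firstMean]
    rw [lintegral_const_mul _ (hs ε U), lintegral_smear _ (hg ε U)]
    rfl
  have hlam' : ENNReal.ofReal (lamO * c₁ * c)
      = ENNReal.ofReal lamO * ENNReal.ofReal c₁ * ENNReal.ofReal c := by
    rw [ENNReal.ofReal_mul (mul_nonneg hlam hc₁), ENNReal.ofReal_mul hlam]
  refine ⟨fun ε U t i => ?_, fun ε hε U t => ?_, fun ε hε U t => ?_, fun ε hε U₁ U₂ t₁ t₂ => ?_⟩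
  · exact S.field.measurable_contribution α ε U t i
      ((measurableSet_lt measurable_const (S.measurable_N₁ i.1)).inter
        (measurableSet_lt measurable_const (S.measurable_N₂ i.1 i.2.1)))
      (((S.poisson.measurable i.1).add (S.measurable_V i.1 i.2.1)).add
        (S.measurable_W i.1 i.2.1 i.2.2)) (S.measurable_h i U t)
  · filter_upwards [ae_all_iff.2 fun i => (S.isRayleigh i).ae_nonneg U t] with ω hω i
    exact S.field.contribution_nonneg hε U t i ω (hω i)
  · simp only [hsum hε]
    refine (S.poisson.lintegral_marked_sum hlam (fun n => S.markMoments U U t t α ε n)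
      (S.indepFun_parents_mark U U t t)).trans ?_
    rw [hmean, hlam']
    ring
  · simp only [hsum hε]
    refine (S.poisson.lintegral_marked_sum_mul hlam (fun n => S.markMoments U₁ U₂ t₁ t₂ α ε n)
      (S.indepFun_parents_mark U₁ U₂ t₁ t₂)
      (fun n m h => S.indepFun_mark U₁ U₂ t₁ t₂ h)).trans ?_
    have hgg : Measurable fun z => gain α ε U₁ z * gain α ε U₂ z := (hg ε U₁).mul (hg ε U₂)
    have hov := overlap_const_mul (c₁.toNNReal : ℝ≥0∞) c₁.toNNReal (hv ε U₁) (hv ε U₂)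
    have hov' := overlap_const_mul (c.toNNReal : ℝ≥0∞) c.toNNReal (hs ε U₁) (hs ε U₂)
    have hov'' := overlap_const_mul (c.toNNReal : ℝ≥0∞) c.toNNReal
      (measurable_smear (radialLaw (reverseGaussianDensity σ R₁)) (hs ε U₁))
      (measurable_smear (radialLaw (reverseGaussianDensity σ R₁)) (hs ε U₂))
    have hfm : ∀ U, firstMean α ε c R U
        = fun z => c.toNNReal * smear (diskLaw R) (gain α ε U) z := fun _ => rfl
    have hvv : Measurable fun z => (c₁.toNNReal * smear (radialLaw (reverseGaussianDensity σ R₁))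
        (firstMean α ε c R U₁) z) * (c₁.toNNReal * smear
        (radialLaw (reverseGaussianDensity σ R₁)) (firstMean α ε c R U₂) z) :=
      ((hv ε U₁).const_mul _).mul ((hv ε U₂).const_mul _)
    have hff : Measurable fun z => firstMean α ε c R U₁ z * firstMean α ε c R U₂ z :=
      (hf ε U₁).mul (hf ε U₂)
    have hmul : Measurable (firstMul α ε c R U₁ U₂ t₁ t₂) :=
      ((measurable_smear _ (hgg.const_mul _)).const_mul _).add hff
    have hmulint : ∫⁻ z, firstMul α ε c R U₁ U₂ t₁ t₂ z
        = ENNReal.ofReal c * (fadingFactor U₁ U₂ t₁ t₂ * overlap (gain α ε U₁) (gain α ε U₂))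
          + ENNReal.ofReal c * ENNReal.ofReal c *
          overlap (smear (diskLaw R) (gain α ε U₁)) (smear (diskLaw R) (gain α ε U₂)) := by
      simp only [firstMul]
      rw [lintegral_add_right _ hff,
        lintegral_const_mul _ (measurable_smear _ (hgg.const_mul _)),
        lintegral_smear _ (hgg.const_mul _), lintegral_const_mul _ hgg]
      exact congrArg₂ (· + ·) rfl hov'
    rw [hmean, hmean, lintegral_add_right _ hvv,
      lintegral_const_mul _ (measurable_smear _ hmul), lintegral_smear _ hmul, hmulint]
    rw [overlap] at hov
    rw [hov, hfm, hfm, smear_const_mul _ _ (hs ε U₁), smear_const_mul _ _ (hs ε U₂), hov'',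
      hlam', hofReal, hofReal]
    ring

end SOCP

/-! ### Scaling and integrability of the regularized path loss -/

section PathLoss

variable {α ε : ℝ}

theorem pathLoss_pos (hε : 0 < ε) (z : Plane) : 0 < pathLoss α ε z := by
  unfold pathLoss
  positivity

theorem pathLoss_le_of_le (hε : 0 < ε) {r : ℝ} (hr : 0 < r) (hα : 0 ≤ α) {z : Plane}
    (hz : r ≤ ‖z‖) : pathLoss α ε z ≤ 1 / r ^ α := by
  unfold pathLoss
  have h1 : 0 < r ^ α := Real.rpow_pos_of_pos hr α
  have h2 : r ^ α ≤ ‖z‖ ^ α := Real.rpow_le_rpow hr.le hz hα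
  exact one_div_le_one_div_of_le h1 (by linarith)

theorem le_pathLoss_of_le (hε : 0 < ε) {E r : ℝ} (hE : ε ≤ E) (hα : 0 ≤ α) {z : Plane}
    (hz : ‖z‖ ≤ r) : 1 / (E + r ^ α) ≤ pathLoss α ε z := by
  unfold pathLoss
  have h2 : ‖z‖ ^ α ≤ r ^ α := Real.rpow_le_rpow (norm_nonneg _) hz hα
  have h3 : 0 ≤ ‖z‖ ^ α := by positivity
  exact one_div_le_one_div_of_le (by linarith) (by linarith)

theorem pathLoss_le_inv (hε : 0 < ε) (z : Plane) : pathLoss α ε z ≤ 1 / ε := by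
  unfold pathLoss
  have h3 : 0 ≤ ‖z‖ ^ α := by positivity
  exact one_div_le_one_div_of_le hε (by linarith)

/-- Factor ε out of the denominator. This self-similarity turns the dependence on ε of the mass and
of the square integral into explicit powers. -/
theorem pathLoss_scale (hα : 0 < α) (hε : 0 < ε) (z : Plane) :
    pathLoss α ε z = ε⁻¹ * pathLoss α 1 (ε ^ (-(1 / α)) • z) := by
  unfold pathLoss
  have h1 : (ε ^ (-(1 / α))) ^ α = ε⁻¹ := by
    rw [← Real.rpow_mul hε.le, neg_mul, one_div, inv_mul_cancel₀ hα.ne', Real.rpow_neg_one]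
  rw [norm_smul, Real.norm_of_nonneg (by positivity),
    Real.mul_rpow (by positivity) (norm_nonneg _), h1]
  have h2 : (0 : ℝ) ≤ ‖z‖ ^ α := by positivity
  field_simp

theorem lintegral_comp_smul_plane {r : ℝ} (hr : 0 < r) {f : Plane → ℝ≥0∞} (hf : Measurable f) :
    ∫⁻ z, f (r • z) = ENNReal.ofReal ((r ^ 2)⁻¹) * ∫⁻ z, f z := by
  have h := Measure.map_addHaar_smul (volume : Measure Plane) hr.ne'
  rw [finrank_euclideanSpace, Fintype.card_fin, abs_of_pos (by positivity)] at h
  rw [← lintegral_map hf (measurable_const_smul r), h, lintegral_smul_measure, smul_eq_mul]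

/-- The order of magnitude `ε ^ (2 / α - 1)` of the mass of the regularized path loss. -/
noncomputable def massScale (α ε : ℝ) : ℝ := ε ^ (2 / α) / ε

theorem massScale_pos (hε : 0 < ε) : 0 < massScale α ε := by
  unfold massScale
  positivity

theorem sq_inv_scale (hε : 0 < ε) : ((ε ^ (-(1 / α))) ^ 2)⁻¹ = ε ^ (2 / α) := by
  rw [← Real.rpow_natCast, ← Real.rpow_mul hε.le, ← Real.rpow_neg hε.le]
  congr 1
  push_cast
  ring

/-- The planar Jacobian ε^(2/α) times the prefactor 1/ε gives `massScale`. The weight φ serves for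
the total mass, the square integral and the mass of a ball. -/
theorem lintegral_mul_scale (hα : 0 < α) (hε : 0 < ε) {φ : Plane → ℝ≥0∞} (hφ : Measurable φ) :
    ∫⁻ z, φ (ε ^ (-(1 / α)) • z) * ENNReal.ofReal (pathLoss α ε z)
      = ENNReal.ofReal (massScale α ε) * ∫⁻ z, φ z * ENNReal.ofReal (pathLoss α 1 z) := by
  have hm : Measurable fun z => φ z * ENNReal.ofReal (pathLoss α 1 z) :=
    hφ.mul (measurable_pathLoss α 1).ennreal_ofReal
  have h := lintegral_comp_smul_plane (r := ε ^ (-(1 / α))) (by positivity) hm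
  rw [sq_inv_scale hε] at h
  have h2 : ∀ z, φ (ε ^ (-(1 / α)) • z) * ENNReal.ofReal (pathLoss α ε z)
      = ENNReal.ofReal ε⁻¹ * (φ (ε ^ (-(1 / α)) • z)
        * ENNReal.ofReal (pathLoss α 1 (ε ^ (-(1 / α)) • z))) := by
    intro z
    rw [pathLoss_scale hα hε z, ENNReal.ofReal_mul (by positivity)]
    ring
  have hm' : Measurable fun z => φ (ε ^ (-(1 / α)) • z)
      * ENNReal.ofReal (pathLoss α 1 (ε ^ (-(1 / α)) • z)) :=
    hm.comp (measurable_const_smul _)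
  simp only [h2]
  rw [lintegral_const_mul _ hm', h, ← mul_assoc,
    ← ENNReal.ofReal_mul (by positivity)]
  congr 2
  unfold massScale
  ring

theorem lintegral_pathLoss (hα : 0 < α) (hε : 0 < ε) :
    ∫⁻ z, ENNReal.ofReal (pathLoss α ε z)
      = ENNReal.ofReal (massScale α ε) * ∫⁻ z, ENNReal.ofReal (pathLoss α 1 z) := by
  simpa using lintegral_mul_scale hα hε (φ := fun _ => 1) measurable_const

theorem lintegral_pathLoss_sq (hα : 0 < α) (hε : 0 < ε) :
    ∫⁻ z, ENNReal.ofReal (pathLoss α ε z) * ENNReal.ofReal (pathLoss α ε z)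
      = ENNReal.ofReal (massScale α ε / ε)
        * ∫⁻ z, ENNReal.ofReal (pathLoss α 1 z) * ENNReal.ofReal (pathLoss α 1 z) := by
  have hm := (measurable_pathLoss α 1).ennreal_ofReal
  have h2 : ∀ z, ENNReal.ofReal (pathLoss α ε z) * ENNReal.ofReal (pathLoss α ε z)
      = ENNReal.ofReal ε⁻¹ * (ENNReal.ofReal (pathLoss α 1 (ε ^ (-(1 / α)) • z))
        * ENNReal.ofReal (pathLoss α ε z)) := by
    intro z
    nth_rewrite 1 [pathLoss_scale hα hε z]
    rw [ENNReal.ofReal_mul (by positivity), mul_assoc]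
  have hm' : Measurable fun z => ENNReal.ofReal (pathLoss α 1 (ε ^ (-(1 / α)) • z))
      * ENNReal.ofReal (pathLoss α ε z) :=
    (hm.comp (measurable_const_smul _)).mul (measurable_pathLoss α ε).ennreal_ofReal
  simp only [h2]
  rw [lintegral_const_mul _ hm', lintegral_mul_scale hα hε hm, ← mul_assoc,
    ← ENNReal.ofReal_mul (by positivity)]
  congr 2
  ring

/-- Comparison with (1 + ‖z‖)^(-α), which is integrable because α exceeds the dimension 2. -/
theorem lintegral_pathLoss_one_ne_top (hα : 2 < α) :
    ∫⁻ z, ENNReal.ofReal (pathLoss α 1 z) ≠ ⊤ := by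
  have h := finite_integral_one_add_norm (E := Plane) (μ := volume) (r := α)
    (by rw [finrank_euclideanSpace, Fintype.card_fin]; exact_mod_cast hα)
  have hle : ∀ z : Plane, ENNReal.ofReal (pathLoss α 1 z)
      ≤ ENNReal.ofReal (2 ^ α) * ENNReal.ofReal ((1 + ‖z‖) ^ (-α)) := by
    intro z
    rw [← ENNReal.ofReal_mul (by positivity)]
    refine ENNReal.ofReal_le_ofReal ?_
    have h0 := norm_nonneg z
    have h1 : (1 + ‖z‖) ^ α ≤ 2 ^ α * (1 + ‖z‖ ^ α) := by
      rcases le_total ‖z‖ 1 with hz | hz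
      · calc (1 + ‖z‖) ^ α ≤ 2 ^ α :=
              Real.rpow_le_rpow (by positivity) (by linarith) (by linarith)
          _ ≤ 2 ^ α * (1 + ‖z‖ ^ α) := le_mul_of_one_le_right (by positivity)
              (by have : 0 ≤ ‖z‖ ^ α := by positivity
                  linarith)
      · calc (1 + ‖z‖) ^ α ≤ (2 * ‖z‖) ^ α :=
              Real.rpow_le_rpow (by positivity) (by linarith) (by linarith)
          _ = 2 ^ α * ‖z‖ ^ α := Real.mul_rpow (by norm_num) h0
          _ ≤ 2 ^ α * (1 + ‖z‖ ^ α) := by gcongr; linarith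
    unfold pathLoss
    rw [Real.rpow_neg (by positivity), ← div_eq_mul_inv, div_le_div_iff₀ (by positivity)
      (by positivity), one_mul]
    exact h1
  refine ne_top_of_le_ne_top ?_ (lintegral_mono hle)
  rw [lintegral_const_mul _ (by fun_prop)]
  exact ENNReal.mul_ne_top ENNReal.ofReal_ne_top h.ne

theorem lintegral_gain (U : Plane) (f : ℝ≥0∞ → ℝ≥0∞) :
    ∫⁻ z, f (gain α ε U z) = ∫⁻ z, f (ENNReal.ofReal (pathLoss α ε z)) :=
  lintegral_sub_right_eq_self (fun z => f (ENNReal.ofReal (pathLoss α ε z))) U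

theorem lintegral_gain_eq (hα : 0 < α) (hε : 0 < ε) (U : Plane) :
    ∫⁻ z, gain α ε U z
      = ENNReal.ofReal (massScale α ε) * ∫⁻ z, ENNReal.ofReal (pathLoss α 1 z) :=
  (lintegral_gain U fun x => x).trans (lintegral_pathLoss hα hε)

theorem overlap_gain_self (hα : 0 < α) (hε : 0 < ε) (U : Plane) :
    overlap (gain α ε U) (gain α ε U) = ENNReal.ofReal (massScale α ε / ε)
        * ∫⁻ z, ENNReal.ofReal (pathLoss α 1 z) * ENNReal.ofReal (pathLoss α 1 z) :=
  (lintegral_gain U fun x => x * x).trans (lintegral_pathLoss_sq hα hε)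

theorem lintegral_pathLoss_one_sq_ne_top (hα : 2 < α) :
    ∫⁻ z, ENNReal.ofReal (pathLoss α 1 z) * ENNReal.ofReal (pathLoss α 1 z) ≠ ⊤ := by
  refine ne_top_of_le_ne_top (lintegral_pathLoss_one_ne_top hα) (lintegral_mono fun z => ?_)
  refine mul_le_of_le_one_right' ?_
  rw [← ENNReal.ofReal_one]
  exact ENNReal.ofReal_le_ofReal (by simpa using pathLoss_le_inv (α := α) one_pos z)

theorem lintegral_pathLoss_one_sq_ne_zero :
    ∫⁻ z, ENNReal.ofReal (pathLoss α 1 z) * ENNReal.ofReal (pathLoss α 1 z) ≠ 0 := by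
  have hm := (measurable_pathLoss α 1).ennreal_ofReal
  have hm' : Measurable fun z => ENNReal.ofReal (pathLoss α 1 z)
      * ENNReal.ofReal (pathLoss α 1 z) := hm.mul hm
  rw [← pos_iff_ne_zero, lintegral_pos_iff_support hm']
  have : Function.support (fun z => ENNReal.ofReal (pathLoss α 1 z)
      * ENNReal.ofReal (pathLoss α 1 z)) = Set.univ := by
    refine Set.eq_univ_of_forall fun z => ?_
    have := ENNReal.ofReal_pos.2 (pathLoss_pos (α := α) one_pos z)
    exact mul_ne_zero this.ne' this.ne'
  rw [this]
  exact Measure.measure_univ_pos.2 (NeZero.ne _)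

/-- Every point is at distance at least ‖U₁ - U₂‖/2 from one of the two locations. The corresponding
factor is bounded uniformly in ε and the other one integrates to the mass, which saves a factor ε
over the overlap at a single location. -/
theorem overlap_gain_le (hα : 0 < α) (hε : 0 < ε) {U₁ U₂ : Plane} (hU : U₁ ≠ U₂) :
    overlap (gain α ε U₁) (gain α ε U₂)
      ≤ ENNReal.ofReal (1 / (‖U₁ - U₂‖ / 2) ^ α)
        * (2 * (ENNReal.ofReal (massScale α ε) * ∫⁻ z, ENNReal.ofReal (pathLoss α 1 z))) := by
  have hd : 0 < ‖U₁ - U₂‖ / 2 := by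
    have := norm_pos_iff.2 (sub_ne_zero.2 hU)
    positivity
  have hle : ∀ z, gain α ε U₁ z * gain α ε U₂ z
      ≤ ENNReal.ofReal (1 / (‖U₁ - U₂‖ / 2) ^ α) * (gain α ε U₁ z + gain α ε U₂ z) := by
    intro z
    have htri : ‖U₁ - U₂‖ ≤ ‖z - U₁‖ + ‖z - U₂‖ := by
      rw [show U₁ - U₂ = (z - U₂) - (z - U₁) by abel]
      exact (norm_sub_le _ _).trans (add_comm _ _).le
    rw [mul_add]
    rcases le_total (‖U₁ - U₂‖ / 2) ‖z - U₁‖ with h | h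
    · exact le_add_left (mul_le_mul_left
        (ENNReal.ofReal_le_ofReal (pathLoss_le_of_le hε hd hα.le h)) _)
    · refine le_add_right ?_
      rw [mul_comm]
      exact mul_le_mul_left
        (ENNReal.ofReal_le_ofReal (pathLoss_le_of_le hε hd hα.le (by linarith))) _
  refine (lintegral_mono hle).trans ?_
  have h1 := measurable_gain α ε U₁
  have h2 := measurable_gain α ε U₂
  have h12 : Measurable fun z => gain α ε U₁ z + gain α ε U₂ z := h1.add h2
  rw [lintegral_const_mul _ h12, lintegral_add_left h1,
    lintegral_gain_eq hα hε, lintegral_gain_eq hα hε, two_mul]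

theorem overlap_gain_ne_top (hα : 2 < α) (hε : 0 < ε) (U₁ U₂ : Plane) :
    overlap (gain α ε U₁) (gain α ε U₂) ≠ ⊤ := by
  by_cases hU : U₁ = U₂
  · rw [hU, overlap_gain_self (by linarith) hε]
    exact ENNReal.mul_ne_top ENNReal.ofReal_ne_top (lintegral_pathLoss_one_sq_ne_top hα)
  · exact ne_top_of_le_ne_top (ENNReal.mul_ne_top ENNReal.ofReal_ne_top (ENNReal.mul_ne_top
      (by simp) (ENNReal.mul_ne_top ENNReal.ofReal_ne_top (lintegral_pathLoss_one_ne_top hα))))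
      (overlap_gain_le (by linarith) hε hU)

end PathLoss

/-! ### Upper and lower bounds for disk averages -/

section DiskLaw

variable {R : ℝ}

theorem measurable_uniformDiskDensity (R : ℝ) : Measurable (uniformDiskDensity R) :=
  Measurable.ite measurableSet_Iic measurable_const measurable_const

theorem smear_diskLaw {f : Plane → ℝ≥0∞} (hf : Measurable f) (z : Plane) :
    smear (diskLaw R) f z = ∫⁻ x, ENNReal.ofReal (uniformDiskDensity R ‖x - z‖) * f x := by
  have hm : Measurable fun y : Plane => ENNReal.ofReal (uniformDiskDensity R ‖y‖) :=
    ((measurable_uniformDiskDensity R).comp measurable_norm).ennreal_ofReal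
  have hf' : Measurable fun y => f (z + y) := hf.comp (measurable_const_add z)
  rw [smear, diskLaw, radialLaw, lintegral_withDensity_eq_lintegral_mul _ hm hf',
    ← lintegral_add_left_eq_self (fun x => ENNReal.ofReal (uniformDiskDensity R ‖x - z‖) * f x) z]
  simp only [Pi.mul_apply, add_sub_cancel_left]

theorem smear_diskLaw_le (hR : 0 < R) {f : Plane → ℝ≥0∞} (hf : Measurable f) (z : Plane) :
    smear (diskLaw R) f z ≤ ENNReal.ofReal (1 / (Real.pi * R ^ 2)) * ∫⁻ x, f x := by
  rw [smear_diskLaw hf, ← lintegral_const_mul _ hf]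
  refine lintegral_mono fun x => mul_le_mul_left (ENNReal.ofReal_le_ofReal ?_) _
  unfold uniformDiskDensity
  split_ifs
  · exact le_rfl
  · positivity

theorem le_smear_diskLaw {f : Plane → ℝ≥0∞} (hf : Measurable f) {z U : Plane}
    (hz : z ∈ Metric.closedBall U (R / 2)) :
    ENNReal.ofReal (1 / (Real.pi * R ^ 2)) * ∫⁻ x in Metric.closedBall U (R / 2), f x
      ≤ smear (diskLaw R) f z := by
  rw [smear_diskLaw hf, ← lintegral_const_mul _ hf,
    ← lintegral_indicator Metric.isClosed_closedBall.measurableSet]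
  refine lintegral_mono (Set.indicator_le fun x hx => ?_)
  refine mul_le_mul_left (ENNReal.ofReal_le_ofReal ?_) _
  have : ‖x - z‖ ≤ R := by
    rw [← dist_eq_norm]
    have h1 := Metric.mem_closedBall.1 hx
    have h2 := Metric.mem_closedBall'.1 hz
    have := dist_triangle x U z
    linarith
  rw [uniformDiskDensity, if_pos this]

theorem overlap_le {f g : Plane → ℝ≥0∞} {C : ℝ≥0∞} (hf : ∀ z, f z ≤ C) (hg : Measurable g) :
    overlap f g ≤ C * ∫⁻ z, g z := by
  rw [← lintegral_const_mul _ hg]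
  exact lintegral_mono fun z => mul_le_mul_left (hf z) _

theorem smear_le {κ : Measure Plane} [IsProbabilityMeasure κ] {f : Plane → ℝ≥0∞} {C : ℝ≥0∞}
    (hf : ∀ z, f z ≤ C) (z : Plane) : smear κ f z ≤ C := by
  refine (lintegral_mono fun y => hf (z + y)).trans ?_
  rw [lintegral_const, measure_univ, mul_one]

/-- A lower bound for the mass of the path loss near the origin. -/
theorem le_setLIntegral_gain {α ε E : ℝ} (hα : 0 < α) (hε : 0 < ε) (hE : ε ≤ E) (U : Plane)
    {r : ℝ} (hr : 0 < r) :
    ENNReal.ofReal (massScale α ε) * ∫⁻ z in Metric.closedBall 0 (E ^ (-(1 / α)) * r),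
        ENNReal.ofReal (pathLoss α 1 z)
      ≤ ∫⁻ z in Metric.closedBall U r, gain α ε U z := by
  have hball : ∀ ρ : ℝ, MeasurableSet (Metric.closedBall (0 : Plane) ρ) := fun ρ =>
    Metric.isClosed_closedBall.measurableSet
  have h1 : ∫⁻ z in Metric.closedBall U r, gain α ε U z
      = ∫⁻ z, (Metric.closedBall 0 r).indicator (fun _ => 1) z
        * ENNReal.ofReal (pathLoss α ε z) := by
    rw [← lintegral_indicator Metric.isClosed_closedBall.measurableSet,
      ← lintegral_add_right_eq_self _ U]
    refine lintegral_congr fun z => ?_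
    by_cases hz : z ∈ Metric.closedBall (0 : Plane) r
    · have hz' : z + U ∈ Metric.closedBall U r := by
        simpa [dist_eq_norm] using hz
      rw [Set.indicator_of_mem hz, Set.indicator_of_mem hz', one_mul, gain, add_sub_cancel_right]
    · have hz' : z + U ∉ Metric.closedBall U r := by
        simpa [dist_eq_norm] using hz
      rw [Set.indicator_of_notMem hz, Set.indicator_of_notMem hz', zero_mul]
  have h2 : ∫⁻ z in Metric.closedBall (0 : Plane) (E ^ (-(1 / α)) * r),
        ENNReal.ofReal (pathLoss α 1 z)
      = ∫⁻ z, (Metric.closedBall 0 (E ^ (-(1 / α)) * r)).indicator (fun _ => 1) z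
        * ENNReal.ofReal (pathLoss α 1 z) := by
    rw [← lintegral_indicator (hball _)]
    refine lintegral_congr fun z => ?_
    by_cases hz : z ∈ Metric.closedBall (0 : Plane) (E ^ (-(1 / α)) * r)
    · rw [Set.indicator_of_mem hz, Set.indicator_of_mem hz, one_mul]
    · rw [Set.indicator_of_notMem hz, Set.indicator_of_notMem hz, zero_mul]
  rw [h1, h2, ← lintegral_mul_scale hα hε (measurable_const.indicator (hball _))]
  refine lintegral_mono fun z => mul_le_mul_left ?_ _
  by_cases hz : ε ^ (-(1 / α)) • z ∈ Metric.closedBall (0 : Plane) (E ^ (-(1 / α)) * r)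
  swap
  · rw [Set.indicator_of_notMem hz]
    exact zero_le
  have hs : 0 < ε ^ (-(1 / α)) := by positivity
  have hz' : z ∈ Metric.closedBall (0 : Plane) r := by
    rw [mem_closedBall_zero_iff] at hz ⊢
    rw [norm_smul, Real.norm_of_nonneg hs.le] at hz
    -- The negative exponent reverses the order: smaller ε magnifies more, so the ball rescaled at
    -- `E` suits every ε ≤ `E`.
    have hEe : E ^ (-(1 / α)) ≤ ε ^ (-(1 / α)) :=
      Real.rpow_le_rpow_of_nonpos hε hE (neg_nonpos.2 (by positivity))
    have : ε ^ (-(1 / α)) * ‖z‖ ≤ ε ^ (-(1 / α)) * r :=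
      hz.trans (mul_le_mul_of_nonneg_right hEe hr.le)
    exact le_of_mul_le_mul_left this hs
  rw [Set.indicator_of_mem hz, Set.indicator_of_mem hz']

/-- On the ball of radius R/2 around U₁, the average of the first path loss captures a fixed share
of its mass, and that of the second has a positive lower bound free of ε. This needs no relation
between R and the distance of the locations. -/
theorem exists_le_overlap_smear {α : ℝ} (hα : 2 < α) (hR : 0 < R) {E : ℝ} (hE : 0 < E)
    (U₁ U₂ : Plane) : ∃ b : ℝ, 0 < b ∧ ∀ ε, 0 < ε → ε ≤ E →
      ENNReal.ofReal (b * massScale α ε)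
        ≤ overlap (smear (diskLaw R) (gain α ε U₁)) (smear (diskLaw R) (gain α ε U₂)) := by
  have hα0 : 0 < α := by linarith
  set A := ∫⁻ z in Metric.closedBall (0 : Plane) (E ^ (-(1 / α)) * (R / 2)),
    ENNReal.ofReal (pathLoss α 1 z) with hA
  have hAtop : A ≠ ⊤ := ne_top_of_le_ne_top (lintegral_pathLoss_one_ne_top hα)
    (setLIntegral_le_lintegral _ _)
  have hpos : ∀ (V : Plane) (ρ : ℝ), 0 < ρ → 0 < volume (Metric.closedBall V ρ) := fun V ρ hρ =>
    Metric.measure_closedBall_pos _ _ hρ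
  have hA0 : 0 < A := by
    rw [hA, setLIntegral_pos_iff (measurable_pathLoss α 1).ennreal_ofReal]
    have : Function.support (fun z => ENNReal.ofReal (pathLoss α 1 z)) = Set.univ :=
      Set.eq_univ_of_forall fun z => (ENNReal.ofReal_pos.2 (pathLoss_pos (α := α) one_pos z)).ne'
    rw [this, Set.univ_inter]
    exact hpos _ _ (by positivity)
  set D := ENNReal.ofReal (1 / (Real.pi * R ^ 2)) with hD
  have hD0 : 0 < D := ENNReal.ofReal_pos.2 (by positivity)
  set v := volume (Metric.closedBall U₁ (R / 2)) with hv
  have hv0 : 0 < v := hpos _ _ (by positivity)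
  have hvtop : v ≠ ⊤ := measure_closedBall_lt_top.ne
  set q := ENNReal.ofReal (1 / (E + (R / 2 + ‖U₁ - U₂‖) ^ α)) with hq
  have hq0 : 0 < q := ENNReal.ofReal_pos.2 (by positivity)
  have htop : D * A * (D * (q * v)) * v ≠ ⊤ := by
    refine ENNReal.mul_ne_top (ENNReal.mul_ne_top (ENNReal.mul_ne_top ENNReal.ofReal_ne_top hAtop)
      (ENNReal.mul_ne_top ENNReal.ofReal_ne_top (ENNReal.mul_ne_top ENNReal.ofReal_ne_top hvtop)))
      hvtop
  have hne : D * A * (D * (q * v)) * v ≠ 0 := by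
    simp only [ne_eq, mul_eq_zero, not_or]
    exact ⟨⟨⟨hD0.ne', hA0.ne'⟩, hD0.ne', hq0.ne', hv0.ne'⟩, hv0.ne'⟩
  -- `D * A` bounds the average around U₁ per unit of `massScale`, `D * (q * v)` bounds the one
  -- towards U₂, and the last `v` is the area of the ball of integration.
  refine ⟨(D * A * (D * (q * v)) * v).toReal, ENNReal.toReal_pos hne htop, fun ε hε hεE => ?_⟩
  rw [ENNReal.ofReal_mul ENNReal.toReal_nonneg, ENNReal.ofReal_toReal htop]
  have h1 : ∀ z ∈ Metric.closedBall U₁ (R / 2),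
      (D * (ENNReal.ofReal (massScale α ε) * A)) * (D * (q * v))
        ≤ smear (diskLaw R) (gain α ε U₁) z * smear (diskLaw R) (gain α ε U₂) z := by
    intro z hz
    refine mul_le_mul' ?_ ?_
    · refine le_trans ?_ (le_smear_diskLaw (measurable_gain α ε U₁) hz)
      exact mul_le_mul_right (le_setLIntegral_gain hα0 hε hεE U₁ (by positivity)) _
    · refine le_trans ?_ (le_smear_diskLaw (measurable_gain α ε U₂) hz)
      refine mul_le_mul_right ?_ _
      rw [hv, ← setLIntegral_const]
      refine setLIntegral_mono (measurable_gain α ε U₂) fun x hx => ?_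
      refine ENNReal.ofReal_le_ofReal (le_pathLoss_of_le hε hεE hα0.le ?_)
      have hx' : ‖x - U₁‖ ≤ R / 2 := by simpa [dist_eq_norm] using hx
      calc ‖x - U₂‖ = ‖(x - U₁) + (U₁ - U₂)‖ := by congr 1; abel
        _ ≤ ‖x - U₁‖ + ‖U₁ - U₂‖ := norm_add_le _ _
        _ ≤ _ := by linarith
  calc D * A * (D * (q * v)) * v * ENNReal.ofReal (massScale α ε)
      = (D * (ENNReal.ofReal (massScale α ε) * A)) * (D * (q * v)) * v := by ring
    _ = ∫⁻ _ in Metric.closedBall U₁ (R / 2),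
          (D * (ENNReal.ofReal (massScale α ε) * A)) * (D * (q * v)) := by
        rw [setLIntegral_const]
    _ ≤ ∫⁻ z in Metric.closedBall U₁ (R / 2),
          smear (diskLaw R) (gain α ε U₁) z * smear (diskLaw R) (gain α ε U₂) z :=
        setLIntegral_mono' Metric.isClosed_closedBall.measurableSet h1
    _ ≤ _ := setLIntegral_le_lintegral _ _

end DiskLaw

/-! ### Positivity of the clustering functional -/

section ClusterF

variable {α ε R : ℝ}

/-- With θ = arccos(r/(2R)) the positivity of the lens area becomes the inequality cos θ sin θ < θ.
-/
theorem lensArea_eq {R r : ℝ} (hR : 0 < R) (hr : 0 ≤ r) (hr' : r ≤ 2 * R) :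
    lensArea R r = 2 * R ^ 2 * (Real.arccos (r / (2 * R))
      - Real.cos (Real.arccos (r / (2 * R))) * Real.sin (Real.arccos (r / (2 * R)))) := by
  have h0 : 0 ≤ r / (2 * R) := by positivity
  have h1 : r / (2 * R) ≤ 1 := (div_le_one (by positivity)).2 hr'
  rw [lensArea, if_pos ⟨hr, hr'⟩, Real.cos_arccos (by linarith) h1, Real.sin_arccos]
  have h2 : R ^ 2 - r ^ 2 / 4 = R ^ 2 * (1 - (r / (2 * R)) ^ 2) := by
    field_simp
    ring
  rw [h2, Real.sqrt_mul (by positivity), Real.sqrt_sq hR.le]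
  field_simp

theorem cos_mul_sin_lt {θ : ℝ} (h0 : 0 < θ) (h1 : θ ≤ Real.pi / 2) :
    Real.cos θ * Real.sin θ < θ := by
  have h2 : 0 ≤ Real.cos θ := Real.cos_nonneg_of_neg_pi_div_two_le_of_le (by linarith) h1
  have h3 := Real.cos_le_one θ
  have h4 := Real.sin_lt h0
  have h5 : 0 ≤ Real.sin θ := Real.sin_nonneg_of_nonneg_of_le_pi h0.le (by linarith [Real.pi_pos])
  nlinarith

theorem lensArea_nonneg (hR : 0 < R) (r : ℝ) : 0 ≤ lensArea R r := by
  by_cases h : 0 ≤ r ∧ r ≤ 2 * R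
  · rw [lensArea_eq hR h.1 h.2]
    rcases (Real.arccos_nonneg (r / (2 * R))).eq_or_lt with h0 | h0
    · simp [← h0]
    · have := cos_mul_sin_lt h0 (Real.arccos_le_pi_div_two.2 (div_nonneg h.1 (by positivity)))
      have : 0 ≤ Real.arccos (r / (2 * R)) - Real.cos (Real.arccos (r / (2 * R)))
        * Real.sin (Real.arccos (r / (2 * R))) := by linarith
      positivity
  · rw [lensArea, if_neg h]

theorem lensArea_pos (hR : 0 < R) {r : ℝ} (h0 : 0 ≤ r) (h : r < 2 * R) : 0 < lensArea R r := by
  rw [lensArea_eq hR h0 h.le]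
  have h1 : 0 < Real.arccos (r / (2 * R)) := Real.arccos_pos.2 ((div_lt_one (by positivity)).2 h)
  have := cos_mul_sin_lt h1 (Real.arccos_le_pi_div_two.2 (by positivity))
  have : 0 < Real.arccos (r / (2 * R)) - Real.cos (Real.arccos (r / (2 * R)))
    * Real.sin (Real.arccos (r / (2 * R))) := by linarith
  positivity

theorem lensArea_le (hR : 0 < R) (r : ℝ) : lensArea R r ≤ 2 * R ^ 2 * Real.pi := by
  rw [lensArea]
  split_ifs with h
  · have h1 := Real.arccos_le_pi (r / (2 * R))
    have h2 := mul_nonneg h.1 (Real.sqrt_nonneg (R ^ 2 - r ^ 2 / 4))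
    have h3 : 2 * R ^ 2 * Real.arccos (r / (2 * R)) ≤ 2 * R ^ 2 * Real.pi := by gcongr
    linarith
  · positivity

theorem measurable_lensArea (R : ℝ) : Measurable (lensArea R) := by
  have : Measurable Real.arccos := Real.continuous_arccos.measurable
  unfold lensArea
  exact Measurable.ite (measurableSet_Icc (a := (0 : ℝ)) (b := 2 * R)) (by fun_prop)
    measurable_const

theorem integrable_pathLoss (hα : 2 < α) (hε : 0 < ε) : Integrable (pathLoss α ε) := by
  refine ⟨(measurable_pathLoss α ε).aestronglyMeasurable, ?_⟩
  rw [hasFiniteIntegral_iff_ofReal (ae_of_all _ fun z => pathLoss_nonneg hε z),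
    lintegral_pathLoss (by linarith) hε]
  exact ENNReal.mul_lt_top ENNReal.ofReal_lt_top (lintegral_pathLoss_one_ne_top hα).lt_top

/-- The integrand is nonnegative, and it is positive on the product of two balls of radius R about
0, whose points are less than 2R apart. -/
theorem clusterF_pos (hα : 2 < α) (hε : 0 < ε) {c : ℝ} (hc : 0 < c) (hR : 0 < R) :
    0 < clusterF α ε c R := by
  have hg := integrable_pathLoss hα hε
  have hmL : Measurable fun p : Plane × Plane => lensArea R ‖p.1 - p.2‖ :=
    (measurable_lensArea R).comp (by fun_prop)
  have hint : Integrable (fun p : Plane × Plane =>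
      pathLoss α ε p.1 * pathLoss α ε p.2 * lensArea R ‖p.1 - p.2‖)
      ((volume : Measure Plane).prod volume) := by
    refine (hg.mul_prod hg).mul_bdd (c := 2 * R ^ 2 * Real.pi) hmL.aestronglyMeasurable
      (ae_of_all _ fun p => ?_)
    rw [Real.norm_of_nonneg (lensArea_nonneg hR _)]
    exact lensArea_le hR _
  unfold clusterF
  refine mul_pos (by positivity) ?_
  rw [← integral_prod (fun p : Plane × Plane =>
    pathLoss α ε p.1 * pathLoss α ε p.2 * lensArea R ‖p.1 - p.2‖) hint,
    integral_pos_iff_support_of_nonneg (fun p => ?_) hint]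
  · have hsub : Metric.ball (0 : Plane) R ×ˢ Metric.ball (0 : Plane) R ⊆ Function.support
        (fun p : Plane × Plane =>
          pathLoss α ε p.1 * pathLoss α ε p.2 * lensArea R ‖p.1 - p.2‖) := by
      rintro ⟨x, y⟩ ⟨hx, hy⟩
      have hx' : ‖x‖ < R := by simpa using hx
      have hy' : ‖y‖ < R := by simpa using hy
      have hxy : ‖x - y‖ < 2 * R := (norm_sub_le x y).trans_lt (by linarith)
      exact (mul_pos (mul_pos (pathLoss_pos hε x) (pathLoss_pos hε y))
        (lensArea_pos hR (norm_nonneg _) hxy)).ne'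
    refine lt_of_lt_of_le ?_ (measure_mono hsub)
    rw [Measure.prod_prod]
    have := Metric.measure_ball_pos (volume : Measure Plane) 0 hR
    exact ENNReal.mul_pos this.ne' this.ne'
  · exact mul_nonneg (mul_nonneg (pathLoss_nonneg hε _) (pathLoss_nonneg hε _))
      (lensArea_nonneg hR _)

end ClusterF

/-! ### Asymptotics of the correlation quotients -/

section Limits

variable {α : ℝ}

theorem tendsto_rpow_two_div (hα : 0 < α) :
    Tendsto (fun ε : ℝ => ε ^ (2 / α)) (𝓝[>] 0) (𝓝 0) := by
  have h : ContinuousAt (fun ε : ℝ => ε ^ (2 / α)) 0 :=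
    Real.continuousAt_rpow_const 0 (2 / α) (Or.inr (by positivity))
  have h2 := h.tendsto
  rw [Real.zero_rpow (by positivity)] at h2
  exact h2.mono_left nhdsWithin_le_nhds

theorem tendsto_id_pos : Tendsto (fun ε : ℝ => ε) (𝓝[>] 0) (𝓝 0) :=
  tendsto_id.mono_left nhdsWithin_le_nhds

variable {G₁ C : ℝ} {g g₁₂ k k₁₂ : ℝ → ℝ}

/-- The quotient lies between 1/2 and 1/2 + k/g, and k/g is at most a constant times `massScale α ε
* ε` = ε^(2/α). -/
theorem tendsto_same (hα : 0 < α) (hG : 0 < G₁)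
    (hg : ∀ ε, 0 < ε → g ε = massScale α ε / ε * G₁)
    (hk0 : ∀ ε, 0 < ε → 0 ≤ k ε) (hk : ∀ ε, 0 < ε → k ε ≤ C * massScale α ε ^ 2) :
    Tendsto (fun ε => (g ε + k ε) / (2 * g ε + k ε)) (𝓝[>] 0) (𝓝 (1 / 2)) := by
  have hlim : Tendsto (fun ε => 1 / 2 + C / G₁ * ε ^ (2 / α)) (𝓝[>] 0) (𝓝 (1 / 2)) := by
    have h := ((tendsto_rpow_two_div hα).const_mul (C / G₁)).const_add (1 / 2)
    rwa [mul_zero, add_zero] at h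
  refine tendsto_of_tendsto_of_tendsto_of_le_of_le' tendsto_const_nhds hlim ?_ ?_
  · filter_upwards [self_mem_nhdsWithin] with ε hε
    have hε : 0 < ε := hε
    have hp := massScale_pos (α := α) hε
    have hgp : 0 < g ε := by rw [hg ε hε]; positivity
    rw [div_le_div_iff₀ (by norm_num) (by linarith [hk0 ε hε])]
    linarith [hk0 ε hε]
  · filter_upwards [self_mem_nhdsWithin] with ε hε
    have hε : 0 < ε := hε
    have hp := massScale_pos (α := α) hε
    have hgp : 0 < g ε := by rw [hg ε hε]; positivity
    have h1 : k ε / g ε ≤ C / G₁ * ε ^ (2 / α) := by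
      rw [div_le_iff₀ hgp]
      refine (hk ε hε).trans (le_of_eq ?_)
      rw [hg ε hε]
      have : ε ^ (2 / α) = massScale α ε * ε := by
        unfold massScale
        field_simp
      rw [this]
      field_simp
    have h2 : (g ε + k ε) / (2 * g ε + k ε) ≤ 1 / 2 + k ε / g ε := by
      rw [div_le_iff₀ (by linarith [hk0 ε hε])]
      have h3 : k ε / g ε * g ε = k ε := div_mul_cancel₀ _ hgp.ne'
      have h4 : 0 ≤ k ε / g ε := div_nonneg (hk0 ε hε) hgp.le
      nlinarith [mul_nonneg h4 (hk0 ε hε), hk0 ε hε]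
    linarith

/-- The denominator is at least g. Relative to g, the overlap g₁₂ is O(ε) and the excess k₁₂ is
O(ε^(2/α)). -/
theorem tendsto_different (hα : 0 < α) (hG : 0 < G₁)
    (hg : ∀ ε, 0 < ε → g ε = massScale α ε / ε * G₁)
    (hk0 : ∀ ε, 0 < ε → 0 ≤ k ε) (hk0' : ∀ ε, 0 < ε → 0 ≤ k₁₂ ε)
    (hk' : ∀ ε, 0 < ε → k₁₂ ε ≤ C * massScale α ε ^ 2)
    (hg0' : ∀ ε, 0 < ε → 0 ≤ g₁₂ ε) {B : ℝ}
    (hg' : ∀ ε, 0 < ε → g₁₂ ε ≤ B * massScale α ε) :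
    Tendsto (fun ε => (g₁₂ ε + k₁₂ ε) / (2 * g ε + k ε)) (𝓝[>] 0) (𝓝 0) := by
  have hlim : Tendsto (fun ε => B / G₁ * ε + C / G₁ * ε ^ (2 / α)) (𝓝[>] 0) (𝓝 0) := by
    simpa using (tendsto_id_pos.const_mul (B / G₁)).add
      ((tendsto_rpow_two_div hα).const_mul (C / G₁))
  refine tendsto_of_tendsto_of_tendsto_of_le_of_le' tendsto_const_nhds hlim ?_ ?_
  · filter_upwards [self_mem_nhdsWithin] with ε hε
    have hε : 0 < ε := hε
    have hp := massScale_pos (α := α) hε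
    have hgp : 0 < g ε := by rw [hg ε hε]; positivity
    exact div_nonneg (add_nonneg (hg0' ε hε) (hk0' ε hε)) (by linarith [hk0 ε hε])
  · filter_upwards [self_mem_nhdsWithin] with ε hε
    have hε : 0 < ε := hε
    have hp := massScale_pos (α := α) hε
    have hgp : 0 < g ε := by rw [hg ε hε]; positivity
    have hn := add_nonneg (hg0' ε hε) (hk0' ε hε)
    calc (g₁₂ ε + k₁₂ ε) / (2 * g ε + k ε) ≤ (g₁₂ ε + k₁₂ ε) / g ε :=
          div_le_div_of_nonneg_left hn hgp (by linarith [hk0 ε hε])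
      _ ≤ (B * massScale α ε + C * massScale α ε ^ 2) / g ε := by
          gcongr
          · exact hg' ε hε
          · exact hk' ε hε
      _ = B / G₁ * ε + C / G₁ * ε ^ (2 / α) := by
          have : ε ^ (2 / α) = massScale α ε * ε := by
            unfold massScale
            field_simp
          rw [hg ε hε, this]
          field_simp

theorem div_lt_div_add {g g₁₂ k k₁₂ : ℝ} (hg : 0 < g) (hk : 0 ≤ k) (h : g₁₂ * k < 2 * g * k₁₂) :
    g₁₂ / (2 * g) < (g₁₂ + k₁₂) / (2 * g + k) := by
  rw [div_lt_div_iff₀ (by linarith) (by linarith)]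
  linarith

/-- After cross-multiplication, a term of order `massScale` cubed must be beaten by one of order
`massScale` squared over ε. Their quotient is O(ε^(2/α)), so small ε suffices. -/
theorem eventually_lt_different (hα : 0 < α) (hG : 0 < G₁)
    (hg : ∀ ε, 0 < ε → g ε = massScale α ε / ε * G₁)
    (hk0 : ∀ ε, 0 < ε → 0 ≤ k ε) (hk : ∀ ε, 0 < ε → k ε ≤ C * massScale α ε ^ 2)
    {b : ℝ} (hb : 0 < b) (hk' : ∀ ε, 0 < ε → ε ≤ 1 → b * massScale α ε ≤ k₁₂ ε)
    {B : ℝ} (hB : 0 ≤ B) (hg' : ∀ ε, 0 < ε → g₁₂ ε ≤ B * massScale α ε) :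
    ∀ᶠ ε in 𝓝[>] (0 : ℝ), g₁₂ ε / (2 * g ε) < (g₁₂ ε + k₁₂ ε) / (2 * g ε + k ε) := by
  have hlim : Tendsto (fun ε : ℝ => B * C * ε ^ (2 / α)) (𝓝[>] 0) (𝓝 0) := by
    simpa using (tendsto_rpow_two_div hα).const_mul (B * C)
  have h1 : ∀ᶠ ε : ℝ in 𝓝[>] 0, ε < 1 := tendsto_id_pos.eventually (gt_mem_nhds one_pos)
  filter_upwards [self_mem_nhdsWithin, h1,
    -- The threshold 2G₁b is what remains of the right side after dividing by `massScale α ε ^ 2 /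
    -- ε`.
    hlim.eventually (gt_mem_nhds (show (0 : ℝ) < 2 * G₁ * b by positivity))] with ε hε hε1 hεs
  have hε : 0 < ε := hε
  have hp := massScale_pos (α := α) hε
  have hgp : 0 < g ε := by rw [hg ε hε]; positivity
  refine div_lt_div_add hgp (hk0 ε hε) ?_
  have hs : ε ^ (2 / α) = massScale α ε * ε := by
    unfold massScale
    field_simp
  rw [hs] at hεs
  calc g₁₂ ε * k ε ≤ (B * massScale α ε) * (C * massScale α ε ^ 2) :=
        mul_le_mul (hg' ε hε) (hk ε hε) (hk0 ε hε) (by positivity)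
    _ = massScale α ε ^ 2 / ε * (B * C * (massScale α ε * ε)) := by field_simp
    _ < massScale α ε ^ 2 / ε * (2 * G₁ * b) := by gcongr
    _ = 2 * g ε * (b * massScale α ε) := by rw [hg ε hε]; field_simp
    _ ≤ 2 * g ε * k₁₂ ε := by gcongr; exact hk' ε hε hε1.le

end Limits

/-! ### Size bounds for the excess kernels -/

section Kernels

variable {α : ℝ} {K : ℝ → Plane → Plane → ℝ≥0∞}

/-- The bounds on an excess covariance density which make it negligible, as `ε → 0`, compared with
the second moment of the path loss. -/
structure IsAdmissibleKernel (α : ℝ) (K : ℝ → Plane → Plane → ℝ≥0∞) : Prop where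
  upper : ∃ C : ℝ, 0 ≤ C ∧ ∀ ε, 0 < ε → ∀ U₁ U₂, K ε U₁ U₂ ≤ ENNReal.ofReal (C * massScale α ε ^ 2)
  translate : ∀ ε U, K ε U U = K ε 0 0

/-- An excess covariance density bounded below by the mass of the path loss. -/
def IsPositiveKernel (α : ℝ) (K : ℝ → Plane → Plane → ℝ≥0∞) : Prop :=
  ∀ E, 0 < E → ∀ U₁ U₂, ∃ b : ℝ, 0 < b ∧
    ∀ ε, 0 < ε → ε ≤ E → ENNReal.ofReal (b * massScale α ε) ≤ K ε U₁ U₂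

theorem IsAdmissibleKernel.ne_top (hK : IsAdmissibleKernel α K) {ε : ℝ} (hε : 0 < ε)
    (U₁ U₂ : Plane) : K ε U₁ U₂ ≠ ⊤ := by
  obtain ⟨C, _, h⟩ := hK.upper
  exact ne_top_of_le_ne_top ENNReal.ofReal_ne_top (h ε hε U₁ U₂)

theorem isAdmissibleKernel_zero : IsAdmissibleKernel α (fun _ _ _ => 0) where
  upper := ⟨0, le_rfl, fun _ _ _ _ => zero_le⟩
  translate _ _ := rfl

theorem IsAdmissibleKernel.add {L : ℝ → Plane → Plane → ℝ≥0∞} (hK : IsAdmissibleKernel α K)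
    (hL : IsAdmissibleKernel α L) :
    IsAdmissibleKernel α (fun ε U₁ U₂ => K ε U₁ U₂ + L ε U₁ U₂) where
  upper := by
    obtain ⟨C, hC, h⟩ := hK.upper
    obtain ⟨D, hD, h'⟩ := hL.upper
    refine ⟨C + D, add_nonneg hC hD, fun ε hε U₁ U₂ => ?_⟩
    rw [add_mul, ENNReal.ofReal_add (by positivity) (by positivity)]
    exact add_le_add (h ε hε U₁ U₂) (h' ε hε U₁ U₂)
  translate ε U := by rw [hK.translate, hL.translate]

theorem IsAdmissibleKernel.const_mul (hK : IsAdmissibleKernel α K) (c : ℝ) :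
    IsAdmissibleKernel α (fun ε U₁ U₂ => ENNReal.ofReal c * K ε U₁ U₂) where
  upper := by
    obtain ⟨C, hC, h⟩ := hK.upper
    refine ⟨max c 0 * C, by positivity, fun ε hε U₁ U₂ => ?_⟩
    rw [mul_assoc, ENNReal.ofReal_mul (le_max_right _ _)]
    exact mul_le_mul' (ENNReal.ofReal_le_ofReal (le_max_left _ _)) (h ε hε U₁ U₂)
  translate ε U := by rw [hK.translate]

theorem gain_eq_shift (α ε : ℝ) (U : Plane) : gain α ε U = fun z => gain α ε 0 (z - U) := by
  funext z
  simp [gain]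

theorem smear_shift (κ : Measure Plane) (f : Plane → ℝ≥0∞) (U : Plane) :
    smear κ (fun z => f (z - U)) = fun z => smear κ f (z - U) := by
  funext z
  simp only [smear, sub_add_eq_add_sub]

theorem overlap_shift (f g : Plane → ℝ≥0∞) (U : Plane) :
    overlap (fun z => f (z - U)) (fun z => g (z - U)) = overlap f g :=
  lintegral_sub_right_eq_self (fun z => f z * g z) U

theorem const_mul_mass_sq (hα : 2 < α) {ε : ℝ} (hε : 0 < ε) {D : ℝ} (hD : 0 ≤ D)
    {U₁ U₂ : Plane} : ENNReal.ofReal D * (∫⁻ z, gain α ε U₁ z) * ∫⁻ z, gain α ε U₂ z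
      = ENNReal.ofReal (D * (∫⁻ z, ENNReal.ofReal (pathLoss α 1 z)).toReal ^ 2
        * massScale α ε ^ 2) := by
  have hp := massScale_pos (α := α) hε
  rw [lintegral_gain_eq (by linarith) hε, lintegral_gain_eq (by linarith) hε,
    ENNReal.ofReal_mul (by positivity), ENNReal.ofReal_mul hD, ENNReal.ofReal_pow hp.le,
    ENNReal.ofReal_pow ENNReal.toReal_nonneg, ENNReal.ofReal_toReal
      (lintegral_pathLoss_one_ne_top hα)]
  ring

/-- One factor is bounded pointwise by the maximal disk density times its mass and the other is
integrated: two masses, hence `massScale` squared. -/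
theorem isAdmissibleKernel_smear (hα : 2 < α) {R : ℝ} (hR : 0 < R)
    [IsProbabilityMeasure (diskLaw R)] :
    IsAdmissibleKernel α (fun ε U₁ U₂ =>
      overlap (smear (diskLaw R) (gain α ε U₁)) (smear (diskLaw R) (gain α ε U₂))) where
  upper := by
    refine ⟨1 / (Real.pi * R ^ 2) * (∫⁻ z, ENNReal.ofReal (pathLoss α 1 z)).toReal ^ 2,
      by positivity, fun ε hε U₁ U₂ => ?_⟩
    have hg := measurable_gain α ε
    refine (overlap_le (smear_diskLaw_le hR (hg U₁)) (measurable_smear _ (hg U₂))).trans ?_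
    rw [lintegral_smear _ (hg U₂), const_mul_mass_sq hα hε (by positivity)]
  translate ε U := by
    rw [gain_eq_shift, smear_shift, overlap_shift]

/-- A further average over any probability law keeps both the pointwise bound and the mass, so the
constant is unchanged. -/
theorem isAdmissibleKernel_smear_smear (hα : 2 < α) {R : ℝ} (hR : 0 < R)
    [IsProbabilityMeasure (diskLaw R)] (κ : Measure Plane) [IsProbabilityMeasure κ] :
    IsAdmissibleKernel α (fun ε U₁ U₂ => overlap (smear κ (smear (diskLaw R) (gain α ε U₁)))
      (smear κ (smear (diskLaw R) (gain α ε U₂)))) where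
  upper := by
    refine ⟨1 / (Real.pi * R ^ 2) * (∫⁻ z, ENNReal.ofReal (pathLoss α 1 z)).toReal ^ 2,
      by positivity, fun ε hε U₁ U₂ => ?_⟩
    have hg := measurable_gain α ε
    have hs := fun U => measurable_smear (diskLaw R) (hg U)
    refine (overlap_le (smear_le (smear_diskLaw_le hR (hg U₁)))
      (measurable_smear _ (hs U₂))).trans ?_
    rw [lintegral_smear _ (hs U₂), lintegral_smear _ (hg U₂),
      const_mul_mass_sq hα hε (by positivity)]
  translate ε U := by
    rw [gain_eq_shift, smear_shift, smear_shift, overlap_shift]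

theorem isPositiveKernel_smear (hα : 2 < α) {c R : ℝ} (hc : 0 < c) (hR : 0 < R) :
    IsPositiveKernel α (fun ε U₁ U₂ => ENNReal.ofReal c *
      overlap (smear (diskLaw R) (gain α ε U₁)) (smear (diskLaw R) (gain α ε U₂))) := by
  intro E hE U₁ U₂
  obtain ⟨b, hb, h⟩ := exists_le_overlap_smear hα hR hE U₁ U₂
  refine ⟨c * b, by positivity, fun ε hε hεE => ?_⟩
  rw [mul_assoc, ENNReal.ofReal_mul hc.le]
  exact mul_le_mul_right (h ε hε hεE) _

theorem IsPositiveKernel.add (hK : IsPositiveKernel α K) (L : ℝ → Plane → Plane → ℝ≥0∞) :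
    IsPositiveKernel α (fun ε U₁ U₂ => K ε U₁ U₂ + L ε U₁ U₂) := by
  intro E hE U₁ U₂
  obtain ⟨b, hb, h⟩ := hK E hE U₁ U₂
  exact ⟨b, hb, fun ε hε hεE => le_add_right (h ε hε hεE)⟩

end Kernels

theorem toReal_overlap_gain_le {α ε : ℝ} (hα : 2 < α) (hε : 0 < ε) {U₁ U₂ : Plane}
    (hU : U₁ ≠ U₂) :
    (overlap (gain α ε U₁) (gain α ε U₂)).toReal ≤ 1 / (‖U₁ - U₂‖ / 2) ^ α
      * (2 * (∫⁻ z, ENNReal.ofReal (pathLoss α 1 z)).toReal) * massScale α ε := by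
  have hp := massScale_pos (α := α) hε
  refine (ENNReal.toReal_mono ?_ (overlap_gain_le (by linarith) hε hU)).trans (le_of_eq ?_)
  · exact ENNReal.mul_ne_top ENNReal.ofReal_ne_top (ENNReal.mul_ne_top (by simp)
      (ENNReal.mul_ne_top ENNReal.ofReal_ne_top (lintegral_pathLoss_one_ne_top hα)))
  · rw [ENNReal.toReal_mul, ENNReal.toReal_mul, ENNReal.toReal_mul,
      ENNReal.toReal_ofReal (by positivity), ENNReal.toReal_ofReal hp.le, ENNReal.toReal_ofNat]
    ring

theorem overlap_gain_self_pos {α ε : ℝ} (hα : 2 < α) (hε : 0 < ε) :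
    0 < (overlap (gain α ε 0) (gain α ε 0)).toReal := by
  refine ENNReal.toReal_pos ?_ (overlap_gain_ne_top hα hε 0 0)
  rw [overlap_gain_self (by linarith) hε]
  have hp := massScale_pos (α := α) hε
  exact mul_ne_zero (ENNReal.ofReal_pos.2 (by positivity)).ne' lintegral_pathLoss_one_sq_ne_zero

theorem exists_overlap_gain_self_eq {α : ℝ} (hα : 2 < α) : ∃ G₁ : ℝ, 0 < G₁ ∧
    ∀ ε, 0 < ε → (overlap (gain α ε 0) (gain α ε 0)).toReal = massScale α ε / ε * G₁ := by
  refine ⟨_, ENNReal.toReal_pos lintegral_pathLoss_one_sq_ne_zero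
    (lintegral_pathLoss_one_sq_ne_top hα), fun ε hε => ?_⟩
  have := massScale_pos (α := α) hε
  rw [overlap_gain_self (by linarith) hε, ENNReal.toReal_mul,
    ENNReal.toReal_ofReal (by positivity)]

/-! ### Correlation coefficients and comparison with the Poisson process -/

section Correlation

variable {Ω ι : Type*} [MeasurableSpace Ω] {Φ : InterfererField Ω ι} {μ : Measure Ω} {α lam : ℝ} {K : ℝ → Plane → Plane → ℝ≥0∞}

namespace HasCovarianceKernel

theorem mean_ne_top (h : HasCovarianceKernel Φ μ α lam K) (hα : 2 < α) {ε : ℝ} (hε : 0 < ε)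
    (U : Plane) (t : ℕ) :
    ∫⁻ ω, ∑' i, ENNReal.ofReal (Φ.contribution α ε U t i ω) ∂μ ≠ ⊤ := by
  rw [h.mean ε hε, lintegral_gain_eq (by linarith) hε]
  exact ENNReal.mul_ne_top ENNReal.ofReal_ne_top
    (ENNReal.mul_ne_top ENNReal.ofReal_ne_top (lintegral_pathLoss_one_ne_top hα))

theorem covariance_density_ne_top (hK : IsAdmissibleKernel α K) (hα : 2 < α)
    (lam : ℝ) {ε : ℝ} (hε : 0 < ε) (U₁ U₂ : Plane) (t₁ t₂ : ℕ) :
    ENNReal.ofReal lam * (fadingFactor U₁ U₂ t₁ t₂ * overlap (gain α ε U₁) (gain α ε U₂)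
      + K ε U₁ U₂) ≠ ⊤ := by
  refine ENNReal.mul_ne_top ENNReal.ofReal_ne_top (ENNReal.add_ne_top.2
    ⟨ENNReal.mul_ne_top ?_ (overlap_gain_ne_top hα hε U₁ U₂), hK.ne_top hε U₁ U₂⟩)
  unfold fadingFactor
  split_ifs <;> simp

variable [Countable ι]

theorem ae_summable (h : HasCovarianceKernel Φ μ α lam K) (hα : 2 < α) {ε : ℝ} (hε : 0 < ε)
    (U : Plane) (t : ℕ) : ∀ᵐ ω ∂μ, Summable fun i => Φ.contribution α ε U t i ω :=
  ae_summable_of_lintegral_ne_top (h.measurable ε U t) (h.nonneg ε hε U t)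
    (h.mean_ne_top hα hε U t)

theorem memLp (h : HasCovarianceKernel Φ μ α lam K) (hK : IsAdmissibleKernel α K) (hα : 2 < α)
    {ε : ℝ} (hε : 0 < ε) (U : Plane) (t : ℕ) : MemLp (Φ.power α ε U t) 2 μ := by
  refine memLp_two_tsum (h.measurable ε U t) (h.nonneg ε hε U t) (h.ae_summable hα hε U t) ?_
  rw [h.mul ε hε, ← h.mean ε hε U t]
  exact ENNReal.add_ne_top.2 ⟨covariance_density_ne_top hK hα lam hε U U t t,
    ENNReal.mul_ne_top (h.mean_ne_top hα hε U t) (h.mean_ne_top hα hε U t)⟩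

variable [IsProbabilityMeasure μ]

theorem covariance_power (h : HasCovarianceKernel Φ μ α lam K) (hK : IsAdmissibleKernel α K)
    (hα : 2 < α) (hlam : 0 ≤ lam) {ε : ℝ} (hε : 0 < ε) (U₁ U₂ : Plane) (t₁ t₂ : ℕ) :
    cov[Φ.power α ε U₁ t₁, Φ.power α ε U₂ t₂; μ]
      = lam * ((fadingFactor U₁ U₂ t₁ t₂).toReal
        * (overlap (gain α ε U₁) (gain α ε U₂)).toReal + (K ε U₁ U₂).toReal) := by
  have hfin : fadingFactor U₁ U₂ t₁ t₂ ≠ ⊤ := by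
    unfold fadingFactor
    split_ifs <;> simp
  have hc := covariance_tsum (h.memLp hK hα hε U₁ t₁) (h.memLp hK hα hε U₂ t₂)
    (h.nonneg ε hε U₁ t₁) (h.nonneg ε hε U₂ t₂) (h.ae_summable hα hε U₁ t₁)
    (h.ae_summable hα hε U₂ t₂) (covariance_density_ne_top hK hα lam hε U₁ U₂ t₁ t₂)
    (h.mean_ne_top hα hε U₁ t₁) (h.mean_ne_top hα hε U₂ t₂)
    (by rw [h.mul ε hε, h.mean ε hε, h.mean ε hε])
  refine hc.trans ?_
  rw [ENNReal.toReal_mul, ENNReal.toReal_ofReal hlam, ENNReal.toReal_add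
    (ENNReal.mul_ne_top hfin (overlap_gain_ne_top hα hε U₁ U₂)) (hK.ne_top hε U₁ U₂),
    ENNReal.toReal_mul]

theorem variance_power (h : HasCovarianceKernel Φ μ α lam K) (hK : IsAdmissibleKernel α K)
    (hα : 2 < α) (hlam : 0 ≤ lam) {ε : ℝ} (hε : 0 < ε) (U : Plane) (t : ℕ) :
    Var[Φ.power α ε U t; μ]
      = lam * (2 * (overlap (gain α ε 0) (gain α ε 0)).toReal + (K ε 0 0).toReal) := by
  rw [← covariance_self (h.memLp hK hα hε U t).aemeasurable,
    h.covariance_power hK hα hlam hε U U t t, hK.translate,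
    overlap_gain_self (by linarith) hε, overlap_gain_self (by linarith) hε]
  simp [fadingFactor]

theorem wellPosed (h : HasCovarianceKernel Φ μ α lam K) (hK : IsAdmissibleKernel α K)
    (hα : 2 < α) (hlam : 0 < lam) : Φ.WellPosed μ α := by
  refine fun ε hε U t => ⟨h.ae_summable hα hε U t, h.memLp hK hα hε U t, ?_⟩
  rw [h.variance_power hK hα hlam.le hε]
  have := overlap_gain_self_pos hα hε
  have : 0 ≤ (K ε 0 0).toReal := ENNReal.toReal_nonneg
  positivity

/-- The variance does not depend on the location, so the two square roots multiply to a single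
variance, and the density cancels. -/
theorem corr_eq (h : HasCovarianceKernel Φ μ α lam K) (hK : IsAdmissibleKernel α K)
    (hα : 2 < α) (hlam : 0 < lam) {ε : ℝ} (hε : 0 < ε) {U₁ U₂ : Plane} {t₁ t₂ : ℕ}
    (hne : (U₁, t₁) ≠ (U₂, t₂)) :
    Φ.corr μ α U₁ U₂ t₁ t₂ ε
      = ((overlap (gain α ε U₁) (gain α ε U₂)).toReal + (K ε U₁ U₂).toReal)
        / (2 * (overlap (gain α ε 0) (gain α ε 0)).toReal + (K ε 0 0).toReal) := by
  have hg := overlap_gain_self_pos hα hε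
  have hk : 0 ≤ (K ε 0 0).toReal := ENNReal.toReal_nonneg
  rw [InterfererField.corr, h.variance_power hK hα hlam.le hε, h.variance_power hK hα hlam.le hε,
    Real.mul_self_sqrt (by positivity), h.covariance_power hK hα hlam.le hε,
    mul_div_mul_left _ _ hlam.ne', fadingFactor, if_neg hne, ENNReal.toReal_one, one_mul]

/-- The limit is independent of the kernel: an admissible excess is negligible against g, so every
such field shares the same coefficient. -/
theorem hasCorrCoef (h : HasCovarianceKernel Φ μ α lam K) (hK : IsAdmissibleKernel α K)
    (hα : 2 < α) (hlam : 0 < lam) {U₁ U₂ : Plane} {t₁ t₂ : ℕ} (hne : (U₁, t₁) ≠ (U₂, t₂)) :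
    Φ.HasCorrCoef μ α U₁ U₂ t₁ t₂ (open Classical in if U₁ = U₂ then 1 / 2 else 0) := by
  have hα0 : 0 < α := by linarith
  obtain ⟨C, hC, hCK⟩ := hK.upper
  obtain ⟨G₁, hG, hg⟩ := exists_overlap_gain_self_eq hα
  have hk : ∀ U₁ U₂ ε, 0 < ε → (K ε U₁ U₂).toReal ≤ C * massScale α ε ^ 2 := fun U₁ U₂ ε hε =>
    ENNReal.toReal_le_of_le_ofReal (by positivity) (hCK ε hε U₁ U₂)
  have hcorr : (fun ε => ((overlap (gain α ε U₁) (gain α ε U₂)).toReal + (K ε U₁ U₂).toReal)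
        / (2 * (overlap (gain α ε 0) (gain α ε 0)).toReal + (K ε 0 0).toReal))
      =ᶠ[𝓝[>] 0] Φ.corr μ α U₁ U₂ t₁ t₂ := by
    filter_upwards [self_mem_nhdsWithin] with ε hε
    exact (h.corr_eq hK hα hlam hε hne).symm
  refine Tendsto.congr' hcorr ?_
  split_ifs with hU
  · subst hU
    refine (tendsto_same hα0 hG hg (k := fun ε => (K ε 0 0).toReal)
      (fun _ _ => ENNReal.toReal_nonneg) (hk 0 0)).congr' ?_
    filter_upwards [self_mem_nhdsWithin] with ε hε
    rw [hK.translate ε U₁, overlap_gain_self hα0 hε, overlap_gain_self hα0 hε]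
  · refine tendsto_different hα0 hG hg (fun _ _ => ENNReal.toReal_nonneg)
      (fun _ _ => ENNReal.toReal_nonneg) (hk U₁ U₂) (fun _ _ => ENNReal.toReal_nonneg)
      (B := 1 / (‖U₁ - U₂‖ / 2) ^ α
        * (2 * (∫⁻ z, ENNReal.ofReal (pathLoss α 1 z)).toReal)) fun ε hε => ?_
    exact toReal_overlap_gain_le hα hε hU

variable {Ω' ι' : Type*} [MeasurableSpace Ω'] [Countable ι'] {Ψ : InterfererField Ω' ι'}
  {ν : Measure Ω'} [IsProbabilityMeasure ν]

theorem corr_lt_of_same_location (hP : HasCovarianceKernel Φ μ α lam (fun _ _ _ => 0))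
    (h : HasCovarianceKernel Ψ ν α lam K) (hK : IsAdmissibleKernel α K)
    (hK' : IsPositiveKernel α K) (hα : 2 < α) (hlam : 0 < lam) {U : Plane} {t₁ t₂ : ℕ}
    (hne : (U, t₁) ≠ (U, t₂)) {ε : ℝ} (hε : 0 < ε) :
    Φ.corr μ α U U t₁ t₂ ε < Ψ.corr ν α U U t₁ t₂ ε := by
  rw [hP.corr_eq isAdmissibleKernel_zero hα hlam hε hne, h.corr_eq hK hα hlam hε hne,
    hK.translate, overlap_gain_self (by linarith) hε U, ← overlap_gain_self (by linarith) hε 0]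
  simp only [ENNReal.toReal_zero, add_zero]
  have hg := overlap_gain_self_pos hα hε
  -- The ceiling is taken to be ε itself, so the argument covers every positive ε.
  obtain ⟨b, hb, hbK⟩ := hK' ε hε 0 0
  have hp := massScale_pos (α := α) hε
  have hk : 0 < (K ε 0 0).toReal := ENNReal.toReal_pos
    ((ENNReal.ofReal_pos.2 (by positivity)).trans_le (hbK ε hε le_rfl)).ne' (hK.ne_top hε 0 0)
  refine div_lt_div_add hg hk.le ?_
  nlinarith [mul_pos hg hk]

theorem eventually_corr_lt (hP : HasCovarianceKernel Φ μ α lam (fun _ _ _ => 0))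
    (h : HasCovarianceKernel Ψ ν α lam K) (hK : IsAdmissibleKernel α K)
    (hK' : IsPositiveKernel α K) (hα : 2 < α) (hlam : 0 < lam) {U₁ U₂ : Plane} {t₁ t₂ : ℕ}
    (hne : (U₁, t₁) ≠ (U₂, t₂)) :
    ∀ᶠ ε in 𝓝[>] (0 : ℝ), Φ.corr μ α U₁ U₂ t₁ t₂ ε < Ψ.corr ν α U₁ U₂ t₁ t₂ ε := by
  have hα0 : 0 < α := by linarith
  by_cases hU : U₁ = U₂
  · subst hU
    filter_upwards [self_mem_nhdsWithin] with ε hε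
    exact hP.corr_lt_of_same_location h hK hK' hα hlam hne hε
  obtain ⟨C, hC, hCK⟩ := hK.upper
  obtain ⟨b, hb, hbK⟩ := hK' 1 one_pos U₁ U₂
  obtain ⟨G₁, hG, hg⟩ := exists_overlap_gain_self_eq hα
  have hB : 0 ≤ 1 / (‖U₁ - U₂‖ / 2) ^ α
      * (2 * (∫⁻ z, ENNReal.ofReal (pathLoss α 1 z)).toReal) := by positivity
  have hlt := eventually_lt_different hα0 hG hg (k := fun ε => (K ε 0 0).toReal)
    (k₁₂ := fun ε => (K ε U₁ U₂).toReal) (fun _ _ => ENNReal.toReal_nonneg)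
    (fun ε hε => ENNReal.toReal_le_of_le_ofReal (by positivity) (hCK ε hε 0 0)) hb
    (fun ε hε hε1 => (ENNReal.ofReal_le_iff_le_toReal (hK.ne_top hε U₁ U₂)).1 (hbK ε hε hε1))
    hB (fun ε hε => toReal_overlap_gain_le hα hε hU)
  filter_upwards [self_mem_nhdsWithin, hlt] with ε hε h1
  rw [hP.corr_eq isAdmissibleKernel_zero hα hlam hε hne, h.corr_eq hK hα hlam hε hne]
  simpa using h1

theorem compare (hP : HasCovarianceKernel Φ μ α lam (fun _ _ _ => 0))
    (h : HasCovarianceKernel Ψ ν α lam K) (hK : IsAdmissibleKernel α K)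
    (hK' : IsPositiveKernel α K) (hα : 2 < α) (hlam : 0 < lam) {U₁ U₂ : Plane} {t₁ t₂ : ℕ}
    (hne : (U₁, t₁) ≠ (U₂, t₂)) {F : ℝ → ℝ} (hF : ∀ ε, 0 < ε → 0 < F ε) :
    (∀ᶠ ε in 𝓝[>] (0 : ℝ),
      Φ.corr μ α U₁ U₂ t₁ t₂ ε ≤ Ψ.corr ν α U₁ U₂ t₁ t₂ ε ∧
      (Ψ.corr ν α U₁ U₂ t₁ t₂ ε = Φ.corr μ α U₁ U₂ t₁ t₂ ε ↔ F ε = 0)) ∧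
    (U₁ = U₂ → ∀ ε : ℝ, 0 < ε →
      Φ.corr μ α U₁ U₂ t₁ t₂ ε ≤ Ψ.corr ν α U₁ U₂ t₁ t₂ ε ∧
      (Ψ.corr ν α U₁ U₂ t₁ t₂ ε = Φ.corr μ α U₁ U₂ t₁ t₂ ε ↔ F ε = 0)) := by
  have key : ∀ ε, 0 < ε → Φ.corr μ α U₁ U₂ t₁ t₂ ε < Ψ.corr ν α U₁ U₂ t₁ t₂ ε →
      Φ.corr μ α U₁ U₂ t₁ t₂ ε ≤ Ψ.corr ν α U₁ U₂ t₁ t₂ ε ∧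
      (Ψ.corr ν α U₁ U₂ t₁ t₂ ε = Φ.corr μ α U₁ U₂ t₁ t₂ ε ↔ F ε = 0) := fun ε hε hlt =>
    ⟨hlt.le, iff_of_false hlt.ne' (hF ε hε).ne'⟩
  refine ⟨?_, ?_⟩
  · filter_upwards [self_mem_nhdsWithin, hP.eventually_corr_lt h hK hK' hα hlam hne] with ε hε hlt
    exact key ε hε hlt
  · rintro rfl ε hε
    exact key ε hε (hP.corr_lt_of_same_location h hK hK' hα hlam hne hε)

end HasCovarianceKernel
end Correlation

end Interference

theorem proposition1
    {ΩP ΩM ΩS : Type*} [MeasurableSpace ΩP] [MeasurableSpace ΩM] [MeasurableSpace ΩS]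
    (μP : Measure ΩP) (μM : Measure ΩM) (μS : Measure ΩS)
    [IsProbabilityMeasure μP] [IsProbabilityMeasure μM] [IsProbabilityMeasure μS]
    (α : ℝ) (hα : 2 < α)
    (lamP : ℝ) (hlamP : 0 < lamP) (P : Interference.PPPModel μP lamP)
    (lamMo cM RM : ℝ) (hlamMo : 0 < lamMo) (hcM : 0 < cM) (hRM : 0 < RM)
    (M : Interference.MCPModel μM lamMo cM RM)
    (lamSo cS' RS' σ cS RS : ℝ) (hlamSo : 0 < lamSo) (hcS' : 0 < cS') (hRS' : 0 < RS')
    (hσ : 0 < σ) (hcS : 0 < cS) (hRS : 0 < RS)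
    (S : Interference.SOCPModel μS lamSo cS' RS' σ cS RS)
    (U₁ U₂ : Plane) (t₁ t₂ : ℕ) (hne : (U₁, t₁) ≠ (U₂, t₂)) :
    P.field.WellPosed μP α ∧ M.field.WellPosed μM α ∧ S.field.WellPosed μS α ∧
    ∃ ζP ζM ζS : ℝ,
      P.field.HasCorrCoef μP α U₁ U₂ t₁ t₂ ζP ∧
      M.field.HasCorrCoef μM α U₁ U₂ t₁ t₂ ζM ∧
      S.field.HasCorrCoef μS α U₁ U₂ t₁ t₂ ζS ∧
      (lamP = lamMo * cM →
        ζP ≤ ζM ∧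
        ((∀ᶠ ε in 𝓝[>] (0 : ℝ), Interference.clusterF α ε cM RM = 0) → ζM = ζP) ∧
        (∀ᶠ ε in 𝓝[>] (0 : ℝ),
          P.field.corr μP α U₁ U₂ t₁ t₂ ε ≤ M.field.corr μM α U₁ U₂ t₁ t₂ ε ∧
          (M.field.corr μM α U₁ U₂ t₁ t₂ ε = P.field.corr μP α U₁ U₂ t₁ t₂ ε ↔
            Interference.clusterF α ε cM RM = 0)) ∧
        (U₁ = U₂ → ∀ ε : ℝ, 0 < ε →
          P.field.corr μP α U₁ U₂ t₁ t₂ ε ≤ M.field.corr μM α U₁ U₂ t₁ t₂ ε ∧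
          (M.field.corr μM α U₁ U₂ t₁ t₂ ε = P.field.corr μP α U₁ U₂ t₁ t₂ ε ↔
            Interference.clusterF α ε cM RM = 0))) ∧
      (lamP = lamSo * cS' * cS →
        ζP ≤ ζS ∧
        ((∀ᶠ ε in 𝓝[>] (0 : ℝ), Interference.clusterF α ε cS RS = 0) → ζS = ζP) ∧
        (∀ᶠ ε in 𝓝[>] (0 : ℝ),
          P.field.corr μP α U₁ U₂ t₁ t₂ ε ≤ S.field.corr μS α U₁ U₂ t₁ t₂ ε ∧
          (S.field.corr μS α U₁ U₂ t₁ t₂ ε = P.field.corr μP α U₁ U₂ t₁ t₂ ε ↔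
            Interference.clusterF α ε cS RS = 0)) ∧
        (U₁ = U₂ → ∀ ε : ℝ, 0 < ε →
          P.field.corr μP α U₁ U₂ t₁ t₂ ε ≤ S.field.corr μS α U₁ U₂ t₁ t₂ ε ∧
          (S.field.corr μS α U₁ U₂ t₁ t₂ ε = P.field.corr μP α U₁ U₂ t₁ t₂ ε ↔
            Interference.clusterF α ε cS RS = 0))) := by
  have hP := P.hasCovarianceKernel hlamP.le α
  have hM := M.hasCovarianceKernel hlamMo.le α
  have hS := S.hasCovarianceKernel hlamSo.le hcS'.le α
  have hlamM : 0 < lamMo * cM := mul_pos hlamMo hcM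
  have hlamS : 0 < lamSo * cS' * cS := mul_pos (mul_pos hlamSo hcS') hcS
  have hprobM : IsProbabilityMeasure (Interference.diskLaw RM) :=
    (M.law_Y 0 0).isProbabilityMeasure_iff.1 inferInstance
  have hprobS : IsProbabilityMeasure (Interference.diskLaw RS) :=
    (S.law_W 0 0 0).isProbabilityMeasure_iff.1 inferInstance
  have hprobV : IsProbabilityMeasure
      (Interference.radialLaw (Interference.reverseGaussianDensity σ RS')) :=
    (S.law_V 0 0).isProbabilityMeasure_iff.1 inferInstance
  have hP' := Interference.isAdmissibleKernel_zero (α := α)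
  have hM' := (Interference.isAdmissibleKernel_smear hα hRM).const_mul cM
  have hS' := ((Interference.isAdmissibleKernel_smear hα hRS).const_mul cS).add
    ((Interference.isAdmissibleKernel_smear_smear hα hRS
      (Interference.radialLaw (Interference.reverseGaussianDensity σ RS'))).const_mul (cS' * cS))
  -- Splits the single constant so that the kernel matches the one in
  -- `SOCPModel.hasCovarianceKernel`.
  simp only [ENNReal.ofReal_mul hcS'.le] at hS'
  have hMpos := Interference.isPositiveKernel_smear hα hcM hRM
  have hSpos := (Interference.isPositiveKernel_smear hα hcS hRS).add
    (fun ε U₁ U₂ => ENNReal.ofReal cS' * ENNReal.ofReal cS *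
      Interference.overlap
        (Interference.smear (Interference.radialLaw (Interference.reverseGaussianDensity σ RS'))
          (Interference.smear (Interference.diskLaw RS) (Interference.gain α ε U₁)))
        (Interference.smear (Interference.radialLaw (Interference.reverseGaussianDensity σ RS'))
          (Interference.smear (Interference.diskLaw RS) (Interference.gain α ε U₂))))
  refine ⟨hP.wellPosed hP' hα hlamP, hM.wellPosed hM' hα hlamM, hS.wellPosed hS' hα hlamS,
    _, _, _, hP.hasCorrCoef hP' hα hlamP hne, hM.hasCorrCoef hM' hα hlamM hne,
    hS.hasCorrCoef hS' hα hlamS hne, ?_, ?_⟩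
  · rintro rfl
    -- The limits supplied by `hasCorrCoef` are literally the same number, so the claims on them are
    -- reflexivity; the content lies in the comparison at positive ε.
    exact ⟨le_rfl, fun _ => rfl, hP.compare hM hM' hMpos hα hlamM hne
      fun ε hε => Interference.clusterF_pos hα hε hcM hRM⟩
  · rintro rfl
    exact ⟨le_rfl, fun _ => rfl, hP.compare hS hS' hSpos hα hlamS hne
      fun ε hε => Interference.clusterF_pos hα hε hcS hRS⟩
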